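/- Let $V=\bigoplus_i V^i$ be a finite dimensional $\mathbb Z$-graded vector space over a field $\mathbb K$ of characteristic $0$, and let $V[1]$ be $V$ with the degree $\deg x=|x|-1$. Signs follow Koszul's rule with respect to $\deg$; scalars have degree $0$. **Forms.** An $n$-linear form $\Omega$ on $V[1]$ is cyclic if $\Omega(x_n,x_1,\dots,x_{n-1})=\Omega(x_1,\dots,x_n)$ (with the Koszul sign); $\mathcal C^n$ is the space of these forms and $\mathcal C(V)=\prod_{n\ge 0}\mathcal C^n$. A form $\Omega\in\mathcal C(V)$ belongs to $\mathcal C_{vsp}(V)$ if for all $k$ and $y$ the map $(x_1,\dots,x_k)\mapsto\Omega(x_1,\dots,x_k,y)$ vanishes on the images of all shuffle products $sh_{p,k-p}(x_{[1,p]},x_{[p+1,k]})=\sum_{\sigma\in Sh(p,k-p)}x_{\sigma^{-1}(1)}\otimes\dots\otimes x_{\sigma^{-1}(k)}$, $0<p<k$. **Pinczon brackets.** A metric is a non degenerate, graded symmetric bilinear form $b$ of degree $0$ on $V$; it corresponds to the symplectic form (non degenerate, graded antisymmetric, of degree $2$) $B(x,y)=(-1)^{\deg x}b(x,y)$ on $V[1]$.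 A Pinczon bracket is a bilinear map $\{\ ,\ \}$ on $\mathcal C(V)$ such that $\{\mathcal C^{k+1},\mathcal C^{l+1}\}\subset\mathcal C^{k+l}$; which is a graded Lie bracket (it lowers the total degree of forms by $2$, is graded antisymmetric and satisfies the graded Jacobi identity); for which $\{\alpha,(\beta_1\otimes\dots\otimes\beta_k)^{Cycl}\}=\sum_j\{\alpha,\beta_j\}(\beta_1\otimes\dots\hat{\beta_j}\dots\otimes\beta_k)^{Cycl}$ (with the Koszul signs) for linear forms $\alpha,\beta_1,\dots,\beta_k$; for which $\mathcal C^0$ is central and no nonzero linear form is central; and which is given, for some metric $b$, by the Pinczon-Ushirobira formula $$\{\Omega,\Omega'\}=\sum_i\left(\iota_{e_i}\Omega\otimes\iota_{e'_i}\Omega'\right)^{Cycl},\qquad b(e_i,e'_j)=\delta_{ij},$$ for every homogeneous basis $(e_i)$ of $V$, where $(\iota_e\Omega)(x_1,\dots,x_k)=\Omega(x_1,\dots,x_k,e)$ and $Cycl$ denotes the sum over all cyclic permutations of the arguments. We then say that the bracket is associated with $b$, or with $B$. A commutative Pinczon algebra structure on $V$ is a pair $(\{\ ,\ \},\Omega)$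 of a Pinczon bracket and a form $\Omega\in\mathcal C_{vsp}(V)$ of degree $3$ without linear component, such that $\{\Omega,\Omega\}=0$. **Quadratic $C_\infty$ algebras.** A $C_\infty$ structure on $V$ is a family $Q=(Q_k)_{k\ge1}$ (the Taylor coefficients of a coderivation) of $k$-linear maps $Q_k:V[1]^k\to V[1]$ of degree $1$ which vanish on shuffle products and satisfy $[Q,Q]=0$, where $[Q,Q']=Q\circ Q'-(-1)^{\deg Q\deg Q'}Q'\circ Q$ and $$(Q\circ Q')(x_{[1,n]})=\sum_{j,\,r}(-1)^{\deg Q'\,(\deg x_1+\dots+\deg x_r)}\,Q(x_{[1,r]},Q'_j(x_{[r+1,r+j]}),x_{[r+j+1,n]}).$$ Put $\Omega_Q(x_1,\dots,x_{k+1})=B(Q_k(x_1,\dots,x_k),x_{k+1})$; $Q$ is $B$-quadratic if $\Omega_Q$ is cyclic. **Proposition.** (1) Let $(\{\ ,\ \},\Omega)$ be a commutative Pinczon algebra structure on $V$. There is a unique symplectic form $B$ on $V[1]$ with which $\{\ ,\ \}$ is associated, and there is a unique family $Q$ of multilinear maps such that $\Omega=\Omega_Q$; this $Q$ is a $B$-quadratic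 $C_\infty$ structure on $V$. (2) Conversely, let $b$ be a metric on $V$, let $B$ be the corresponding symplectic form on $V[1]$, and let $Q$ be a $B$-quadratic $C_\infty$ structure on $V$. There is a unique commutative Pinczon algebra structure $(\{\ ,\ \},\Omega)$ on $V$ such that $\{\ ,\ \}$ is associated with $B$ and $\Omega=\Omega_Q$. So commutative Pinczon algebra structures on $V$ correspond bijectively to pairs $(B,Q)$ as in (2), that is, to quadratic $C_\infty$ algebra structures on $V$. -/

import Mathlib

namespace Pinczon

noncomputable section

/-! ## Graded spaces, the shift `V[1]`, Koszul signs -/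

section Basic

variable {K V : Type*} [Field K] [AddCommGroup V] [Module K V]

/-- The grading of `V[1]`: a vector of degree `|x|` in `V` has degree `deg x = |x| - 1` in `V[1]`. -/
def shiftOne (𝒱 : ℤ → Submodule K V) : ℤ → Submodule K V := fun d => 𝒱 (d + 1)

/-- `x` is a tuple of homogeneous vectors of `V[1]`, of degrees `deg (x i) = d i`. -/
def IsHomTuple (𝒱 : ℤ → Submodule K V) {n : ℕ} (d : Fin n → ℤ) (x : Fin n → V) : Prop :=
  ∀ i, x i ∈ shiftOne 𝒱 (d i)

/-- The Koszul sign of the rearrangement that moves letter `i`, of degree `d i`, to place `σ i`: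
a factor `(-1) ^ (d i * d j)` for every inversion. -/
def koszulSign {n : ℕ} (σ : Equiv.Perm (Fin n)) (d : Fin n → ℤ) : ℤˣ :=
  ∏ p ∈ Finset.univ.filter (fun p : Fin n × Fin n => p.1 < p.2 ∧ σ p.2 < σ p.1),
    (d p.1 * d p.2).negOnePow

/-- The subgroup of `𝔖ₙ` generated by the cycle `(1, 2, …, n)`, as a finite set. -/
def cyclicPerms (n : ℕ) : Finset (Equiv.Perm (Fin n)) := by
  classical exact Finset.univ.filter (fun σ => σ ∈ Subgroup.zpowers (finRotate n))

/-- The `(p, n - p)` shuffles. -/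
def shuffles (p n : ℕ) : Finset (Equiv.Perm (Fin n)) := by
  classical exact Finset.univ.filter (fun σ =>
    StrictMonoOn σ {i | i.val < p} ∧ StrictMonoOn σ {i | p ≤ i.val})

/-- A function of `n` vectors of `V[1]` vanishes on the images of all the shuffle products
`sh_{p, n-p}`, `0 < p < n`. -/
def VanishesOnShuffles {M : Type*} [AddCommGroup M] (𝒱 : ℤ → Submodule K V) {n : ℕ}
    (F : (Fin n → V) → M) : Prop :=
  ∀ p : ℕ, 0 < p → p < n → ∀ (d : Fin n → ℤ) (x : Fin n → V), IsHomTuple 𝒱 d x →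
    ∑ σ ∈ shuffles p n, koszulSign σ d • F (x ∘ σ.symm) = 0

end Basic

/-! ## Cyclic forms on `V[1]` -/

/-- `n`-linear forms. -/
abbrev Form (K V : Type*) [Field K] [AddCommGroup V] [Module K V] (n : ℕ) : Type _ :=
  MultilinearMap K (fun _ : Fin n => V) K

/-- `n`-linear maps with values in the space itself. -/
abbrev Op (K V : Type*) [Field K] [AddCommGroup V] [Module K V] (n : ℕ) : Type _ :=
  MultilinearMap K (fun _ : Fin n => V) V

section Forms

variable {K V : Type*} [Field K] [AddCommGroup V] [Module K V]

/-- `Ω(xₙ, x₁, …, xₙ₋₁) = Ω(x₁, …, xₙ)`, with the Koszul sign. -/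
def IsCyclic (𝒱 : ℤ → Submodule K V) {n : ℕ} (Ω : Form K V n) : Prop :=
  ∀ (d : Fin n → ℤ) (x : Fin n → V), IsHomTuple 𝒱 d x →
    koszulSign (finRotate n) d • Ω (x ∘ (finRotate n).symm) = Ω x

/-- The space `𝒞(V)` of (formal sums over all arities of) cyclic multilinear forms on `V[1]`:
an element has one component, an `n`-linear cyclic form, for each `n`. -/
def cyclicForms (𝒱 : ℤ → Submodule K V) : Submodule K (∀ n, Form K V n) where
  carrier := {Ω | ∀ n, IsCyclic 𝒱 (Ω n)}
  zero_mem' := by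
    intro n d x _
    simp
  add_mem' := by
    intro Ω Ω' h h' n d x hx
    have h1 := h n d x hx
    have h2 := h' n d x hx
    simp only [Pi.add_apply, add_apply, smul_add]
    rw [h1, h2]
  smul_mem' := by
    intro c Ω h n d x hx
    have h1 := h n d x hx
    simp only [Pi.smul_apply, smul_apply]
    rw [smul_comm, h1]

/-- `Ω` has only an `n`-linear component, i.e. `Ω ∈ 𝒞ⁿ`. -/
def HasArity {𝒱 : ℤ → Submodule K V} (n : ℕ) (Ω : cyclicForms 𝒱) : Prop :=
  ∀ m, m ≠ n → Ω.1 m = 0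

/-- `Ω` is homogeneous of degree `p` as a form on `V[1]` (scalars have degree `0`). -/
def HasFormDegree {𝒱 : ℤ → Submodule K V} (p : ℤ) (Ω : cyclicForms 𝒱) : Prop :=
  ∀ (n : ℕ) (d : Fin n → ℤ) (x : Fin n → V), IsHomTuple 𝒱 d x → Ω.1 n x ≠ 0 → (∑ i, d i) + p = 0

/-- `Ω ∈ 𝒞_vsp(V)`: for every `y`, the map `x ↦ Ω(x₁, …, xₖ, y)` vanishes on shuffle products. -/
def IsVsp {𝒱 : ℤ → Submodule K V} (Ω : cyclicForms 𝒱) : Prop :=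
  ∀ (k : ℕ) (y : V), VanishesOnShuffles 𝒱
    (fun x : Fin k → V => Ω.1 (k + 1) (Fin.snoc (α := fun _ => V) x y))

/-! ### Cyclic products of linear forms -/

/-- `β` is a linear form of degree `g` on `V[1]`. -/
def IsHomCovector (𝒱 : ℤ → Submodule K V) (g : ℤ) (β : Module.Dual K V) : Prop :=
  ∀ (d : ℤ) (v : V), v ∈ shiftOne 𝒱 d → β v ≠ 0 → d + g = 0

/-- `(β₁ ⊗ … ⊗ βₖ)(x₁, …, xₖ)` with its Koszul sign, `βⱼ` (degree `g j`) passing `xᵢ`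
(degree `d i`) for `i < j`. -/
def tensorValue {k : ℕ} (g : Fin k → ℤ) (β : Fin k → Module.Dual K V)
    (d : Fin k → ℤ) (x : Fin k → V) : K :=
  (∑ p ∈ Finset.univ.filter (fun p : Fin k × Fin k => p.1 < p.2), g p.2 * d p.1).negOnePow •
    ∏ i, β i (x i)

/-- `Λ = (β₁ ⊗ … ⊗ βₖ)^Cycl`. -/
def IsCyclicTensor {𝒱 : ℤ → Submodule K V} {k : ℕ} (g : Fin k → ℤ) (β : Fin k → Module.Dual K V)
    (Λ : cyclicForms 𝒱) : Prop :=
  HasArity k Λ ∧ ∀ (d : Fin k → ℤ) (x : Fin k → V), IsHomTuple 𝒱 d x →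
    Λ.1 k x = ∑ τ ∈ cyclicPerms k,
      koszulSign τ d • tensorValue g β (d ∘ τ.symm) (x ∘ τ.symm)

/-! ### Metrics on `V`, symplectic forms on `V[1]` -/

/-- A non degenerate, (graded) symmetric bilinear form of degree `0` on `V`. -/
structure IsMetric (𝒱 : ℤ → Submodule K V) (b : V →ₗ[K] V →ₗ[K] K) : Prop where
  degree_zero : ∀ (i j : ℤ) (x y : V), x ∈ 𝒱 i → y ∈ 𝒱 j → b x y ≠ 0 → i + j = 0
  symm : ∀ (i j : ℤ) (x y : V), x ∈ 𝒱 i → y ∈ 𝒱 j → b x y = (i * j).negOnePow • b y x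
  nondegenerate : ∀ x, (∀ y, b x y = 0) → x = 0

/-- A non degenerate, (graded) antisymmetric bilinear form on `V[1]`, of degree `2`. -/
structure IsSymplectic (𝒱 : ℤ → Submodule K V) (B : V →ₗ[K] V →ₗ[K] K) : Prop where
  degree_two : ∀ (i j : ℤ) (x y : V), x ∈ shiftOne 𝒱 i → y ∈ shiftOne 𝒱 j → B x y ≠ 0 →
    i + j + 2 = 0
  antisymm : ∀ (i j : ℤ) (x y : V), x ∈ shiftOne 𝒱 i → y ∈ shiftOne 𝒱 j →
    B x y = -((i * j).negOnePow • B y x)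
  nondegenerate : ∀ x, (∀ y, B x y = 0) → x = 0

/-- `B(x, y) = (-1)^{deg x} b(x, y)`. -/
def IsShiftedForm (𝒱 : ℤ → Submodule K V) (b B : V →ₗ[K] V →ₗ[K] K) : Prop :=
  ∀ (i : ℤ) (x y : V), x ∈ shiftOne 𝒱 i → B x y = i.negOnePow • b x y

/-! ### The Pinczon bracket -/

/-- The first `k` entries of a tuple. -/
def firstPart {α : Type*} {n : ℕ} (k : Fin (n + 1)) (x : Fin n → α) : Fin k.val → α :=
  fun a => x ⟨a.val, by omega⟩

/-- The last `n - k` entries of a tuple. -/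
def lastPart {α : Type*} {n : ℕ} (k : Fin (n + 1)) (x : Fin n → α) : Fin (n - k.val) → α :=
  fun a => x ⟨k.val + a.val, by omega⟩

/-- The value of `∑ᵢ ι_{eᵢ}Ω ⊗ ι_{e'ᵢ}Ω'` on `(x₁, …, xₙ)`, where `Ω` is `(k+1)`-linear, `Ω'` is
`(n-k+1)`-linear and `ι_e Ω (x₁, …, xₖ) = Ω(x₁, …, xₖ, e)`. The Koszul sign
`(-1)^{e'ᵢ Ω + (e'ᵢ + Ω') X}`, `X = x₁ + ⋯ + xₖ`, `Y = xₖ₊₁ + ⋯ + xₙ`, is written out with the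
congruences `e'ᵢ ≡ eᵢ`, `Ω ≡ X + eᵢ`, `Ω' ≡ Y + eᵢ` that hold on all nonzero terms;
`c i` is the degree of `eᵢ` in `V[1]`. -/
def contraction {ι : Type*} [Fintype ι] (c : ι → ℤ) (e e' : ι → V) (Ω Ω' : ∀ n, Form K V n)
    {n : ℕ} (k : Fin (n + 1)) (d : Fin n → ℤ) (x : Fin n → V) : K :=
  ∑ i, (c i + (∑ a, firstPart k d a) * (c i + ∑ a, lastPart k d a)).negOnePow •
    (Ω (k.val + 1) (Fin.snoc (α := fun _ => V) (firstPart k x) (e i)) *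
      Ω' (n - k.val + 1) (Fin.snoc (α := fun _ => V) (lastPart k x) (e' i)))

/-- `{Ω, Ω'} = ∑ᵢ ι_{eᵢ}Ω ⊙ ι_{e'ᵢ}Ω'` (cyclic product) for every homogeneous basis `(eᵢ)` and
the family `(e'ᵢ)` with `b(eᵢ, e'ⱼ) = δᵢⱼ`. The `n`-linear component of the bracket collects
the `(k+1)`-linear component of `Ω` and the `(n-k+1)`-linear component of `Ω'`, `0 ≤ k ≤ n`. -/
def IsPinczonUshirobira (𝒱 : ℤ → Submodule K V) (b : V →ₗ[K] V →ₗ[K] K)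
    (br : cyclicForms 𝒱 →ₗ[K] cyclicForms 𝒱 →ₗ[K] cyclicForms 𝒱) : Prop :=
  ∀ (e : Module.Basis (Fin (Module.finrank K V)) K V) (c : Fin (Module.finrank K V) → ℤ)
    (e' : Fin (Module.finrank K V) → V),
    (∀ i, e i ∈ shiftOne 𝒱 (c i)) → (∀ i j, b (e i) (e' j) = if i = j then 1 else 0) →
    ∀ (Ω Ω' : cyclicForms 𝒱) (n : ℕ) (d : Fin n → ℤ) (x : Fin n → V), IsHomTuple 𝒱 d x →
      (br Ω Ω').1 n x = ∑ k : Fin (n + 1), ∑ τ ∈ cyclicPerms n,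
        koszulSign τ d • contraction c e e' Ω.1 Ω'.1 k (d ∘ τ.symm) (x ∘ τ.symm)

/-- A Pinczon bracket on `𝒞(V)`: a bilinear graded Lie bracket with
`{𝒞ᵏ⁺¹, 𝒞ˡ⁺¹} ⊆ 𝒞ᵏ⁺ˡ`, for which linear forms act like derivations, scalars are central and no
other linear form is, and which is given by the Pinczon-Ushirobira formula of some metric. -/
structure IsPinczonBracket (𝒱 : ℤ → Submodule K V)
    (br : cyclicForms 𝒱 →ₗ[K] cyclicForms 𝒱 →ₗ[K] cyclicForms 𝒱) : Prop where
  arity : ∀ (k l : ℕ) (Ω Ω' : cyclicForms 𝒱), HasArity (k + 1) Ω → HasArity (l + 1) Ω' →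
    HasArity (k + l) (br Ω Ω')
  degree : ∀ (p q : ℤ) (Ω Ω' : cyclicForms 𝒱), HasFormDegree p Ω → HasFormDegree q Ω' →
    HasFormDegree (p + q - 2) (br Ω Ω')
  skew : ∀ (p q : ℤ) (Ω Ω' : cyclicForms 𝒱), HasFormDegree p Ω → HasFormDegree q Ω' →
    br Ω Ω' = -((p * q).negOnePow • br Ω' Ω)
  jacobi : ∀ (p q r : ℤ) (Ω Ω' Ω'' : cyclicForms 𝒱),
    HasFormDegree p Ω → HasFormDegree q Ω' → HasFormDegree r Ω'' →
    br Ω (br Ω' Ω'') + (p * (q + r)).negOnePow • br Ω' (br Ω'' Ω)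
      + (r * (p + q)).negOnePow • br Ω'' (br Ω Ω') = 0
  derivation : ∀ (α : cyclicForms 𝒱) (k : ℕ) (g : Fin (k + 1) → ℤ)
    (β : Fin (k + 1) → Module.Dual K V) (Λ : cyclicForms 𝒱) (β' Λ' : Fin (k + 1) → cyclicForms 𝒱),
    HasArity 1 α → (∀ j, IsHomCovector 𝒱 (g j) (β j)) → IsCyclicTensor g β Λ →
    (∀ j, IsCyclicTensor (k := 1) (fun _ => g j) (fun _ => β j) (β' j)) →
    (∀ j, IsCyclicTensor (fun i => g (j.succAbove i)) (fun i => β (j.succAbove i)) (Λ' j)) →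
    br α Λ = ∑ j, (g j * ∑ i ∈ Finset.univ.filter (fun i => i < j), g i).negOnePow •
      ((br α (β' j)).1 0 Fin.elim0 • Λ' j)
  scalars_central : ∀ Ω Ω' : cyclicForms 𝒱, HasArity 0 Ω → br Ω Ω' = 0
  linear_nondegenerate : ∀ α : cyclicForms 𝒱, HasArity 1 α → (∀ Ω, br α Ω = 0) → α = 0
  ushirobira : ∃ b, IsMetric 𝒱 b ∧ IsPinczonUshirobira 𝒱 b br

/-- `B` is the form on `V[1]` that corresponds to the metric `b` of the bracket. -/
def IsFormOfBracket (𝒱 : ℤ → Submodule K V)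
    (br : cyclicForms 𝒱 →ₗ[K] cyclicForms 𝒱 →ₗ[K] cyclicForms 𝒱)
    (B : V →ₗ[K] V →ₗ[K] K) : Prop :=
  ∃ b, IsMetric 𝒱 b ∧ IsPinczonUshirobira 𝒱 b br ∧ IsShiftedForm 𝒱 b B

/-- A commutative Pinczon algebra `(𝒞_vsp(V), { , }, Ω)`: `Ω` is a form of degree `3`, cyclic and
vanishing on shuffle products, with `{Ω, Ω} = 0`. Its components start with a bilinear one
(there is no scalar component because of the degree). -/
structure IsCommPinczonAlgebra (𝒱 : ℤ → Submodule K V)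
    (br : cyclicForms 𝒱 →ₗ[K] cyclicForms 𝒱 →ₗ[K] cyclicForms 𝒱) (Ω : cyclicForms 𝒱) : Prop where
  bracket : IsPinczonBracket 𝒱 br
  vsp : IsVsp Ω
  degree_three : HasFormDegree 3 Ω
  no_linear : Ω.1 1 = 0
  bracket_self : br Ω Ω = 0

/-! ## `C∞` structures -/

/-- `(Q ∘ Q')(x₁, …, xₙ)`, the sum over `j` (arity of the component of `Q'`) and `r` of
`(-1)^{q'(x₁ + ⋯ + xᵣ)} Q(x₁, …, xᵣ, Q'(xᵣ₊₁, …, xᵣ₊ⱼ), xᵣ₊ⱼ₊₁, …, xₙ)`,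
where `q'` is the degree of `Q'`. -/
def compValue (q' : ℤ) (Q Q' : ∀ n, Op K V n) {n : ℕ} (d : Fin n → ℤ) (x : Fin n → V) : V :=
  ∑ j : Fin (n + 1), ∑ r : Fin (n - j.val + 1),
    (q' * ∑ i ∈ Finset.univ.filter (fun i : Fin n => i.val < r.val), d i).negOnePow •
      Q (n - j.val + 1) (fun i =>
        if h : i.val < r.val then x ⟨i.val, by omega⟩
        else if h' : i.val = r.val then Q' j.val (fun a => x ⟨r.val + a.val, by omega⟩)
        else x ⟨i.val + j.val - 1, by omega⟩)

/-- The bracket `[Q, Q'] = Q ∘ Q' - (-1)^{q q'} Q' ∘ Q` of coderivations of degrees `q`, `q'`,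
evaluated on homogeneous vectors of degrees `d i`. -/
def coderBracketValue (q q' : ℤ) (Q Q' : ∀ n, Op K V n) {n : ℕ} (d : Fin n → ℤ)
    (x : Fin n → V) : V :=
  compValue q' Q Q' d x - (q * q').negOnePow • compValue q Q' Q d x

/-- The family `Q = (Qₖ)_{k ≥ 1}` of Taylor coefficients is a `C∞` structure on `V`: each `Qₖ` is of
degree `1` on `V[1]` and vanishes on shuffle products, and `[Q, Q] = 0`. -/
structure IsCInfinity (𝒱 : ℤ → Submodule K V) (Q : ∀ n, Op K V n) : Prop where
  zero : Q 0 = 0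
  degree_one : ∀ (n : ℕ) (d : Fin n → ℤ) (x : Fin n → V), IsHomTuple 𝒱 d x →
    Q n x ∈ shiftOne 𝒱 ((∑ i, d i) + 1)
  vsp : ∀ n, VanishesOnShuffles 𝒱 (fun x : Fin n → V => Q n x)
  bracket_self : ∀ (n : ℕ) (d : Fin n → ℤ) (x : Fin n → V), IsHomTuple 𝒱 d x →
    coderBracketValue 1 1 Q Q d x = 0

/-- `Ω_Q(x₁, …, xₖ₊₁) = B(Q(x₁, …, xₖ), xₖ₊₁)`. -/
def quadraticForm (B : V →ₗ[K] V →ₗ[K] K) (Q : ∀ n, Op K V n) : ∀ n, Form K V n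
  | 0 => 0
  | k + 1 => (B.compMultilinearMap (Q k)).uncurryRight

/-- `Q` is `B`-quadratic: `Ω_Q` is cyclic. -/
def IsQuadratic (𝒱 : ℤ → Submodule K V) (B : V →ₗ[K] V →ₗ[K] K) (Q : ∀ n, Op K V n) : Prop :=
  quadraticForm B Q ∈ cyclicForms 𝒱

end Forms

end

end Pinczon

/-! Homogeneous vectors of `V[1]` serve as letters, and a family of forms becomes a function of
words (`onWords`). Cyclic forms are those whose function is invariant under signed rotations
(`isCyclic_iff`), and the words in a homogeneous basis determine the family (`form_ext_onWords`).

The core is a rewriting of the bracket. To a form `F` of degree `p` attach the operator `L_F f (w) =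
∑_{w = xyz} ∑ᵢ (-1)^{p|x|} F(y eᵢ) f(x e'ᵢ z)` (`insertion` with the coefficients `leg`); up to sign
it is the transpose of the coderivation `Q` with `B(Q(y), ·) = F(y, ·)`. In `{F, G}` evaluated on a
word ending in `c`, the letter `c` falls into one factor or the other, and cyclicity turns the two
kinds of terms into (`rightDer_wordBracket`) `{F, G}(· c) = (-1)^{pq} L_F (G(· c)) - L_G (F(· c))`.
Since a graded commutator of insertion operators is again an insertion operator
(`insertion_commutator`), taking `c = eᵢ` gives `L_{F,G} = (-1)^{pq} L_F L_G - L_G L_F`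
(`insertion_leg_wordBracket`). Antisymmetry and the Jacobi identity follow on nonempty words. The
scalar component has no last letter and is computed directly (`wordBracket_jacobi_nil`).

For `F = G = Ω_Q` the formula reads `{Ω, Ω}(· a) = -2 L_Ω (Ω(· a)) = B([Q, Q](·), a)`
(`IsMetric.apply_coderBracketValue`). As `B` is non degenerate, `Ω = Ω_Q` determines `Q`, and the
conditions on degree, shuffles and square zero pass from one to the other; the scalar part of `{Ω,
Ω}` vanishes because `Ω` has no linear component.

It remains that a metric yields a Pinczon bracket and is recovered from it. The signs of the formula
depend on degrees, so the bracket is defined on a basis and extended multilinearly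
(`bracketForm_apply`); it does not depend on the basis because the tensor `∑ eᵢ ⊗ e'ᵢ` does not.
Brackets of linear forms recover the dual basis, hence `b` (`IsPinczonUshirobira.metric_unique`).
Finally `B = -b.flip` by parity, so `b` and `B` determine each other. -/

namespace Pinczon

/-! ## Signs -/

section Signs

variable {K : Type*} [Field K]

/-- The sign `(-1) ^ n` as a scalar. -/
def sgn (n : ℤ) : K := ((n.negOnePow : ℤ) : K)

theorem negOnePow_smul_eq_sgn_mul (n : ℤ) (a : K) : n.negOnePow • a = sgn n * a := by
  rw [Units.smul_def, zsmul_eq_mul]; rfl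

theorem negOnePow_smul_eq_sgn_smul {M : Type*} [AddCommGroup M] [Module K M] (n : ℤ) (a : M) :
    n.negOnePow • a = (sgn n : K) • a := by
  rw [Units.smul_def, sgn, Int.cast_smul_eq_zsmul]

theorem sgn_add (m n : ℤ) : (sgn (m + n) : K) = sgn m * sgn n := by
  simp [sgn, Int.negOnePow_add]

@[simp] theorem sgn_zero : (sgn 0 : K) = 1 := by simp [sgn]

@[simp] theorem sgn_one : (sgn 1 : K) = -1 := by simp [sgn]

/-- Koszul signs depend only on the exponent modulo 2. Each sign identity below becomes a polynomial
identity over `ZMod 2`, and finitely many values decide it. -/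
theorem sgn_congr {m n : ℤ} (h : (m : ZMod 2) = n) : (sgn m : K) = sgn n := by
  have : Even (m - n) := by
    rw [← ZMod.intCast_eq_zero_iff_even]
    push_cast; rw [h, sub_self]
  rw [sgn, sgn, (Int.negOnePow_eq_iff m n).2 this]

@[simp] theorem sgn_mul_self (n : ℤ) : (sgn n * sgn n : K) = 1 := by
  rw [← sgn_add, sgn_congr (n := 0), sgn_zero]
  push_cast
  generalize (n : ZMod 2) = a
  revert a; decide

@[simp] theorem sgn_mul_self_mul (n : ℤ) (a : K) : (sgn n * (sgn n * a) : K) = a := by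
  rw [← mul_assoc, sgn_mul_self, one_mul]

theorem sgn_ne_zero (n : ℤ) : (sgn n : K) ≠ 0 := by
  intro h
  have := sgn_mul_self (K := K) n
  simp [h] at this

theorem neg_eq_sgn_one_mul (a : K) : -a = sgn 1 * a := by simp

end Signs

/-! ## Words of homogeneous vectors -/

section Words

variable {K V : Type*} [Field K] [AddCommGroup V] [Module K V] {𝒱 : ℤ → Submodule K V}

/-- A homogeneous vector of `V[1]` together with its degree. -/
abbrev Letter (𝒱 : ℤ → Submodule K V) : Type _ := Σ d : ℤ, shiftOne 𝒱 d

/-- The letter given by a homogeneous vector. -/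
def Letter.mk' {d : ℤ} {v : V} (h : v ∈ shiftOne 𝒱 d) : Letter 𝒱 := ⟨d, v, h⟩

@[simp] theorem Letter.mk'_fst {d : ℤ} {v : V} (h : v ∈ shiftOne 𝒱 d) : (Letter.mk' h).1 = d := rfl

@[simp] theorem Letter.mk'_snd {d : ℤ} {v : V} (h : v ∈ shiftOne 𝒱 d) :
    ((Letter.mk' h).2 : V) = v := rfl

/-- The total degree of a word. -/
def wdeg (w : List (Letter 𝒱)) : ℤ := (w.map Sigma.fst).sum

@[simp] theorem wdeg_nil : wdeg ([] : List (Letter 𝒱)) = 0 := rfl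

@[simp] theorem wdeg_cons (a : Letter 𝒱) (w : List (Letter 𝒱)) : wdeg (a :: w) = a.1 + wdeg w := by
  simp [wdeg]

@[simp] theorem wdeg_append (u w : List (Letter 𝒱)) : wdeg (u ++ w) = wdeg u + wdeg w := by
  simp [wdeg]

theorem wdeg_take_add_drop (w : List (Letter 𝒱)) (r : ℕ) :
    wdeg (w.take r) + wdeg (w.drop r) = wdeg w := by
  rw [← wdeg_append, List.take_append_drop]

/-- The vectors of a word. -/
def vecs (w : List (Letter 𝒱)) : List V := w.map fun a => (a.2 : V)

@[simp] theorem vecs_nil : vecs ([] : List (Letter 𝒱)) = [] := rfl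

@[simp] theorem vecs_cons (a : Letter 𝒱) (w : List (Letter 𝒱)) : vecs (a :: w) = (a.2 : V) :: vecs w :=
  rfl

@[simp] theorem vecs_append (u w : List (Letter 𝒱)) : vecs (u ++ w) = vecs u ++ vecs w := by
  simp [vecs]

variable {M : Type*} [AddCommGroup M] [Module K M]

/-- The value of a family of multilinear maps on a list of vectors. -/
def evalList (F : ∀ n, MultilinearMap K (fun _ : Fin n => V) M) (l : List V) : M :=
  F l.length l.get

theorem evalList_eq (F : ∀ n, MultilinearMap K (fun _ : Fin n => V) M) {l : List V} {n : ℕ}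
    (h : l.length = n) : evalList F l = F n fun i => l[i.1]'(by omega) := by
  subst h; rfl

theorem evalList_ofFn (F : ∀ n, MultilinearMap K (fun _ : Fin n => V) M) {n : ℕ} (x : Fin n → V) :
    evalList F (List.ofFn x) = F n x := by
  rw [evalList_eq F (List.length_ofFn (f := x))]
  congr 1
  ext i
  simp

/-- Isolating one entry as a `Function.update` makes multilinearity available for lists; this is
what makes `slot` linear. -/
theorem evalList_append_cons (F : ∀ n, MultilinearMap K (fun _ : Fin n => V) M) (x z : List V)
    (v : V) : evalList F (x ++ v :: z) = F (x.length + z.length + 1)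
      (Function.update (fun i => (x ++ 0 :: z)[i.1]'(by simp; omega)) ⟨x.length, by omega⟩ v) := by
  rw [evalList_eq F (n := x.length + z.length + 1) (by simp; omega)]
  congr 1
  ext i
  by_cases hi : i = ⟨x.length, by omega⟩
  · subst hi; simp
  · rw [Function.update_of_ne hi]
    have : i.1 ≠ x.length := fun h => hi (Fin.ext h)
    rw [List.getElem_append, List.getElem_append]
    split_ifs with h
    · rfl
    · rw [List.getElem_cons, List.getElem_cons, dif_neg (by omega), dif_neg (by omega)]

/-- A family of multilinear maps as a function of the entry at a given position. -/
def slot (F : ∀ n, MultilinearMap K (fun _ : Fin n => V) M) (x z : List V) : V →ₗ[K] M where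
  toFun v := evalList F (x ++ v :: z)
  map_add' v v' := by simp only [evalList_append_cons, MultilinearMap.map_update_add]
  map_smul' c v := by
    simp only [evalList_append_cons, MultilinearMap.map_update_smul, RingHom.id_apply]

@[simp] theorem slot_apply (F : ∀ n, MultilinearMap K (fun _ : Fin n => V) M) (x z : List V) (v : V) :
    slot F x z v = evalList F (x ++ v :: z) := rfl

/-- The word of a tuple of homogeneous vectors. -/
def word {n : ℕ} {d : Fin n → ℤ} {x : Fin n → V} (h : IsHomTuple 𝒱 d x) : List (Letter 𝒱) :=
  List.ofFn fun i => Letter.mk' (h i)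

@[simp] theorem length_word {n : ℕ} {d : Fin n → ℤ} {x : Fin n → V} (h : IsHomTuple 𝒱 d x) :
    (word h).length = n := by simp [word]

theorem vecs_word {n : ℕ} {d : Fin n → ℤ} {x : Fin n → V} (h : IsHomTuple 𝒱 d x) :
    vecs (word h) = List.ofFn x := by
  simp [vecs, word, List.map_ofFn, Function.comp_def]

theorem wdeg_word {n : ℕ} {d : Fin n → ℤ} {x : Fin n → V} (h : IsHomTuple 𝒱 d x) :
    wdeg (word h) = ∑ i, d i := by
  simp [wdeg, word, List.map_ofFn, Function.comp_def, List.sum_ofFn]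

theorem isHomTuple_get (w : List (Letter 𝒱)) :
    IsHomTuple 𝒱 (fun i : Fin w.length => (w.get i).1) (fun i => ((w.get i).2 : V)) :=
  fun i => (w.get i).2.2

theorem word_isHomTuple_get (w : List (Letter 𝒱)) : word (isHomTuple_get w) = w := by
  have : (fun i => Letter.mk' (isHomTuple_get w i)) = w.get := by
    ext i <;> rfl
  rw [word, this, List.ofFn_get]

theorem exists_word {n : ℕ} (w : List (Letter 𝒱)) (hw : w.length = n) :
    ∃ (d : Fin n → ℤ) (x : Fin n → V) (h : IsHomTuple 𝒱 d x), word h = w := by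
  subst hw
  exact ⟨_, _, isHomTuple_get w, word_isHomTuple_get w⟩

theorem evalList_word (F : ∀ n, MultilinearMap K (fun _ : Fin n => V) M) {n : ℕ} {d : Fin n → ℤ}
    {x : Fin n → V} (h : IsHomTuple 𝒱 d x) : evalList F (vecs (word h)) = F n x := by
  rw [vecs_word, evalList_ofFn]

end Words

/-! ## Signed rotations and cyclic sums -/

section Rotations

variable {K V : Type*} [Field K] [AddCommGroup V] [Module K V] {𝒱 : ℤ → Submodule K V}

/-- A function of words is cyclic: moving the first letter to the end costs the Koszul sign. -/
def CyclicFun (f : List (Letter 𝒱) → K) : Prop :=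
  ∀ a w, f (a :: w) = sgn (a.1 * wdeg w) * f (w ++ [a])

theorem CyclicFun.append {f : List (Letter 𝒱) → K} (hf : CyclicFun f) (x y : List (Letter 𝒱)) :
    f (x ++ y) = sgn (wdeg x * wdeg y) * f (y ++ x) := by
  induction x generalizing y with
  | nil => simp
  | cons a x ih =>
    rw [List.cons_append, hf a (x ++ y), List.append_assoc, ih (y ++ [a]), ← mul_assoc, ← sgn_add]
    simp only [wdeg_append, wdeg_cons, wdeg_nil, List.append_assoc, List.singleton_append]
    congr 1
    apply sgn_congr
    push_cast
    ring_nf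
    generalize (a.1 : ZMod 2) = p, (wdeg x : ZMod 2) = q, (wdeg y : ZMod 2) = r
    revert p q r; decide

/-- The sum over all signed rotations of a word. -/
def cycSum (f : List (Letter 𝒱) → K) (w : List (Letter 𝒱)) : K :=
  ∑ r ∈ Finset.range w.length, sgn (wdeg (w.take r) * wdeg (w.drop r)) * f (w.drop r ++ w.take r)

/-- Rotating `a :: w` by `r + 1` letters and `w ++ [a]` by `r` letters gives the same word. The
terms left over, `r = 0` on one side and `r = |w|` on the other, both give `a :: w`. -/
theorem cycSum_cyclic (f : List (Letter 𝒱) → K) : CyclicFun (cycSum f) := by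
  intro a w
  rw [cycSum, cycSum, Finset.mul_sum, List.length_append, List.length_cons, List.length_singleton,
    Finset.sum_range_succ', Finset.sum_range_succ]
  congr 1
  · refine Finset.sum_congr rfl fun r hr => ?_
    have hr' : r ≤ w.length := (Finset.mem_range.1 hr).le
    rw [List.take_append_of_le_length hr', List.drop_append_of_le_length hr', ← mul_assoc, ← sgn_add,
      ← wdeg_take_add_drop w r]
    simp only [List.take_succ_cons, List.drop_succ_cons, wdeg_cons, wdeg_append, wdeg_nil,
      List.append_assoc, List.singleton_append]
    congr 1
    apply sgn_congr
    push_cast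
    generalize (a.1 : ZMod 2) = p, (wdeg (w.take r) : ZMod 2) = q, (wdeg (w.drop r) : ZMod 2) = s
    revert p q s; decide
  · simp [mul_comm a.1]

theorem finRotate_pow_val {n : ℕ} (r : ℕ) (i : Fin n) :
    (((finRotate n) ^ r) i).val = (i.val + r) % n := by
  obtain _ | n := n
  · exact i.elim0
  induction r with
  | zero => simp [Nat.mod_eq_of_lt i.2]
  | succ r ih =>
    rw [pow_succ', Equiv.Perm.mul_apply, finRotate_apply, Fin.val_add, ih, Fin.val_one', ← Nat.add_mod,
      add_assoc]

theorem finRotate_pow_self (n : ℕ) : (finRotate n) ^ n = 1 := by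
  ext i
  rw [finRotate_pow_val]
  simp [Nat.mod_eq_of_lt i.2]

/-- A permutation acts on arguments through `τ.symm`; with inverse powers, `r` is the number of
letters that move from the front to the back. -/
theorem cyclicPerms_eq_image {n : ℕ} (hn : 0 < n) : cyclicPerms n =
    (Finset.range n).image fun r => ((finRotate n) ^ r)⁻¹ := by
  ext σ
  simp only [cyclicPerms, Finset.mem_filter, Finset.mem_univ, true_and, Finset.mem_image,
    Finset.mem_range, Subgroup.mem_zpowers_iff]
  constructor
  · rintro ⟨z, rfl⟩
    have hpos : 0 ≤ -z % (n : ℤ) := Int.emod_nonneg _ (by omega)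
    have hlt : -z % (n : ℤ) < n := Int.emod_lt_of_pos _ (by omega)
    refine ⟨(-z % (n : ℤ)).toNat, by omega, ?_⟩
    rw [← zpow_natCast, Int.toNat_of_nonneg hpos, ← zpow_eq_zpow_emod' _ (finRotate_pow_self n),
      zpow_neg, inv_inv]
  · rintro ⟨r, -, rfl⟩
    exact ⟨-r, by rw [zpow_neg, zpow_natCast]⟩

theorem sum_cyclicPerms {M : Type*} [AddCommMonoid M] {n : ℕ} (hn : 0 < n)
    (f : Equiv.Perm (Fin n) → M) :
    ∑ τ ∈ cyclicPerms n, f τ = ∑ r ∈ Finset.range n, f ((finRotate n) ^ r)⁻¹ := by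
  rw [cyclicPerms_eq_image hn, Finset.sum_image]
  intro r hr s hs h
  have h0 := congrArg (fun σ : Equiv.Perm (Fin n) => (σ ⟨0, hn⟩).val) (inv_injective h)
  simp only [finRotate_pow_val, zero_add] at h0
  rwa [Nat.mod_eq_of_lt (by simpa using hr), Nat.mod_eq_of_lt (by simpa using hs)] at h0

theorem inv_finRotate_pow_val {n r : ℕ} (hr : r < n) (i : Fin n) :
    ((((finRotate n) ^ r)⁻¹ : Equiv.Perm (Fin n)) i).val =
      if i.val < r then i.val + n - r else i.val - r := by
  set j := (((finRotate n) ^ r)⁻¹ : Equiv.Perm (Fin n)) i with hj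
  have hi : i = ((finRotate n) ^ r) j := by simp [hj]
  have h := finRotate_pow_val r j
  rw [← hi] at h
  have := j.2
  rcases lt_or_ge (j.val + r) n with hlt | hge
  · rw [Nat.mod_eq_of_lt hlt] at h
    rw [if_neg (by omega)]; omega
  · rw [Nat.mod_eq_sub_mod hge, Nat.mod_eq_of_lt (by omega)] at h
    rw [if_pos (by omega)]; omega

theorem sum_take_word {n : ℕ} {d : Fin n → ℤ} {x : Fin n → V} (h : IsHomTuple 𝒱 d x) (r : ℕ) :
    wdeg ((word h).take r) = ∑ i ∈ Finset.univ.filter (fun i : Fin n => i.val < r), d i := by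
  induction n generalizing r with
  | zero => simp [word]
  | succ n ih =>
    obtain _ | r := r
    · simp
    · have h' : IsHomTuple 𝒱 (fun i : Fin n => d i.succ) (fun i => x i.succ) := fun i => h i.succ
      have hw : word h = ⟨d 0, x 0, h 0⟩ :: word h' := by
        simp [word, List.ofFn_succ, Letter.mk']
      rw [hw, List.take_succ_cons, wdeg_cons, ih, Finset.sum_filter, Finset.sum_filter,
        Fin.sum_univ_succ]
      simp

theorem sum_drop_word {n : ℕ} {d : Fin n → ℤ} {x : Fin n → V} (h : IsHomTuple 𝒱 d x) (r : ℕ) :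
    wdeg ((word h).drop r) = ∑ i ∈ Finset.univ.filter (fun i : Fin n => r ≤ i.val), d i := by
  have h1 := wdeg_take_add_drop (word h) r
  rw [sum_take_word, wdeg_word,
    ← Finset.sum_filter_add_sum_filter_not Finset.univ (fun i : Fin n => i.val < r)] at h1
  simpa using h1

/-- The inversions of this rotation are exactly the pairs `i < r ≤ j`, so the exponent factors as a
product of two block degrees. -/
theorem koszulSign_rotation {n r : ℕ} (hr : r < n) {d : Fin n → ℤ} {x : Fin n → V}
    (h : IsHomTuple 𝒱 d x) : koszulSign ((finRotate n) ^ r)⁻¹ d =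
      (wdeg ((word h).take r) * wdeg ((word h).drop r)).negOnePow := by
  rw [sum_take_word, sum_drop_word, Finset.sum_mul_sum, ← Finset.sum_product', koszulSign]
  have hset : Finset.univ.filter (fun p : Fin n × Fin n => p.1 < p.2 ∧
      (((finRotate n) ^ r)⁻¹ : Equiv.Perm (Fin n)) p.2 <
        (((finRotate n) ^ r)⁻¹ : Equiv.Perm (Fin n)) p.1) =
      (Finset.univ.filter fun i : Fin n => i.val < r) ×ˢ
        (Finset.univ.filter fun i : Fin n => r ≤ i.val) := by
    ext ⟨i, j⟩
    simp only [Finset.mem_filter, Finset.mem_univ, true_and, Finset.mem_product, Fin.lt_def,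
      inv_finRotate_pow_val hr]
    have := i.2
    have := j.2
    split_ifs <;> omega
  rw [hset]
  induction (Finset.univ.filter fun i : Fin n => i.val < r) ×ˢ
        (Finset.univ.filter fun i : Fin n => r ≤ i.val) using Finset.induction_on with
  | empty => simp
  | insert a s ha ih => rw [Finset.prod_insert ha, Finset.sum_insert ha, Int.negOnePow_add, ih]

theorem IsHomTuple.comp {n : ℕ} {d : Fin n → ℤ} {x : Fin n → V} (h : IsHomTuple 𝒱 d x)
    {m : ℕ} (σ : Fin m → Fin n) : IsHomTuple 𝒱 (d ∘ σ) (x ∘ σ) := fun i => h (σ i)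

theorem word_rotation {n r : ℕ} (hr : r < n) {d : Fin n → ℤ} {x : Fin n → V}
    (h : IsHomTuple 𝒱 d x) :
    word (h.comp (((finRotate n) ^ r)⁻¹ : Equiv.Perm (Fin n)).symm) =
      (word h).drop r ++ (word h).take r := by
  rw [← List.rotate_eq_drop_append_take (by simpa using hr.le)]
  refine List.ext_getElem (by simp) fun i hi hi' => ?_
  rw [List.getElem_rotate]
  simp only [word, List.getElem_ofFn, List.length_ofFn]
  have : ((((finRotate n) ^ r)⁻¹ : Equiv.Perm (Fin n)).symm ⟨i, by simpa using hi⟩) =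
      ⟨(i + r) % n, Nat.mod_lt _ (by omega)⟩ := Fin.ext (finRotate_pow_val r _)
  simp only [Function.comp_apply, this]

theorem sum_cyclicPerms_eq_cycSum {n : ℕ} (hn : 0 < n) {d : Fin n → ℤ} {x : Fin n → V}
    (h : IsHomTuple 𝒱 d x) (Φ : (Fin n → ℤ) → (Fin n → V) → K) (f : List (Letter 𝒱) → K)
    (hΦ : ∀ (d' : Fin n → ℤ) (x' : Fin n → V) (h' : IsHomTuple 𝒱 d' x'), Φ d' x' = f (word h')) :
    ∑ τ ∈ cyclicPerms n, koszulSign τ d • Φ (d ∘ τ.symm) (x ∘ τ.symm) = cycSum f (word h) := by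
  rw [sum_cyclicPerms hn, cycSum, length_word]
  refine Finset.sum_congr rfl fun r hr => ?_
  rw [Finset.mem_range] at hr
  rw [koszulSign_rotation hr h, negOnePow_smul_eq_sgn_mul, hΦ _ _ (h.comp _), word_rotation hr h]

/-- In arity `0` the cyclic group still has one element, whereas `cycSum` over the empty word is an
empty sum; hence the separate treatment of `[]` throughout. -/
theorem sum_cyclicPerms_zero {M : Type*} [AddCommMonoid M] (f : Equiv.Perm (Fin 0) → M) :
    ∑ τ ∈ cyclicPerms 0, f τ = f 1 := by
  have : cyclicPerms 0 = {1} := by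
    ext σ
    simp [cyclicPerms, Subsingleton.elim σ 1]
  rw [this, Finset.sum_singleton]

theorem isCyclic_iff {F : ∀ n, Form K V n} :
    (∀ n, IsCyclic 𝒱 (F n)) ↔ CyclicFun (𝒱 := 𝒱) fun w => evalList F (vecs w) := by
  have key : ∀ (n : ℕ) (d : Fin (n + 1) → ℤ) (x : Fin (n + 1) → V) (h : IsHomTuple 𝒱 d x),
      koszulSign (finRotate (n + 1)) d • F (n + 1) (x ∘ (finRotate (n + 1)).symm) =
        sgn (wdeg ((word h).take n) * wdeg ((word h).drop n)) *
          evalList F (vecs ((word h).drop n ++ (word h).take n)) := by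
    intro n d x h
    -- Moving the last letter to the front is the rotation that moves the other `n` letters to the
    -- back.
    have hrot : finRotate (n + 1) = ((finRotate (n + 1)) ^ n)⁻¹ := by
      rw [eq_inv_iff_mul_eq_one, ← pow_succ', finRotate_pow_self]
    rw [← word_rotation n.lt_succ_self h, evalList_word, ← negOnePow_smul_eq_sgn_mul,
      ← koszulSign_rotation n.lt_succ_self h, ← hrot]
  constructor
  · intro hF a w
    obtain ⟨d, x, h, hw⟩ := exists_word (n := w.length + 1) (w ++ [a]) (by simp)
    have hk := key w.length d x h
    rw [hF _ d x h, ← evalList_word F h, hw] at hk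
    simp only [List.take_left, List.drop_left, List.singleton_append, wdeg_cons, wdeg_nil,
      add_zero] at hk
    show evalList F (vecs (a :: w)) = _ * evalList F (vecs (w ++ [a]))
    rw [hk, mul_comm (wdeg w), sgn_mul_self_mul]
  · intro hF n d x h
    obtain _ | n := n
    · simp [koszulSign]
    · rw [key n d x h, ← hF.append, List.take_append_drop, evalList_word]

end Rotations

/-! ## Insertion operators on functions of words -/

section Insertion

variable {K V : Type*} [Field K] [AddCommGroup V] [Module K V] {𝒱 : ℤ → Submodule K V}

/-- The left derivative `w ↦ f (c w)`. -/
def leftDer (c : Letter 𝒱) : (List (Letter 𝒱) → K) →ₗ[K] (List (Letter 𝒱) → K) :=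
  LinearMap.funLeft K K (c :: ·)

@[simp] theorem leftDer_apply (c : Letter 𝒱) (f : List (Letter 𝒱) → K) (w : List (Letter 𝒱)) :
    leftDer c f w = f (c :: w) := rfl

/-- The concatenation product of functions of words. -/
def concat : (List (Letter 𝒱) → K) →ₗ[K] (List (Letter 𝒱) → K) →ₗ[K] (List (Letter 𝒱) → K) :=
  LinearMap.mk₂ K (fun g f w => ∑ j ∈ Finset.range (w.length + 1), g (w.take j) * f (w.drop j))
    (fun _ _ _ => by ext; simp [add_mul, Finset.sum_add_distrib])
    (fun _ _ _ => by ext; simp [Finset.mul_sum, mul_assoc])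
    (fun _ _ _ => by ext; simp [mul_add, Finset.sum_add_distrib])
    (fun _ _ _ => by ext; simp [Finset.mul_sum, mul_left_comm])

theorem concat_apply (g f : List (Letter 𝒱) → K) (w : List (Letter 𝒱)) :
    concat g f w = ∑ j ∈ Finset.range (w.length + 1), g (w.take j) * f (w.drop j) := rfl

@[simp] theorem concat_nil (g f : List (Letter 𝒱) → K) : concat g f [] = g [] * f [] := by
  simp [concat_apply]

theorem concat_cons (g f : List (Letter 𝒱) → K) (c : Letter 𝒱) (w : List (Letter 𝒱)) :
    concat g f (c :: w) = g [] * f (c :: w) + concat (leftDer c g) f w := by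
  rw [concat_apply, List.length_cons, Finset.sum_range_succ', add_comm, concat_apply]
  simp

theorem leftDer_concat (g f : List (Letter 𝒱) → K) (c : Letter 𝒱) :
    leftDer c (concat g f) = g [] • leftDer c f + concat (leftDer c g) f := by
  ext w
  simp [concat_cons]

theorem concat_assoc (g f h : List (Letter 𝒱) → K) :
    concat (concat g f) h = concat g (concat f h) := by
  ext w
  induction w generalizing g f h with
  | nil => simp [mul_assoc]
  | cons c w ih =>
    rw [concat_cons, concat_cons, concat_nil, leftDer_concat, map_add, map_smul, LinearMap.add_apply,
      LinearMap.smul_apply, Pi.add_apply, ih, concat_cons f h]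
    simp only [Pi.smul_apply, smul_eq_mul]
    ring

/-- Multiplication of a function of words by the sign `(-1) ^ (p |w|)`. -/
def twist (p : ℤ) (f : List (Letter 𝒱) → K) (w : List (Letter 𝒱)) : K := sgn (p * wdeg w) * f w

variable {I : Type*} [Fintype I]

/-- The part of the insertion operator that replaces an initial subword by a letter. -/
def headInsertion (a : I → Letter 𝒱) (ψ : I → List (Letter 𝒱) → K) :
    (List (Letter 𝒱) → K) →ₗ[K] (List (Letter 𝒱) → K) :=
  ∑ i, concat (ψ i) ∘ₗ leftDer (a i)

theorem headInsertion_apply (a : I → Letter 𝒱) (ψ : I → List (Letter 𝒱) → K)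
    (f : List (Letter 𝒱) → K) :
    headInsertion a ψ f = ∑ i, concat (ψ i) (leftDer (a i) f) := by
  simp [headInsertion]

/-- The operator `f ↦ (w ↦ ∑_{w = xyz} ∑ᵢ (-1)^{p|x|} ψᵢ(y) f(x aᵢ z))`. -/
def insertion (p : ℤ) (a : I → Letter 𝒱) (ψ : I → List (Letter 𝒱) → K) :
    (List (Letter 𝒱) → K) →ₗ[K] (List (Letter 𝒱) → K) where
  toFun f w := ∑ r ∈ Finset.range (w.length + 1), ∑ j ∈ Finset.range (w.length - r + 1),
    sgn (p * wdeg (w.take r)) *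
      ∑ i, ψ i ((w.drop r).take j) * f (w.take r ++ a i :: (w.drop r).drop j)
  map_add' f g := by
    ext w
    simp only [Pi.add_apply, mul_add, Finset.sum_add_distrib]
  map_smul' c f := by
    ext w
    simp only [Pi.smul_apply, smul_eq_mul, Finset.mul_sum, RingHom.id_apply]
    refine Finset.sum_congr rfl fun _ _ => Finset.sum_congr rfl fun _ _ =>
      Finset.sum_congr rfl fun _ _ => by ring

theorem insertion_apply (p : ℤ) (a : I → Letter 𝒱) (ψ : I → List (Letter 𝒱) → K)
    (f : List (Letter 𝒱) → K) (w : List (Letter 𝒱)) : insertion p a ψ f w =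
    ∑ r ∈ Finset.range (w.length + 1), ∑ j ∈ Finset.range (w.length - r + 1),
      sgn (p * wdeg (w.take r)) *
        ∑ i, ψ i ((w.drop r).take j) * f (w.take r ++ a i :: (w.drop r).drop j) := rfl

theorem insertion_nil (p : ℤ) (a : I → Letter 𝒱) (ψ : I → List (Letter 𝒱) → K)
    (f : List (Letter 𝒱) → K) : insertion p a ψ f [] = ∑ i, ψ i [] * f [a i] := by
  simp [insertion_apply]

theorem insertion_cons (p : ℤ) (a : I → Letter 𝒱) (ψ : I → List (Letter 𝒱) → K)
    (f : List (Letter 𝒱) → K) (c : Letter 𝒱) (w : List (Letter 𝒱)) :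
    insertion p a ψ f (c :: w) = headInsertion a ψ f (c :: w) +
      sgn (p * c.1) * insertion p a ψ (leftDer c f) w := by
  rw [insertion_apply, List.length_cons, Finset.sum_range_succ', add_comm]
  congr 1
  · rw [headInsertion_apply, Finset.sum_apply]
    simp only [List.take_zero, List.drop_zero, wdeg_nil, mul_zero, sgn_zero, one_mul,
      List.nil_append, Nat.sub_zero, concat_apply, leftDer_apply, List.length_cons]
    rw [Finset.sum_comm]
  · rw [insertion_apply, Finset.mul_sum]
    refine Finset.sum_congr rfl fun r _ => ?_
    rw [Finset.mul_sum, Nat.add_sub_add_right]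
    refine Finset.sum_congr rfl fun j _ => ?_
    simp only [List.take_succ_cons, List.drop_succ_cons, wdeg_cons, mul_add, sgn_add, mul_assoc,
      List.cons_append, leftDer_apply]

/-- Apply an operator behind the first letter. -/
def behindFirst (q : ℤ) (N : (List (Letter 𝒱) → K) →ₗ[K] (List (Letter 𝒱) → K))
    (f : List (Letter 𝒱) → K) : List (Letter 𝒱) → K
  | [] => 0
  | c :: w => sgn (q * c.1) * N (leftDer c f) w

theorem leftDer_behindFirst (q : ℤ) (N : (List (Letter 𝒱) → K) →ₗ[K] (List (Letter 𝒱) → K))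
    (f : List (Letter 𝒱) → K) (c : Letter 𝒱) :
    leftDer c (behindFirst q N f) = (sgn (q * c.1) : K) • N (leftDer c f) := rfl

theorem insertion_eq (p : ℤ) (a : I → Letter 𝒱) (ψ : I → List (Letter 𝒱) → K)
    (f : List (Letter 𝒱) → K) : insertion p a ψ f =
      headInsertion a ψ f + behindFirst p (insertion p a ψ) f := by
  ext w
  cases w with
  | nil => simp [insertion_nil, headInsertion_apply, behindFirst]
  | cons c w => rw [insertion_cons, Pi.add_apply, behindFirst]

/-- The inserted letter is the first one that `concat g f` reads; it falls into `g` unless `g` reads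
the empty word. -/
theorem headInsertion_concat (a : I → Letter 𝒱) (ψ : I → List (Letter 𝒱) → K)
    (g f : List (Letter 𝒱) → K) : headInsertion a ψ (concat g f) =
      g [] • headInsertion a ψ f + concat (headInsertion a ψ g) f := by
  simp only [headInsertion_apply, leftDer_concat, map_add, map_smul, Finset.sum_add_distrib,
    Finset.smul_sum, map_sum, LinearMap.sum_apply, concat_assoc]

theorem leftDer_twist (p : ℤ) (g : List (Letter 𝒱) → K) (c : Letter 𝒱) :
    leftDer c (twist p g) = (sgn (p * c.1) : K) • twist p (leftDer c g) := by
  ext w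
  simp [twist, mul_add, sgn_add, mul_assoc]

/-- A twisted Leibniz rule: the inserted letter falls into the factor read by `g` or into the one
read by `f`, and in the second case the sign also counts the letters read by `g`. -/
theorem insertion_concat (p : ℤ) (a : I → Letter 𝒱) (ψ : I → List (Letter 𝒱) → K)
    (g f : List (Letter 𝒱) → K) : insertion p a ψ (concat g f) =
      concat (insertion p a ψ g) f + concat (twist p g) (insertion p a ψ f) := by
  ext w
  induction w generalizing g with
  | nil =>
    simp [insertion_nil, twist, concat_cons, Finset.sum_mul, Finset.mul_sum,
      ← Finset.sum_add_distrib]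
    refine Finset.sum_congr rfl fun i _ => by ring
  | cons c w ih =>
    have h1 : insertion p a ψ g [] = headInsertion a ψ g [] := by
      simp [insertion_eq, behindFirst]
    have h2 : leftDer c (insertion p a ψ g) = leftDer c (headInsertion a ψ g) +
        (sgn (p * c.1) : K) • insertion p a ψ (leftDer c g) := by
      rw [insertion_eq, map_add, leftDer_behindFirst]
    rw [insertion_cons, headInsertion_concat, leftDer_concat, map_add, Pi.add_apply, Pi.add_apply,
      Pi.add_apply, ih, concat_cons (insertion p a ψ g), concat_cons (twist p g), leftDer_twist, h1, h2,
      insertion_cons, concat_cons (headInsertion a ψ g)]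
    simp [twist]
    ring

/-- `ψᵢ` has degree `q` relative to the letter `aᵢ`, up to parity. -/
def HasParity (q : ℤ) (a : I → Letter 𝒱) (ψ : I → List (Letter 𝒱) → K) : Prop :=
  ∀ p i, twist p (ψ i) = (sgn (p * ((a i).1 + q)) : K) • ψ i

/-- Two successive insertions are sorted by what happens at the head of the word: they are nested
there, they are disjoint with one of them there, or both avoid the first letter. Exchanging the two
operators swaps the two sums of the middle term up to the sign `(-1)^{pq}`. -/
theorem insertion_insertion (p q : ℤ) (a : I → Letter 𝒱) (φ ψ : I → List (Letter 𝒱) → K)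
    (hψ : HasParity q a ψ) (f : List (Letter 𝒱) → K) :
    insertion p a φ (insertion q a ψ f) =
      headInsertion a (fun i => insertion p a φ (ψ i)) f +
      (∑ i, (sgn (p * (a i).1 + p * q) : K) • concat (ψ i) (insertion p a φ (leftDer (a i) f)) +
        ∑ i, (sgn (q * (a i).1) : K) • concat (φ i) (insertion q a ψ (leftDer (a i) f))) +
      behindFirst (p + q) (insertion p a φ ∘ₗ insertion q a ψ) f := by
  rw [insertion_eq q a ψ f, map_add, headInsertion_apply, map_sum, insertion_eq p a φ
    (behindFirst q (insertion q a ψ) f), headInsertion_apply, headInsertion_apply]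
  simp only [insertion_concat, leftDer_behindFirst, hψ p, map_smul, LinearMap.smul_apply, mul_add,
    Finset.sum_add_distrib, add_assoc]
  congr 1
  ext w
  cases w with
  | nil => rfl
  | cons c w =>
    simp [behindFirst, leftDer_behindFirst, add_mul, sgn_add, mul_assoc]

/-- Disjoint insertions cancel in the graded commutator and nested ones survive. Dually, the
commutator of two coderivations is a coderivation. -/
theorem insertion_commutator (p q : ℤ) (a : I → Letter 𝒱) (φ ψ : I → List (Letter 𝒱) → K)
    (hφ : HasParity p a φ) (hψ : HasParity q a ψ) (f : List (Letter 𝒱) → K) :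
    insertion (p + q) a
        (fun i => insertion p a φ (ψ i) - (sgn (p * q) : K) • insertion q a ψ (φ i)) f =
      insertion p a φ (insertion q a ψ f) - (sgn (p * q) : K) • insertion q a ψ (insertion p a φ f) := by
  -- Once the disjoint insertions at the head have cancelled, the rest acts behind the first letter,
  -- which allows induction on the word.
  have key : ∀ f w, (insertion p a φ (insertion q a ψ f) -
      (sgn (p * q) : K) • insertion q a ψ (insertion p a φ f)) w =
      headInsertion a (fun i => insertion p a φ (ψ i) - (sgn (p * q) : K) • insertion q a ψ (φ i)) f w +
      (behindFirst (p + q) (insertion p a φ ∘ₗ insertion q a ψ) f w - sgn (p * q) *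
        behindFirst (q + p) (insertion q a ψ ∘ₗ insertion p a φ) f w) := by
    intro f w
    rw [insertion_insertion p q a φ ψ hψ, insertion_insertion q p a ψ φ hφ]
    simp only [headInsertion_apply, map_sub, map_smul, LinearMap.sub_apply, LinearMap.smul_apply,
      Finset.sum_sub_distrib, ← Finset.smul_sum, sgn_add, mul_comm q p]
    simp only [mul_comm _ (sgn (p * q) : K), mul_smul, ← Finset.smul_sum]
    simp only [Pi.sub_apply, Pi.add_apply, Pi.smul_apply, smul_eq_mul, mul_add, sgn_mul_self_mul]
    ring
  ext w
  induction w generalizing f with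
  | nil => rw [key, insertion_eq]; simp [behindFirst]
  | cons c w ih =>
    rw [key, insertion_cons, ih]
    simp [behindFirst, add_comm q p]
    ring

end Insertion

/-! ## Dual homogeneous bases -/

section DualBases

variable {K V : Type*} [Field K] [AddCommGroup V] [Module K V] {𝒱 : ℤ → Submodule K V}
  {b : V →ₗ[K] V →ₗ[K] K}

/-- A homogeneous basis of `V[1]` and the family that is dual to it for `b`. -/
structure DualBases (𝒱 : ℤ → Submodule K V) (b : V →ₗ[K] V →ₗ[K] K) where
  /-- the basis -/
  e : Module.Basis (Fin (Module.finrank K V)) K V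
  /-- the degrees of the basis vectors -/
  c : Fin (Module.finrank K V) → ℤ
  /-- the dual family -/
  e' : Fin (Module.finrank K V) → V
  mem : ∀ i, e i ∈ shiftOne 𝒱 (c i)
  mem' : ∀ i, e' i ∈ shiftOne 𝒱 (-2 - c i)
  dual : ∀ i j, b (e i) (e' j) = if i = j then 1 else 0

theorem shiftOne_iSupIndep (h𝒱 : DirectSum.IsInternal 𝒱) : iSupIndep (shiftOne 𝒱) :=
  h𝒱.submodule_iSupIndep.comp (add_left_injective 1)

/-- A homogeneous vector has only coordinates of its own degree. -/
theorem degree_eq_of_coord_ne_zero (h𝒱 : DirectSum.IsInternal 𝒱) {ι : Type*} [Fintype ι]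
    (e : Module.Basis ι K V) {c : ι → ℤ} (mem : ∀ i, e i ∈ shiftOne 𝒱 (c i)) {d : ℤ} {v : V}
    (hv : v ∈ shiftOne 𝒱 d) {i : ι} (hi : e.coord i v ≠ 0) : c i = d := by
  classical
  by_contra hne
  set u := ∑ j ∈ Finset.univ.filter (fun j => c j = d), e.coord j v • e j with hu
  set w := ∑ j ∈ Finset.univ.filter (fun j => ¬ c j = d), e.coord j v • e j with hw
  have huw : u + w = v := by
    rw [hu, hw, Finset.sum_filter_add_sum_filter_not]
    exact e.sum_repr v
  have hud : u ∈ shiftOne 𝒱 d := by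
    refine Submodule.sum_mem _ fun j hj => Submodule.smul_mem _ _ ?_
    rw [Finset.mem_filter] at hj
    exact hj.2 ▸ mem j
  have hwd : w ∈ shiftOne 𝒱 d := by
    have := Submodule.sub_mem _ hv hud
    rwa [← huw, add_sub_cancel_left] at this
  -- The remainder `w` has degree `d` and also lies in the span of the other degrees, so
  -- independence of the grading kills it.
  have hw' : w ∈ ⨆ (j : ℤ) (_ : j ≠ d), shiftOne 𝒱 j := by
    refine Submodule.sum_mem _ fun j hj => Submodule.smul_mem _ _ ?_
    rw [Finset.mem_filter] at hj
    exact Submodule.mem_iSup_of_mem (c j) (Submodule.mem_iSup_of_mem hj.2 (mem j))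
  have hw0 : w = 0 := by
    have := (shiftOne_iSupIndep h𝒱) d
    exact (Submodule.disjoint_def.1 this) w hwd hw'
  rw [hw0, add_zero] at huw
  have hz : e.coord i u = 0 := by
    rw [hu, map_sum]
    refine Finset.sum_eq_zero fun j hj => ?_
    have hji : j ≠ i := fun h => hne (h ▸ (Finset.mem_filter.1 hj).2)
    simp [hji]
  exact hi (huw ▸ hz)

theorem exists_homogeneous_basis [FiniteDimensional K V] (h𝒱 : DirectSum.IsInternal 𝒱) :
    ∃ (e : Module.Basis (Fin (Module.finrank K V)) K V) (c : Fin (Module.finrank K V) → ℤ),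
      ∀ i, e i ∈ shiftOne 𝒱 (c i) := by
  let B := h𝒱.collectedBasis fun i => Module.finBasis K (𝒱 i)
  let σ := B.indexEquiv (Module.finBasis K V)
  -- The shift by `-1` converts degrees in `V` to degrees in `V[1]`.
  refine ⟨B.reindex σ, fun i => (σ.symm i).1 - 1, fun i => ?_⟩
  have := h𝒱.collectedBasis_mem (fun i => Module.finBasis K (𝒱 i)) (σ.symm i)
  simp [shiftOne, B] at this ⊢

theorem IsMetric.shift_degree (hb : IsMetric 𝒱 b) {i j : ℤ} {x y : V} (hx : x ∈ shiftOne 𝒱 i)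
    (hy : y ∈ shiftOne 𝒱 j) (h : b x y ≠ 0) : i + j + 2 = 0 := by
  have := hb.degree_zero _ _ x y hx hy h
  omega

theorem IsMetric.bijective [FiniteDimensional K V] (hb : IsMetric 𝒱 b) : Function.Bijective b := by
  have hinj : Function.Injective b := by
    rw [← LinearMap.ker_eq_bot, LinearMap.ker_eq_bot']
    intro x hx
    exact hb.nondegenerate x fun y => by rw [hx]; rfl
  exact ⟨hinj, (LinearMap.injective_iff_surjective_of_finrank_eq_finrank
    (Subspace.dual_finrank_eq).symm).1 hinj⟩

theorem IsMetric.right_nondegenerate [FiniteDimensional K V] (hb : IsMetric 𝒱 b) {y : V}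
    (h : ∀ x, b x y = 0) : y = 0 := by
  rw [← Module.forall_dual_apply_eq_zero_iff K]
  intro φ
  obtain ⟨x, rfl⟩ := hb.bijective.2 φ
  exact h x

theorem IsMetric.eq_of_basis [FiniteDimensional K V] (hb : IsMetric 𝒱 b) {ι : Type*}
    (e : Module.Basis ι K V) {y z : V} (h : ∀ i, b (e i) y = b (e i) z) : y = z := by
  rw [← sub_eq_zero]
  refine hb.right_nondegenerate fun x => ?_
  have : b.flip (y - z) = 0 := e.ext fun i => by simp [h]
  exact LinearMap.congr_fun this x

/-- A nonzero pairing forces the degrees in `V[1]` to add up to `-2`. Hence `v` and its part of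
degree `-2 - c j` pair equally with every basis vector. -/
theorem IsMetric.dual_mem [FiniteDimensional K V] (hb : IsMetric 𝒱 b) {ι : Type*} [Fintype ι]
    [DecidableEq ι] (e : Module.Basis ι K V) {c : ι → ℤ} (mem : ∀ i, e i ∈ shiftOne 𝒱 (c i))
    {v : V} {j : ι} (hv : ∀ i, b (e i) v = if i = j then 1 else 0) :
    v ∈ shiftOne 𝒱 (-2 - c j) := by
  have key : v = ∑ i ∈ Finset.univ.filter (fun i => c i = -2 - c j), e.coord i v • e i := by
    refine hb.eq_of_basis e fun k => ?_
    -- If `c k = c j`, only basis vectors of degree `-2 - c j` can pair with `e k`; otherwise both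
    -- sides vanish.
    by_cases hk : c k = c j
    · conv_lhs => rw [← e.sum_repr v]
      rw [map_sum, map_sum, Finset.sum_filter]
      refine Finset.sum_congr rfl fun i _ => ?_
      split_ifs with hi
      · rfl
      · rw [map_smul]
        by_contra hne
        have := hb.shift_degree (mem k) (mem i) (fun h => hne (by rw [h, smul_zero]))
        omega
    · have hkj : k ≠ j := fun h => hk (by rw [h])
      rw [hv, if_neg hkj, map_sum]
      refine (Finset.sum_eq_zero fun i hi => ?_).symm
      rw [map_smul]
      by_contra hne
      have := hb.shift_degree (mem k) (mem i) (fun h => hne (by rw [h, smul_zero]))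
      have := (Finset.mem_filter.1 hi).2
      omega
  rw [key]
  refine Submodule.sum_mem _ fun i hi => Submodule.smul_mem _ _ ?_
  exact (Finset.mem_filter.1 hi).2 ▸ mem i

/-- The dual bases of a metric and a homogeneous basis. -/
noncomputable def IsMetric.dualBases [FiniteDimensional K V] (hb : IsMetric 𝒱 b)
    (e : Module.Basis (Fin (Module.finrank K V)) K V) (c : Fin (Module.finrank K V) → ℤ)
    (e' : Fin (Module.finrank K V) → V) (mem : ∀ i, e i ∈ shiftOne 𝒱 (c i))
    (dual : ∀ i j, b (e i) (e' j) = if i = j then 1 else 0) : DualBases 𝒱 b where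
  e := e
  c := c
  e' := e'
  mem := mem
  mem' j := hb.dual_mem e mem fun i => dual i j
  dual := dual

theorem IsMetric.exists_dual_family [FiniteDimensional K V] (hb : IsMetric 𝒱 b) {ι : Type*}
    [DecidableEq ι] [Finite ι] (e : Module.Basis ι K V) :
    ∃ e' : ι → V, ∀ i j, b (e i) (e' j) = if i = j then 1 else 0 := by
  have hinj : Function.Injective b.flip := by
    rw [← LinearMap.ker_eq_bot, LinearMap.ker_eq_bot']
    intro y hy
    exact hb.right_nondegenerate fun x => LinearMap.congr_fun hy x
  have hsurj := (LinearMap.injective_iff_surjective_of_finrank_eq_finrank (f := b.flip)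
    (Subspace.dual_finrank_eq).symm).1 hinj
  choose e' he' using fun j => hsurj (e.coord j)
  refine ⟨e', fun i j => ?_⟩
  rw [← LinearMap.flip_apply, he']
  simp [Finsupp.single_apply]

theorem IsMetric.nonempty_dualBases [FiniteDimensional K V] (h𝒱 : DirectSum.IsInternal 𝒱)
    (hb : IsMetric 𝒱 b) : Nonempty (DualBases 𝒱 b) := by
  obtain ⟨e, c, mem⟩ := exists_homogeneous_basis h𝒱
  obtain ⟨e', dual⟩ := hb.exists_dual_family e
  exact ⟨hb.dualBases e c e' mem dual⟩

namespace DualBases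

variable (D : DualBases 𝒱 b)

/-- The basis vectors as letters. -/
noncomputable def letter (i : Fin (Module.finrank K V)) : Letter 𝒱 := ⟨D.c i, D.e i, D.mem i⟩

/-- The dual vectors as letters. -/
noncomputable def letter' (i : Fin (Module.finrank K V)) : Letter 𝒱 := ⟨-2 - D.c i, D.e' i, D.mem' i⟩

@[simp] theorem letter_fst (i) : (D.letter i).1 = D.c i := rfl

@[simp] theorem letter_snd (i) : ((D.letter i).2 : V) = D.e i := rfl

@[simp] theorem letter'_fst (i) : (D.letter' i).1 = -2 - D.c i := rfl

@[simp] theorem letter'_snd (i) : ((D.letter' i).2 : V) = D.e' i := rfl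

theorem expand [FiniteDimensional K V] (hb : IsMetric 𝒱 b) (y : V) :
    y = ∑ j, b (D.e j) y • D.e' j := by
  refine hb.eq_of_basis D.e fun i => ?_
  simp [D.dual]

theorem apply_sum (G : V →ₗ[K] K) (y : V) : b y (∑ i, G (D.e i) • D.e' i) = G y := by
  have : b.flip (∑ i, G (D.e i) • D.e' i) = G := D.e.ext fun j => by simp [D.dual]
  exact LinearMap.congr_fun this y

theorem dual_flip (hb : IsMetric 𝒱 b) (i j : Fin (Module.finrank K V)) :
    b (D.e' j) (D.e i) = if i = j then sgn (D.c i + 1) else 0 := by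
  rw [hb.symm _ _ _ _ (D.mem' j) (D.mem i), D.dual, negOnePow_smul_eq_sgn_mul]
  split_ifs with h
  · subst h
    rw [mul_one]
    apply sgn_congr
    push_cast
    generalize (D.c i : ZMod 2) = a
    revert a; decide
  · simp

/-- A second vector that represents `G`, with the roles of `e` and `e'` exchanged. Comparison with
`apply_sum` yields the antisymmetry of the canonical tensor. -/
theorem apply_sum' [FiniteDimensional K V] (hb : IsMetric 𝒱 b) (G : V →ₗ[K] K) (y : V) :
    b y (∑ i, (sgn (D.c i + 1) * G (D.e' i)) • D.e i) = G y := by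
  have key : ∀ j, b (D.e' j) (∑ i, (sgn (D.c i + 1) * G (D.e' i)) • D.e i) = G (D.e' j) := by
    intro j
    simp only [map_sum, map_smul, smul_eq_mul, D.dual_flip hb, mul_ite, mul_zero,
      Finset.sum_ite_eq', Finset.mem_univ, if_true]
    rw [mul_right_comm, sgn_mul_self, one_mul]
  have hy := D.expand hb y
  generalize (∑ i, (sgn (D.c i + 1) * G (D.e' i)) • D.e i) = v at key
  rw [hy]
  simp [key]

/-- The canonical tensor does not depend on the basis. -/
theorem sum_eq_sum [FiniteDimensional K V] (hb : IsMetric 𝒱 b) (D' : DualBases 𝒱 b)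
    (G H : V →ₗ[K] K) : ∑ i, G (D.e i) * H (D.e' i) = ∑ i, G (D'.e i) * H (D'.e' i) := by
  have : ∑ i, G (D.e i) • D.e' i = ∑ i, G (D'.e i) • D'.e' i :=
    hb.eq_of_basis D.e fun i => by rw [D.apply_sum, D'.apply_sum]
  simpa using congrArg H this

/-- The canonical tensor is antisymmetric on `V[1]`. -/
theorem sum_swap [FiniteDimensional K V] (hb : IsMetric 𝒱 b) (G H : V →ₗ[K] K) :
    ∑ i, G (D.e i) * H (D.e' i) = ∑ i, sgn (D.c i + 1) * (G (D.e' i) * H (D.e i)) := by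
  have : ∑ i, G (D.e i) • D.e' i = ∑ i, (sgn (D.c i + 1) * G (D.e' i)) • D.e i :=
    hb.eq_of_basis D.e fun i => by rw [D.apply_sum, D.apply_sum' hb]
  simpa [mul_assoc] using congrArg H this

/-- The operator `v ↦ (-1) ^ (m deg v) v`. -/
noncomputable def signMap (m : ℤ) : V →ₗ[K] V := D.e.constr K fun i => (sgn (m * D.c i) : K) • D.e i

@[simp] theorem signMap_e (m : ℤ) (i) : D.signMap m (D.e i) = (sgn (m * D.c i) : K) • D.e i := by
  simp [signMap]

theorem signMap_apply (h𝒱 : DirectSum.IsInternal 𝒱) (m : ℤ) {d : ℤ} {v : V}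
    (hv : v ∈ shiftOne 𝒱 d) : D.signMap m v = (sgn (m * d) : K) • v := by
  conv_lhs => rw [← D.e.sum_repr v]
  conv_rhs => rw [← D.e.sum_repr v]
  rw [map_sum, Finset.smul_sum]
  refine Finset.sum_congr rfl fun i _ => ?_
  rw [map_smul, signMap_e, smul_comm]
  by_cases hi : D.e.repr v i = 0
  · simp [hi]
  · rw [degree_eq_of_coord_ne_zero h𝒱 D.e D.mem hv hi]

/-- The sign is absorbed into `G` by `signMap`, which acts by the same rule on every homogeneous
basis. -/
theorem signed_sum_eq_sum [FiniteDimensional K V] (h𝒱 : DirectSum.IsInternal 𝒱)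
    (hb : IsMetric 𝒱 b) (D' : DualBases 𝒱 b) (m : ℤ) (G H : V →ₗ[K] K) :
    ∑ i, sgn (m * D.c i) * (G (D.e i) * H (D.e' i)) =
      ∑ i, sgn (m * D'.c i) * (G (D'.e i) * H (D'.e' i)) := by
  have := D.sum_eq_sum hb D' (G ∘ₗ D.signMap m) H
  simpa [D.signMap_apply h𝒱 m (D'.mem _), mul_assoc] using this

/-- The factor `(-1)^{m cᵢ}` survives the exchange because `e'ᵢ` has degree `-2 - cᵢ`, of the parity
of `cᵢ`. -/
theorem signed_sum_swap [FiniteDimensional K V] (h𝒱 : DirectSum.IsInternal 𝒱)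
    (hb : IsMetric 𝒱 b) (m : ℤ) (G H : V →ₗ[K] K) :
    ∑ i, sgn (m * D.c i) * (G (D.e i) * H (D.e' i)) =
      ∑ i, sgn (m * D.c i + D.c i + 1) * (G (D.e' i) * H (D.e i)) := by
  have := D.sum_swap hb (G ∘ₗ D.signMap m) H
  simp only [LinearMap.comp_apply, D.signMap_e, map_smul, smul_eq_mul, mul_assoc,
    D.signMap_apply h𝒱 m (D.mem' _)] at this
  rw [this]
  refine Finset.sum_congr rfl fun i _ => ?_
  rw [← mul_assoc, ← sgn_add]
  congr 1
  apply sgn_congr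
  push_cast
  generalize (D.c i : ZMod 2) = a, (m : ZMod 2) = b
  revert a b; decide

end DualBases

end DualBases

/-! ## The Pinczon-Ushirobira formula on words -/

section WordBracket

variable {K V : Type*} [Field K] [AddCommGroup V] [Module K V] {𝒱 : ℤ → Submodule K V}
  {b : V →ₗ[K] V →ₗ[K] K}

/-- A family of forms as a function of words. -/
def onWords (𝒱 : ℤ → Submodule K V) (F : ∀ n, Form K V n) (w : List (Letter 𝒱)) : K :=
  evalList F (vecs w)

theorem onWords_word (F : ∀ n, Form K V n) {n : ℕ} {d : Fin n → ℤ} {x : Fin n → V}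
    (h : IsHomTuple 𝒱 d x) : onWords 𝒱 F (word h) = F n x := evalList_word F h

theorem onWords_nil (F : ∀ n, Form K V n) (x : Fin 0 → V) : onWords 𝒱 F [] = F 0 x := by
  rw [← onWords_word (𝒱 := 𝒱) (d := Fin.elim0) (x := x) F (fun i => i.elim0)]
  simp [word]

theorem cyclicForms_cyclicFun (Ω : cyclicForms 𝒱) : CyclicFun (onWords 𝒱 Ω.1) :=
  isCyclic_iff.1 Ω.2

/-- A function of words is homogeneous of degree `p`. -/
def HomFun (p : ℤ) (f : List (Letter 𝒱) → K) : Prop := ∀ w, f w ≠ 0 → wdeg w + p = 0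

theorem hasFormDegree_iff {p : ℤ} {Ω : cyclicForms 𝒱} :
    HasFormDegree p Ω ↔ HomFun p (onWords 𝒱 Ω.1) := by
  constructor
  · intro h w hw
    generalize hn : w.length = n
    obtain ⟨d, x, hx, rfl⟩ := exists_word w hn
    rw [onWords_word] at hw
    rw [wdeg_word]
    exact h _ d x hx hw
  · intro h n d x hx hne
    rw [← wdeg_word hx]
    exact h _ (by rwa [onWords_word])

/-- Exponents need to agree only on nonzero terms, where homogeneity relates the degrees of the
letters to those of the forms. -/
theorem sgn_mul_congr {m n : ℤ} {a : K} (h : a ≠ 0 → (m : ZMod 2) = n) : sgn m * a = sgn n * a := by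
  by_cases ha : a = 0
  · simp [ha]
  · rw [sgn_congr (h ha)]

theorem HomFun.zmod {p : ℤ} {f : List (Letter 𝒱) → K} (hf : HomFun p f) {w : List (Letter 𝒱)}
    (hw : f w ≠ 0) : (wdeg w : ZMod 2) = p := by
  have h := congrArg (Int.cast : ℤ → ZMod 2) (hf w hw)
  push_cast at h
  rw [eq_neg_of_add_eq_zero_left h, ZMod.neg_eq_self_mod_two]

variable (D : DualBases 𝒱 b)

/-- The contraction of two functions of words with the canonical tensor of `b`. -/
noncomputable def wordContraction (f g : List (Letter 𝒱) → K) (x y : List (Letter 𝒱)) : K :=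
  ∑ i, sgn (D.c i + wdeg x * (D.c i + wdeg y)) * (f (x ++ [D.letter i]) * g (y ++ [D.letter' i]))

/-- The value of the Pinczon-Ushirobira bracket on a word. -/
noncomputable def wordBracket (f g : List (Letter 𝒱) → K) : List (Letter 𝒱) → K
  | [] => wordContraction D f g [] []
  | a :: w => cycSum (fun u => ∑ k ∈ Finset.range (u.length + 1),
      wordContraction D f g (u.take k) (u.drop k)) (a :: w)

theorem word_firstPart {n : ℕ} (k : Fin (n + 1)) {d : Fin n → ℤ} {x : Fin n → V}
    (h : IsHomTuple 𝒱 d x) (h' : IsHomTuple 𝒱 (firstPart k d) (firstPart k x)) :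
    word h' = (word h).take k := by
  refine List.ext_getElem (by simp; omega) fun i hi hi' => ?_
  simp [word, firstPart, Letter.mk']

theorem word_lastPart {n : ℕ} (k : Fin (n + 1)) {d : Fin n → ℤ} {x : Fin n → V}
    (h : IsHomTuple 𝒱 d x) (h' : IsHomTuple 𝒱 (lastPart k d) (lastPart k x)) :
    word h' = (word h).drop k := by
  refine List.ext_getElem (by simp) fun i hi hi' => ?_
  simp [word, lastPart, Letter.mk']

theorem apply_snoc (F : ∀ n, Form K V n) {n : ℕ} {d : Fin n → ℤ} {x : Fin n → V}
    (h : IsHomTuple 𝒱 d x) (a : Letter 𝒱) :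
    F (n + 1) (Fin.snoc (α := fun _ => V) x (a.2 : V)) = onWords 𝒱 F (word h ++ [a]) := by
  rw [onWords, vecs_append, vecs_word, ← evalList_ofFn]
  congr 1
  rw [List.ofFn_succ_last]
  simp

theorem contraction_eq_wordContraction (F G : ∀ n, Form K V n) {n : ℕ} (k : Fin (n + 1))
    {d : Fin n → ℤ} {x : Fin n → V} (h : IsHomTuple 𝒱 d x) :
    contraction D.c D.e D.e' F G k d x =
      wordContraction D (onWords 𝒱 F) (onWords 𝒱 G) ((word h).take k) ((word h).drop k) := by
  have h1 : IsHomTuple 𝒱 (firstPart k d) (firstPart k x) := fun i => h _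
  have h2 : IsHomTuple 𝒱 (lastPart k d) (lastPart k x) := fun i => h _
  rw [contraction, wordContraction, ← word_firstPart k h h1, ← word_lastPart k h h2]
  refine Finset.sum_congr rfl fun i _ => ?_
  rw [negOnePow_smul_eq_sgn_mul, wdeg_word, wdeg_word, ← apply_snoc F h1, ← apply_snoc G h2]
  rfl

theorem pinczonUshirobira_eq_wordBracket (F G : ∀ n, Form K V n) {n : ℕ} {d : Fin n → ℤ}
    {x : Fin n → V} (h : IsHomTuple 𝒱 d x) :
    ∑ k : Fin (n + 1), ∑ τ ∈ cyclicPerms n,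
      koszulSign τ d • contraction D.c D.e D.e' F G k (d ∘ τ.symm) (x ∘ τ.symm) =
    wordBracket D (onWords 𝒱 F) (onWords 𝒱 G) (word h) := by
  rw [Finset.sum_comm]
  simp only [← Finset.smul_sum]
  obtain _ | n := n
  · rw [sum_cyclicPerms_zero]
    have hw : word h = [] := by simp [word]
    rw [hw, wordBracket]
    rw [Fin.sum_univ_one, contraction_eq_wordContraction D F G _ (h.comp _)]
    simp [koszulSign, word]
  · rw [sum_cyclicPerms_eq_cycSum n.succ_pos h
      (fun d x => ∑ k : Fin (n + 1 + 1), contraction D.c D.e D.e' F G k d x)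
      (fun u => ∑ k ∈ Finset.range (u.length + 1),
        wordContraction D (onWords 𝒱 F) (onWords 𝒱 G) (u.take k) (u.drop k))]
    · have : word h = (word h).head (by simp [← List.length_pos_iff]) :: (word h).tail := by simp
      rw [this, wordBracket]
    · intro d' x' h'
      rw [length_word, ← Fin.sum_univ_eq_sum_range (fun k => wordContraction D (onWords 𝒱 F)
        (onWords 𝒱 G) ((word h').take k) ((word h').drop k))]
      exact Finset.sum_congr rfl fun k _ => contraction_eq_wordContraction D F G k h'

/-- The cyclic sum of all splittings, organized by the position of the last letter. -/
theorem wordBracket_append_singleton (f g : List (Letter 𝒱) → K) (v : List (Letter 𝒱))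
    (c : Letter 𝒱) : wordBracket D f g (v ++ [c]) =
      ∑ r ∈ Finset.range (v.length + 1), ∑ j ∈ Finset.range (v.length - r + 1),
        (sgn (wdeg (v.take r) * (wdeg ((v.drop r).take j) + wdeg ((v.drop r).drop j ++ [c]))) *
            wordContraction D f g ((v.drop r).take j) ((v.drop r).drop j ++ [c] ++ v.take r) +
          sgn ((wdeg (v.take r) + wdeg ((v.drop r).take j)) * wdeg ((v.drop r).drop j ++ [c])) *
            wordContraction D f g ((v.drop r).drop j ++ [c] ++ v.take r) ((v.drop r).take j)) := by
  have h0 : wordBracket D f g (v ++ [c]) = cycSum (fun u => ∑ k ∈ Finset.range (u.length + 1),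
      wordContraction D f g (u.take k) (u.drop k)) (v ++ [c]) := by
    cases v <;> rfl
  set n := v.length with hn
  set F : ℕ → ℕ → K := fun r k => sgn (wdeg ((v ++ [c]).take r) * wdeg ((v ++ [c]).drop r)) *
    wordContraction D f g (((v ++ [c]).drop r ++ (v ++ [c]).take r).take k)
      (((v ++ [c]).drop r ++ (v ++ [c]).take r).drop k) with hF
  have h1 : wordBracket D f g (v ++ [c]) =
      ∑ r ∈ Finset.range (n + 1), (∑ j ∈ Finset.range (n - r + 1), F r j +
        ∑ m ∈ Finset.range (r + 1), F r (n - r + 1 + m)) := by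
    rw [h0, cycSum, List.length_append, List.length_singleton]
    refine Finset.sum_congr rfl fun r hr => ?_
    rw [Finset.mem_range] at hr
    have hlen : ((v ++ [c]).drop r ++ (v ++ [c]).take r).length = n + 1 := by
      simp; omega
    -- Cuts with `k ≤ n - r` come before `c` and leave it in the second factor; the other `r + 1`
    -- cuts put it in the first.
    have hsplit : n + 1 + 1 = n - r + 1 + (r + 1) := by omega
    rw [hlen, hsplit, Finset.sum_range_add, mul_add, Finset.mul_sum, Finset.mul_sum]
  -- When `c` lies in the first factor, the second factor is the piece `y` of `v` between positions
  -- `m` and `r`; the sum is indexed anew by the start and the length of `y`.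
  have h2 : ∑ r ∈ Finset.range (n + 1), ∑ m ∈ Finset.range (r + 1), F r (n - r + 1 + m) =
      ∑ r ∈ Finset.range (n + 1), ∑ j ∈ Finset.range (n - r + 1), F (r + j) (n - (r + j) + 1 + r) := by
    have := Finset.sum_range_diag_flip (n + 1)
      (fun r j => F (r + j) (n - (r + j) + 1 + r))
    rw [Finset.sum_congr rfl fun r hr => Finset.sum_congr rfl fun m hm => ?_, this]
    · refine Finset.sum_congr rfl fun r hr => ?_
      rw [Finset.mem_range] at hr
      rw [Nat.sub_add_comm (by omega)]
    · rw [Finset.mem_range] at hm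
      rw [Nat.add_sub_cancel' (by omega)]
  rw [h1, Finset.sum_add_distrib, h2, ← Finset.sum_add_distrib]
  refine Finset.sum_congr rfl fun r hr => ?_
  rw [← Finset.sum_add_distrib]
  refine Finset.sum_congr rfl fun j hj => ?_
  rw [Finset.mem_range] at hr hj
  have hv : v = v.take r ++ ((v.drop r).take j ++ (v.drop r).drop j) := by simp
  have lx : (v.take r).length = r := by simp; omega
  have ly : ((v.drop r).take j).length = j := by simp; omega
  have lz : ((v.drop r).drop j).length = n - (r + j) := by simp; omega
  generalize v.take r = x at *
  generalize (v.drop r).take j = y at *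
  generalize (v.drop r).drop j = z at *
  have hw : v ++ [c] = x ++ (y ++ (z ++ [c])) := by rw [hv]; simp
  have hw' : v ++ [c] = (x ++ y) ++ (z ++ [c]) := by rw [hv]; simp
  have lzc : (z ++ [c]).length = n - (r + j) + 1 := by simp [lz]
  congr 1
  · simp only [hF]
    rw [hw, ← lx, List.take_left, List.drop_left, ← ly, List.append_assoc, List.take_left,
      List.drop_left, wdeg_append y]
  · simp only [hF]
    have lxy : r + j = (x ++ y).length := by simp [lx, ly]
    have lr : n - (r + j) + 1 + r = (z ++ [c] ++ x).length := by
      rw [List.length_append, lzc, lx]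
    rw [lr, hw', lxy, List.take_left, List.drop_left, ← List.append_assoc, List.take_left,
      List.drop_left, wdeg_append x]

/-- The right derivative `v ↦ f (v c)`. -/
def rightDer (c : Letter 𝒱) (f : List (Letter 𝒱) → K) (v : List (Letter 𝒱)) : K := f (v ++ [c])

/-- The functions `w ↦ f (w eᵢ)`. -/
noncomputable def leg (f : List (Letter 𝒱) → K) (i : Fin (Module.finrank K V))
    (w : List (Letter 𝒱)) : K := f (w ++ [D.letter i])

theorem onWords_sum_swap [FiniteDimensional K V] (h𝒱 : DirectSum.IsInternal 𝒱)
    (hb : IsMetric 𝒱 b) (m : ℤ) (F G : ∀ n, Form K V n) (x z x' z' : List (Letter 𝒱)) :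
    ∑ i, sgn (m * D.c i) * (onWords 𝒱 F (x ++ D.letter i :: z) *
        onWords 𝒱 G (x' ++ D.letter' i :: z')) =
      ∑ i, sgn (m * D.c i + D.c i + 1) * (onWords 𝒱 F (x ++ D.letter' i :: z) *
        onWords 𝒱 G (x' ++ D.letter i :: z')) := by
  have := D.signed_sum_swap h𝒱 hb m (slot F (vecs x) (vecs z)) (slot G (vecs x') (vecs z'))
  simpa [onWords] using this

/-- Rotating `g` carries the dual letter from the end of `z x` to the place between `x` and `z`,
where an insertion puts it. -/
theorem sgn_mul_wordContraction_left {f g : List (Letter 𝒱) → K} (hg : CyclicFun g)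
    (x y z : List (Letter 𝒱)) :
    sgn (wdeg x * (wdeg y + wdeg z)) * wordContraction D f g y (z ++ x) =
      ∑ i, sgn (D.c i + wdeg y * D.c i + (wdeg y + D.c i) * wdeg z) *
        (f (y ++ [D.letter i]) * g (x ++ D.letter' i :: z)) := by
  rw [wordContraction, Finset.mul_sum]
  refine Finset.sum_congr rfl fun i _ => ?_
  have : g (z ++ x ++ [D.letter' i]) =
      sgn (wdeg z * (wdeg x - 2 - D.c i)) * g (x ++ D.letter' i :: z) := by
    rw [List.append_assoc, hg.append]
    simp [sub_eq_add_neg, add_assoc]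
  rw [this, ← mul_assoc, ← sgn_add, mul_left_comm (f _), ← mul_assoc, ← sgn_add]
  congr 1
  apply sgn_congr
  rw [wdeg_append]
  push_cast
  generalize (D.c i : ZMod 2) = c, (wdeg x : ZMod 2) = x, (wdeg y : ZMod 2) = y,
    (wdeg z : ZMod 2) = z
  revert c x y z; decide

/-- After rotating `F`, the basis letter sits in `F` and the dual one in `G`, the wrong way round
for an insertion into `F`; antisymmetry of the canonical tensor exchanges them. -/
theorem sgn_mul_wordContraction_right [FiniteDimensional K V] (h𝒱 : DirectSum.IsInternal 𝒱)
    (hb : IsMetric 𝒱 b) (F G : ∀ n, Form K V n) (hF : CyclicFun (onWords 𝒱 F))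
    (x y z : List (Letter 𝒱)) :
    sgn ((wdeg x + wdeg y) * wdeg z) *
        wordContraction D (onWords 𝒱 F) (onWords 𝒱 G) (z ++ x) y =
      ∑ i, sgn (1 + wdeg x * (D.c i + wdeg y)) *
        (onWords 𝒱 G (y ++ [D.letter i]) * onWords 𝒱 F (x ++ D.letter' i :: z)) := by
  have h1 : sgn ((wdeg x + wdeg y) * wdeg z) *
        wordContraction D (onWords 𝒱 F) (onWords 𝒱 G) (z ++ x) y =
      sgn (wdeg x * wdeg y) * ∑ i, sgn ((1 + wdeg x) * D.c i) *
        (onWords 𝒱 F (x ++ D.letter i :: z) * onWords 𝒱 G (y ++ [D.letter' i])) := by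
    rw [wordContraction, Finset.mul_sum, Finset.mul_sum]
    refine Finset.sum_congr rfl fun i _ => ?_
    have : onWords 𝒱 F (z ++ x ++ [D.letter i]) =
        sgn (wdeg z * (wdeg x + D.c i)) * onWords 𝒱 F (x ++ D.letter i :: z) := by
      rw [List.append_assoc, hF.append]
      simp
    rw [this]
    simp only [← mul_assoc, ← sgn_add]
    congr 2
    apply sgn_congr
    rw [wdeg_append]
    push_cast
    generalize (D.c i : ZMod 2) = c, (wdeg x : ZMod 2) = x, (wdeg y : ZMod 2) = y,
      (wdeg z : ZMod 2) = z
    revert c x y z; decide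
  rw [h1, onWords_sum_swap D h𝒱 hb, Finset.mul_sum]
  refine Finset.sum_congr rfl fun i _ => ?_
  rw [mul_comm (onWords 𝒱 F _), ← mul_assoc, ← sgn_add]
  congr 1
  apply sgn_congr
  push_cast
  generalize (D.c i : ZMod 2) = c, (wdeg x : ZMod 2) = x, (wdeg y : ZMod 2) = y
  revert c x y; decide

/-- The bracket of homogeneous cyclic forms in terms of insertion operators. -/
theorem rightDer_wordBracket [FiniteDimensional K V] (h𝒱 : DirectSum.IsInternal 𝒱)
    (hb : IsMetric 𝒱 b) {p q : ℤ} {F G : ∀ n, Form K V n} (hF : CyclicFun (onWords 𝒱 F))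
    (hG : CyclicFun (onWords 𝒱 G)) (hp : HomFun p (onWords 𝒱 F)) (hq : HomFun q (onWords 𝒱 G))
    (c : Letter 𝒱) : rightDer c (wordBracket D (onWords 𝒱 F) (onWords 𝒱 G)) =
      (sgn (p * q) : K) •
        insertion p D.letter' (leg D (onWords 𝒱 F)) (rightDer c (onWords 𝒱 G)) -
      insertion q D.letter' (leg D (onWords 𝒱 G)) (rightDer c (onWords 𝒱 F)) := by
  ext v
  rw [rightDer, wordBracket_append_singleton, Pi.sub_apply, Pi.smul_apply, insertion_apply,
    insertion_apply, Finset.smul_sum, ← Finset.sum_sub_distrib]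
  refine Finset.sum_congr rfl fun r _ => ?_
  rw [Finset.smul_sum, ← Finset.sum_sub_distrib]
  refine Finset.sum_congr rfl fun j _ => ?_
  -- Here `v = x y z`. The term with `c` in the second factor inserts `F` into `G`, the other one
  -- inserts `G` into `F`, and `y` is the word consumed.
  generalize v.take r = x
  generalize (v.drop r).take j = y
  generalize (v.drop r).drop j = z
  rw [sgn_mul_wordContraction_left D hG, sgn_mul_wordContraction_right D h𝒱 hb F G hF,
    sub_eq_add_neg, smul_eq_mul, Finset.mul_sum, Finset.mul_sum, Finset.mul_sum,
    ← Finset.sum_neg_distrib]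
  congr 1
  · refine Finset.sum_congr rfl fun i _ => ?_
    simp only [leg, rightDer, List.append_assoc, List.cons_append]
    rw [← mul_assoc (sgn (p * q)), ← sgn_add]
    apply sgn_mul_congr
    intro hne
    have h1 := hp.zmod (left_ne_zero_of_mul hne)
    have h2 := hq.zmod (right_ne_zero_of_mul hne)
    simp only [wdeg_append, wdeg_cons, wdeg_nil, DualBases.letter_fst, DualBases.letter'_fst] at h1 h2 ⊢
    push_cast at h1 h2 ⊢
    generalize (D.c i : ZMod 2) = k, (wdeg x : ZMod 2) = x, (wdeg y : ZMod 2) = y,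
      (wdeg z : ZMod 2) = z, (c.1 : ZMod 2) = c at *
    rw [← h1, ← h2]
    clear h1 h2
    revert k x y z c; decide
  · refine Finset.sum_congr rfl fun i _ => ?_
    simp only [leg, rightDer, List.append_assoc, List.cons_append]
    rw [neg_eq_sgn_one_mul, ← mul_assoc (sgn 1), ← sgn_add]
    apply sgn_mul_congr
    intro hne
    have h2 := hq.zmod (left_ne_zero_of_mul hne)
    simp only [wdeg_append, wdeg_cons, wdeg_nil, DualBases.letter_fst] at h2 ⊢
    push_cast at h2 ⊢
    generalize (D.c i : ZMod 2) = k, (wdeg x : ZMod 2) = x, (wdeg y : ZMod 2) = y at *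
    rw [← h2]
    clear h2
    revert k x y; decide

end WordBracket

/-! ## Lie algebra identities for the bracket on words -/

section LieIdentities

variable {K V : Type*} [Field K] [AddCommGroup V] [Module K V] {𝒱 : ℤ → Submodule K V}
  {b : V →ₗ[K] V →ₗ[K] K}

theorem sgn_eq_one_or (n : ℤ) : (sgn n : K) = 1 ∨ (sgn n : K) = -1 :=
  mul_self_eq_one_iff.1 (sgn_mul_self n)

theorem insertion_smul {I : Type*} [Fintype I] (p : ℤ) (a : I → Letter 𝒱)
    (ψ : I → List (Letter 𝒱) → K) (s : K) (f : List (Letter 𝒱) → K) :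
    insertion p a (fun i => s • ψ i) f = s • insertion p a ψ f := by
  ext w
  simp only [insertion_apply, Pi.smul_apply, smul_eq_mul, Finset.mul_sum]
  refine Finset.sum_congr rfl fun _ _ => Finset.sum_congr rfl fun _ _ =>
    Finset.sum_congr rfl fun _ _ => by ring

theorem insertion_congr {I : Type*} [Fintype I] {p q : ℤ} (h : (p : ZMod 2) = q) (a : I → Letter 𝒱)
    (ψ : I → List (Letter 𝒱) → K) : insertion p a ψ = insertion q a ψ := by
  ext f w
  simp only [insertion_apply]
  refine Finset.sum_congr rfl fun _ _ => Finset.sum_congr rfl fun _ _ => ?_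
  congr 1
  exact sgn_congr (by push_cast; rw [h])

variable (D : DualBases 𝒱 b)

theorem HomFun.hasParity_leg {p : ℤ} {f : List (Letter 𝒱) → K} (hf : HomFun p f) :
    HasParity p D.letter' (leg D f) := by
  intro m i
  ext w
  simp only [twist, leg, Pi.smul_apply, smul_eq_mul]
  apply sgn_mul_congr
  intro hne
  have h := hf.zmod hne
  simp only [wdeg_append, wdeg_cons, wdeg_nil, DualBases.letter_fst, DualBases.letter'_fst] at h ⊢
  push_cast at h ⊢
  rw [← h]
  clear h
  generalize (D.c i : ZMod 2) = k, (wdeg w : ZMod 2) = x, (m : ZMod 2) = y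
  revert k x y; decide

theorem exists_of_wordContraction_ne_zero {f g : List (Letter 𝒱) → K} {x y : List (Letter 𝒱)}
    (h : wordContraction D f g x y ≠ 0) :
    ∃ i, f (x ++ [D.letter i]) ≠ 0 ∧ g (y ++ [D.letter' i]) ≠ 0 := by
  obtain ⟨i, -, hi⟩ := Finset.exists_ne_zero_of_sum_ne_zero h
  exact ⟨i, left_ne_zero_of_mul (right_ne_zero_of_mul hi),
    right_ne_zero_of_mul (right_ne_zero_of_mul hi)⟩

/-- A nonzero value comes from a nonzero term, which keeps track of arities and degrees. The arity
and degree axioms and the centrality of scalars rest on this. -/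
theorem exists_of_wordBracket_ne_zero {f g : List (Letter 𝒱) → K} {w : List (Letter 𝒱)}
    (h : wordBracket D f g w ≠ 0) : ∃ (x y : List (Letter 𝒱)) (i : _),
      x.length + y.length = w.length ∧ wdeg x + wdeg y = wdeg w ∧
        f (x ++ [D.letter i]) ≠ 0 ∧ g (y ++ [D.letter' i]) ≠ 0 := by
  cases w with
  | nil =>
    obtain ⟨i, hi⟩ := exists_of_wordContraction_ne_zero D h
    exact ⟨[], [], i, rfl, rfl, hi⟩
  | cons a w =>
    rw [wordBracket, cycSum] at h
    obtain ⟨r, hr, h⟩ := Finset.exists_ne_zero_of_sum_ne_zero h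
    obtain ⟨k, hk, h⟩ := Finset.exists_ne_zero_of_sum_ne_zero (right_ne_zero_of_mul h)
    obtain ⟨i, hi⟩ := exists_of_wordContraction_ne_zero D h
    generalize hu : (a :: w).drop r ++ (a :: w).take r = u at *
    refine ⟨_, _, i, ?_, ?_, hi⟩
    · rw [← List.length_append, List.take_append_drop, ← hu, List.length_append, add_comm,
        ← List.length_append, List.take_append_drop]
    · rw [wdeg_take_add_drop, ← hu, wdeg_append, add_comm, wdeg_take_add_drop]

theorem HomFun.wordBracket {p q : ℤ} {f g : List (Letter 𝒱) → K} (hf : HomFun p f)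
    (hg : HomFun q g) : HomFun (p + q - 2) (wordBracket D f g) := by
  intro w hw
  obtain ⟨x, y, i, -, hd, h1, h2⟩ := exists_of_wordBracket_ne_zero D hw
  have h1 := hf _ h1
  have h2 := hg _ h2
  simp only [wdeg_append, wdeg_cons, wdeg_nil, DualBases.letter_fst, DualBases.letter'_fst] at h1 h2
  omega

theorem wordBracket_cyclic (f g : List (Letter 𝒱) → K) : CyclicFun (wordBracket D f g) := by
  intro a w
  have h := cycSum_cyclic (fun u => ∑ k ∈ Finset.range (u.length + 1),
      wordContraction D f g (u.take k) (u.drop k)) a w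
  cases w <;> exact h

/-- The contraction of two linear forms with a bilinear one. -/
noncomputable def tripleContraction (f g h : List (Letter 𝒱) → K) : K :=
  ∑ i, ∑ j, f [D.letter i] * g [D.letter j] * h [D.letter' i, D.letter' j]

/-- For a bilinear form, cyclicity is graded symmetry. -/
theorem tripleContraction_comm {p q : ℤ} {f g h : List (Letter 𝒱) → K} (hf : HomFun p f)
    (hg : HomFun q g) (hh : CyclicFun h) : tripleContraction D f g h =
      sgn (p * q) * tripleContraction D g f h := by
  rw [tripleContraction, tripleContraction, Finset.sum_comm, Finset.mul_sum]
  refine Finset.sum_congr rfl fun j _ => ?_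
  rw [Finset.mul_sum]
  refine Finset.sum_congr rfl fun i _ => ?_
  rw [hh (D.letter' i) [D.letter' j], mul_left_comm, mul_comm (f _)]
  simp only [List.singleton_append, mul_assoc]
  apply sgn_mul_congr
  intro hne
  have h2 := hg.zmod (left_ne_zero_of_mul hne)
  have h1 := hf.zmod (left_ne_zero_of_mul (right_ne_zero_of_mul hne))
  simp only [wdeg_cons, wdeg_nil, DualBases.letter_fst, DualBases.letter'_fst] at h1 h2 ⊢
  push_cast at h1 h2 ⊢
  rw [← h1, ← h2]
  clear h1 h2
  generalize (D.c i : ZMod 2) = x, (D.c j : ZMod 2) = y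
  revert x y; decide

theorem tripleContraction_degree {p q r : ℤ} {f g h : List (Letter 𝒱) → K} (hf : HomFun p f)
    (hg : HomFun q g) (hh : HomFun r h) (hne : tripleContraction D f g h ≠ 0) :
    (r : ZMod 2) = p + q := by
  obtain ⟨i, -, hne⟩ := Finset.exists_ne_zero_of_sum_ne_zero hne
  obtain ⟨j, -, hne⟩ := Finset.exists_ne_zero_of_sum_ne_zero hne
  have h1 := hf.zmod (left_ne_zero_of_mul (left_ne_zero_of_mul hne))
  have h2 := hg.zmod (right_ne_zero_of_mul (left_ne_zero_of_mul hne))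
  have h3 := hh.zmod (right_ne_zero_of_mul hne)
  simp only [wdeg_cons, wdeg_nil, DualBases.letter_fst, DualBases.letter'_fst] at h1 h2 h3
  push_cast at h1 h2 h3
  rw [← h1, ← h2, ← h3]
  clear h1 h2 h3
  generalize (D.c i : ZMod 2) = x, (D.c j : ZMod 2) = y
  revert x y; decide

variable [FiniteDimensional K V]

/-- On nonempty words the formula by insertions is visibly antisymmetric; on the empty word this is
the antisymmetry of the canonical tensor. -/
theorem wordBracket_skew (h𝒱 : DirectSum.IsInternal 𝒱)
    (hb : IsMetric 𝒱 b) {p q : ℤ} {F G : ∀ n, Form K V n} (hF : CyclicFun (onWords 𝒱 F))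
    (hG : CyclicFun (onWords 𝒱 G)) (hp : HomFun p (onWords 𝒱 F)) (hq : HomFun q (onWords 𝒱 G)) :
    wordBracket D (onWords 𝒱 F) (onWords 𝒱 G) =
      -((sgn (p * q) : K) • wordBracket D (onWords 𝒱 G) (onWords 𝒱 F)) := by
  ext w
  rcases List.eq_nil_or_concat w with rfl | ⟨v, c, rfl⟩
  · have h := onWords_sum_swap D h𝒱 hb 1 F G [] [] [] []
    simp only [List.nil_append, one_mul] at h
    simp only [wordBracket, wordContraction, List.nil_append, wdeg_nil, zero_mul, add_zero, h,
      Pi.neg_apply, Pi.smul_apply, smul_eq_mul, Finset.mul_sum, neg_eq_sgn_one_mul]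
    refine Finset.sum_congr rfl fun i _ => ?_
    rw [mul_comm (onWords 𝒱 F _)]
    simp only [← mul_assoc (sgn _) (sgn _), ← sgn_add]
    apply sgn_mul_congr
    intro hne
    have h1 := hp.zmod (right_ne_zero_of_mul hne)
    have h2 := hq.zmod (left_ne_zero_of_mul hne)
    simp only [wdeg_cons, wdeg_nil, DualBases.letter_fst, DualBases.letter'_fst] at h1 h2
    push_cast at h1 h2 ⊢
    rw [← h1, ← h2]
    clear h1 h2
    generalize (D.c i : ZMod 2) = k
    revert k; decide
  · have h1 := congrFun (rightDer_wordBracket D h𝒱 hb hF hG hp hq c) v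
    have h2 := congrFun (rightDer_wordBracket D h𝒱 hb hG hF hq hp c) v
    simp only [rightDer, Pi.sub_apply, Pi.smul_apply, smul_eq_mul] at h1 h2
    rw [List.concat_eq_append, Pi.neg_apply, Pi.smul_apply, smul_eq_mul, h1, h2, mul_comm q p, mul_sub,
      sgn_mul_self_mul]
    ring

/-- The legs of a bracket are its right derivatives along the `eᵢ`, which `rightDer_wordBracket`
identifies with the coefficients of a commutator of insertions. -/
theorem insertion_leg_wordBracket (h𝒱 : DirectSum.IsInternal 𝒱)
    (hb : IsMetric 𝒱 b) {p q : ℤ} {F G : ∀ n, Form K V n} (hF : CyclicFun (onWords 𝒱 F))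
    (hG : CyclicFun (onWords 𝒱 G)) (hp : HomFun p (onWords 𝒱 F)) (hq : HomFun q (onWords 𝒱 G))
    (f : List (Letter 𝒱) → K) :
    insertion (p + q - 2) D.letter' (leg D (wordBracket D (onWords 𝒱 F) (onWords 𝒱 G))) f =
      (sgn (p * q) : K) • insertion p D.letter' (leg D (onWords 𝒱 F))
        (insertion q D.letter' (leg D (onWords 𝒱 G)) f) -
      insertion q D.letter' (leg D (onWords 𝒱 G))
        (insertion p D.letter' (leg D (onWords 𝒱 F)) f) := by
  have hleg : leg D (wordBracket D (onWords 𝒱 F) (onWords 𝒱 G)) = fun i => (sgn (p * q) : K) •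
      (insertion p D.letter' (leg D (onWords 𝒱 F)) (leg D (onWords 𝒱 G) i) -
        (sgn (p * q) : K) •
          insertion q D.letter' (leg D (onWords 𝒱 G)) (leg D (onWords 𝒱 F) i)) := by
    ext i : 1
    have h := rightDer_wordBracket D h𝒱 hb hF hG hp hq (D.letter i)
    rw [smul_sub, smul_smul, sgn_mul_self, one_smul]
    exact h
  have hpar : ((p + q - 2 : ℤ) : ZMod 2) = ((p + q : ℤ) : ZMod 2) := by
    push_cast
    generalize (p : ZMod 2) = x, (q : ZMod 2) = y
    revert x y; decide
  rw [hleg, insertion_smul, insertion_congr hpar, insertion_commutator p q D.letter' _ _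
    (hp.hasParity_leg D) (hq.hasParity_leg D), smul_sub, smul_smul, sgn_mul_self, one_smul]

/-- Only the linear component of the inner bracket contributes, and each of its terms contracts a
linear form with a bilinear one. -/
theorem wordBracket_wordBracket_nil (h𝒱 : DirectSum.IsInternal 𝒱)
    (hb : IsMetric 𝒱 b) {p q r : ℤ} {f : List (Letter 𝒱) → K} {G H : ∀ n, Form K V n}
    (hG : CyclicFun (onWords 𝒱 G)) (hH : CyclicFun (onWords 𝒱 H)) (hp : HomFun p f)
    (hq : HomFun q (onWords 𝒱 G)) (hr : HomFun r (onWords 𝒱 H)) :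
    wordBracket D f (wordBracket D (onWords 𝒱 G) (onWords 𝒱 H)) [] =
      sgn p * (sgn (q * r) * tripleContraction D (onWords 𝒱 G) f (onWords 𝒱 H) -
        tripleContraction D (onWords 𝒱 H) f (onWords 𝒱 G)) := by
  rw [wordBracket, wordContraction, tripleContraction, tripleContraction, Finset.sum_comm,
    Finset.sum_comm (f := fun i j => onWords 𝒱 H [D.letter i] * f [D.letter j] *
      onWords 𝒱 G [D.letter' i, D.letter' j]), Finset.mul_sum, ← Finset.sum_sub_distrib,
    Finset.mul_sum]
  refine Finset.sum_congr rfl fun i _ => ?_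
  have h := congrFun (rightDer_wordBracket D h𝒱 hb hG hH hq hr (D.letter' i)) []
  simp only [rightDer, Pi.sub_apply, Pi.smul_apply, smul_eq_mul, insertion_nil, leg,
    List.nil_append, List.singleton_append] at h
  simp only [List.nil_append, wdeg_nil, zero_mul, add_zero, h]
  have hs : sgn (D.c i) * f [D.letter i] = sgn p * f [D.letter i] := by
    apply sgn_mul_congr
    intro hne
    simpa using hp.zmod hne
  rw [← mul_assoc, hs, mul_assoc]
  congr 1
  simp only [mul_sub, Finset.mul_sum, mul_left_comm (f _), mul_assoc]

theorem wordBracket_jacobi_nil (h𝒱 : DirectSum.IsInternal 𝒱)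
    (hb : IsMetric 𝒱 b) {p q r : ℤ} {F G H : ∀ n, Form K V n} (hF : CyclicFun (onWords 𝒱 F))
    (hG : CyclicFun (onWords 𝒱 G)) (hH : CyclicFun (onWords 𝒱 H)) (hp : HomFun p (onWords 𝒱 F))
    (hq : HomFun q (onWords 𝒱 G)) (hr : HomFun r (onWords 𝒱 H)) :
    wordBracket D (onWords 𝒱 F) (wordBracket D (onWords 𝒱 G) (onWords 𝒱 H)) [] +
      sgn (p * (q + r)) *
        wordBracket D (onWords 𝒱 G) (wordBracket D (onWords 𝒱 H) (onWords 𝒱 F)) [] +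
      sgn (r * (p + q)) *
        wordBracket D (onWords 𝒱 H) (wordBracket D (onWords 𝒱 F) (onWords 𝒱 G)) [] = 0 := by
  rw [wordBracket_wordBracket_nil D h𝒱 hb hG hH hp hq hr,
    wordBracket_wordBracket_nil D h𝒱 hb hH hF hq hr hp,
    wordBracket_wordBracket_nil D h𝒱 hb hF hG hr hp hq,
    tripleContraction_comm D hq hp hH, tripleContraction_comm D hr hq hF,
    tripleContraction_comm D hp hr hG]
  have h1 := tripleContraction_degree D hp hq hr
  have h2 := tripleContraction_degree D hq hr hp
  have h3 := tripleContraction_degree D hr hp hq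
  set T1 := tripleContraction D (onWords 𝒱 F) (onWords 𝒱 G) (onWords 𝒱 H)
  set T2 := tripleContraction D (onWords 𝒱 G) (onWords 𝒱 H) (onWords 𝒱 F)
  set T3 := tripleContraction D (onWords 𝒱 H) (onWords 𝒱 F) (onWords 𝒱 G)
  -- The six terms cancel in pairs, but only after using that a nonzero contraction ties the three
  -- degrees together modulo 2.
  have e1 : sgn (p + q * r + q * p) * T1 = sgn (p * (q + r) + q) * T1 := by
    apply sgn_mul_congr
    intro hne
    push_cast
    rw [h1 hne]
    generalize (p : ZMod 2) = x, (q : ZMod 2) = y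
    revert x y; decide
  have e2 : sgn (p * (q + r) + q + r * p + r * q) * T2 = sgn (r * (p + q) + r) * T2 := by
    apply sgn_mul_congr
    intro hne
    push_cast
    rw [h2 hne]
    generalize (r : ZMod 2) = x, (q : ZMod 2) = y
    revert x y; decide
  have e3 : sgn (r * (p + q) + r + p * q + p * r) * T3 = sgn p * T3 := by
    apply sgn_mul_congr
    intro hne
    push_cast
    rw [h3 hne]
    generalize (r : ZMod 2) = x, (p : ZMod 2) = y
    revert x y; decide
  simp only [sgn_add] at e1 e2 e3
  linear_combination e1 + e2 + e3

/-- The inner brackets enter as families of forms `FG`, `GH`, `HF` because the antisymmetry of the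
canonical tensor uses linearity in the contracted slot, which a bare function of words lacks. -/
theorem wordBracket_jacobi (h𝒱 : DirectSum.IsInternal 𝒱)
    (hb : IsMetric 𝒱 b) {p q r : ℤ} {F G H FG GH HF : ∀ n, Form K V n}
    (hF : CyclicFun (onWords 𝒱 F))
    (hG : CyclicFun (onWords 𝒱 G)) (hH : CyclicFun (onWords 𝒱 H)) (hp : HomFun p (onWords 𝒱 F))
    (hq : HomFun q (onWords 𝒱 G)) (hr : HomFun r (onWords 𝒱 H))
    (hFG : onWords 𝒱 FG = wordBracket D (onWords 𝒱 F) (onWords 𝒱 G))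
    (hGH : onWords 𝒱 GH = wordBracket D (onWords 𝒱 G) (onWords 𝒱 H))
    (hHF : onWords 𝒱 HF = wordBracket D (onWords 𝒱 H) (onWords 𝒱 F)) :
    wordBracket D (onWords 𝒱 F) (onWords 𝒱 GH) +
      (sgn (p * (q + r)) : K) • wordBracket D (onWords 𝒱 G) (onWords 𝒱 HF) +
      (sgn (r * (p + q)) : K) • wordBracket D (onWords 𝒱 H) (onWords 𝒱 FG) = 0 := by
  ext w
  rcases List.eq_nil_or_concat w with rfl | ⟨v, c, rfl⟩
  · have h := wordBracket_jacobi_nil D h𝒱 hb hF hG hH hp hq hr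
    rwa [← hFG, ← hGH, ← hHF] at h
  · have key : ∀ {p q r : ℤ} {F G H GH : ∀ n, Form K V n} (hF : CyclicFun (onWords 𝒱 F))
        (hG : CyclicFun (onWords 𝒱 G)) (hH : CyclicFun (onWords 𝒱 H))
        (hp : HomFun p (onWords 𝒱 F)) (hq : HomFun q (onWords 𝒱 G))
        (hr : HomFun r (onWords 𝒱 H))
        (hGH : onWords 𝒱 GH = wordBracket D (onWords 𝒱 G) (onWords 𝒱 H)),
        wordBracket D (onWords 𝒱 F) (onWords 𝒱 GH) (v ++ [c]) =
          (sgn (p * q) * sgn (r * p)) * (sgn (q * r) * insertion p D.letter' (leg D (onWords 𝒱 F))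
            (insertion q D.letter' (leg D (onWords 𝒱 G)) (rightDer c (onWords 𝒱 H))) v -
            insertion p D.letter' (leg D (onWords 𝒱 F))
            (insertion r D.letter' (leg D (onWords 𝒱 H)) (rightDer c (onWords 𝒱 G))) v) -
          (sgn (q * r) * insertion q D.letter' (leg D (onWords 𝒱 G))
            (insertion r D.letter' (leg D (onWords 𝒱 H)) (rightDer c (onWords 𝒱 F))) v -
            insertion r D.letter' (leg D (onWords 𝒱 H))
            (insertion q D.letter' (leg D (onWords 𝒱 G)) (rightDer c (onWords 𝒱 F))) v) := by
      intro p q r F G H GH hF hG hH hp hq hr hGH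
      have hcyc : CyclicFun (onWords 𝒱 GH) := hGH ▸ wordBracket_cyclic D _ _
      have hhom : HomFun (q + r - 2) (onWords 𝒱 GH) := hGH ▸ hq.wordBracket D hr
      have h1 := congrFun (rightDer_wordBracket D h𝒱 hb hF hcyc hp hhom c) v
      rw [hGH, rightDer_wordBracket D h𝒱 hb hG hH hq hr, insertion_leg_wordBracket D h𝒱 hb hG hH hq hr,
        ← hGH] at h1
      have hs : (sgn (p * (q + r - 2)) : K) = sgn (p * q) * sgn (r * p) := by
        rw [← sgn_add]
        apply sgn_congr
        push_cast
        generalize (p : ZMod 2) = x, (q : ZMod 2) = y, (r : ZMod 2) = z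
        revert x y z; decide
      rw [hs] at h1
      simpa only [rightDer, map_sub, map_smul, Pi.sub_apply, Pi.smul_apply, smul_eq_mul] using h1
    have hs1 : (sgn (p * (q + r)) : K) = sgn (p * q) * sgn (r * p) := by
      rw [mul_add, sgn_add, mul_comm r p]
    have hs2 : (sgn (r * (p + q)) : K) = sgn (r * p) * sgn (q * r) := by
      rw [mul_add, sgn_add, mul_comm r q]
    rw [List.concat_eq_append, Pi.add_apply, Pi.add_apply, Pi.smul_apply, Pi.smul_apply, smul_eq_mul,
      smul_eq_mul, key hF hG hH hp hq hr hGH, key hG hH hF hq hr hp hHF, key hH hF hG hr hp hq hFG,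
      hs1, hs2]
    -- Each double bracket has become four double insertions, and for every choice of the three
    -- signs the twelve terms cancel.
    rcases sgn_eq_one_or (K := K) (p * q) with h1 | h1 <;>
    rcases sgn_eq_one_or (K := K) (q * r) with h2 | h2 <;>
    rcases sgn_eq_one_or (K := K) (r * p) with h3 | h3 <;>
    rw [h1, h2, h3, Pi.zero_apply] <;> ring

end LieIdentities

/-! ## Construction of the bracket of a metric -/

section Construction

variable {K V : Type*} [Field K] [AddCommGroup V] [Module K V] {𝒱 : ℤ → Submodule K V}
  {b : V →ₗ[K] V →ₗ[K] K}

theorem form_ext_onWords [FiniteDimensional K V] (h𝒱 : DirectSum.IsInternal 𝒱)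
    {F G : ∀ n, Form K V n} (h : onWords 𝒱 F = onWords 𝒱 G) : F = G := by
  obtain ⟨e, c, mem⟩ := exists_homogeneous_basis h𝒱
  ext1 n
  refine Module.Basis.ext_multilinear (fun _ => e) fun w => ?_
  have hw : IsHomTuple 𝒱 (fun i => c (w i)) (fun i => e (w i)) := fun i => mem (w i)
  rw [← onWords_word F hw, ← onWords_word G hw, h]

theorem cyclicForms_ext [FiniteDimensional K V] (h𝒱 : DirectSum.IsInternal 𝒱)
    {Ω Ω' : cyclicForms 𝒱} (h : onWords 𝒱 Ω.1 = onWords 𝒱 Ω'.1) : Ω = Ω' :=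
  Subtype.ext (form_ext_onWords h𝒱 h)

/-- Multilinear maps that agree on tuples of basis vectors of the right degrees agree on all
homogeneous tuples of these degrees. -/
theorem eq_on_homTuple (h𝒱 : DirectSum.IsInternal 𝒱) {ι : Type*} [Fintype ι] [DecidableEq ι]
    (e : Module.Basis ι K V) {c : ι → ℤ} (mem : ∀ i, e i ∈ shiftOne 𝒱 (c i)) {n : ℕ}
    (F G : Form K V n) {d : Fin n → ℤ} (hFG : ∀ w : Fin n → ι, (∀ i, c (w i) = d i) →
      F (fun i => e (w i)) = G (fun i => e (w i))) {x : Fin n → V} (hx : IsHomTuple 𝒱 d x) :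
    F x = G x := by
  have hexp : x = fun i => ∑ j, e.coord j (x i) • e j := by
    ext i
    exact (e.sum_repr (x i)).symm
  rw [hexp, MultilinearMap.map_sum, MultilinearMap.map_sum]
  refine Finset.sum_congr rfl fun w _ => ?_
  rw [MultilinearMap.map_smul_univ, MultilinearMap.map_smul_univ]
  by_cases hw : ∏ i, e.coord (w i) (x i) = 0
  · rw [hw, zero_smul, zero_smul]
  · rw [hFG w fun i => degree_eq_of_coord_ne_zero h𝒱 e mem (hx i)
      fun h => hw (Finset.prod_eq_zero (Finset.mem_univ i) h)]

/-- The form `x ↦ F(x₁, …, xₖ, u) G(xₖ₊₁, …, xₙ, u')`. -/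
noncomputable def splitForm {n : ℕ} (k : Fin (n + 1)) (F : Form K V (k.val + 1))
    (G : Form K V (n - k.val + 1)) (u u' : V) : Form K V n :=
  ((LinearMap.mul' K K).compMultilinearMap
    (((LinearMap.applyₗ u).compMultilinearMap F.curryRight).domCoprod
      ((LinearMap.applyₗ u').compMultilinearMap G.curryRight))).domDomCongr
    (finSumFinEquiv.trans (finCongr (by omega)))

theorem splitForm_apply {n : ℕ} (k : Fin (n + 1)) (F : Form K V (k.val + 1))
    (G : Form K V (n - k.val + 1)) (u u' : V) (x : Fin n → V) : splitForm k F G u u' x =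
      F (Fin.snoc (α := fun _ => V) (firstPart k x) u) *
        G (Fin.snoc (α := fun _ => V) (lastPart k x) u') := rfl

/-- For fixed degrees, the Pinczon-Ushirobira formula is multilinear. -/
theorem exists_pinczonUshirobira_form (D : DualBases 𝒱 b) (F G : ∀ n, Form K V n) {n : ℕ}
    (d : Fin n → ℤ) : ∃ P : Form K V n, ∀ x, P x =
      ∑ k : Fin (n + 1), ∑ τ ∈ cyclicPerms n,
        koszulSign τ d • contraction D.c D.e D.e' F G k (d ∘ τ.symm) (x ∘ τ.symm) := by
  refine ⟨∑ k : Fin (n + 1), ∑ τ ∈ cyclicPerms n, (((koszulSign τ d : ℤˣ) : ℤ) : K) •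
    ∑ i, (sgn (D.c i + (∑ a, firstPart k (d ∘ τ.symm) a) *
      (D.c i + ∑ a, lastPart k (d ∘ τ.symm) a)) : K) •
      (splitForm k (F _) (G _) (D.e i) (D.e' i)).domDomCongr τ.symm, fun x => ?_⟩
  simp only [sum_apply, smul_apply, MultilinearMap.domDomCongr_apply,
    splitForm_apply, contraction, negOnePow_smul_eq_sgn_mul, smul_eq_mul]
  refine Finset.sum_congr rfl fun k _ => Finset.sum_congr rfl fun τ _ => ?_
  rw [Units.smul_def, zsmul_eq_mul]
  rfl

variable (D : DualBases 𝒱 b)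

/-- The bracket of two families of forms, defined by its values on the basis. -/
noncomputable def bracketForm (F G : ∀ n, Form K V n) (n : ℕ) : Form K V n :=
  ∑ w : Fin n → Fin (Module.finrank K V),
    wordBracket D (onWords 𝒱 F) (onWords 𝒱 G) (List.ofFn fun i => D.letter (w i)) •
      (MultilinearMap.mkPiAlgebra K (Fin n) K).compLinearMap fun i => D.e.coord (w i)

theorem bracketForm_basis (F G : ∀ n, Form K V n) {n : ℕ}
    (w : Fin n → Fin (Module.finrank K V)) : bracketForm D F G n (fun i => D.e (w i)) =
      wordBracket D (onWords 𝒱 F) (onWords 𝒱 G) (List.ofFn fun i => D.letter (w i)) := by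
  rw [bracketForm, sum_apply, Finset.sum_eq_single w]
  · simp
  · intro w' _ hne
    obtain ⟨i, hi⟩ := Function.ne_iff.1 hne
    rw [smul_apply, MultilinearMap.compLinearMap_apply,
      MultilinearMap.mkPiAlgebra_apply, Finset.prod_eq_zero (Finset.mem_univ i), smul_zero]
    simp [Ne.symm hi]
  · simp

/-- For each fixed degree vector the formula is a multilinear form; it agrees with `bracketForm` on
basis tuples of these degrees, hence on all homogeneous tuples of these degrees. -/
theorem bracketForm_apply (h𝒱 : DirectSum.IsInternal 𝒱) (F G : ∀ n, Form K V n) {n : ℕ}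
    {d : Fin n → ℤ} {x : Fin n → V} (hx : IsHomTuple 𝒱 d x) : bracketForm D F G n x =
      wordBracket D (onWords 𝒱 F) (onWords 𝒱 G) (word hx) := by
  obtain ⟨P, hP⟩ := exists_pinczonUshirobira_form D F G d
  rw [← pinczonUshirobira_eq_wordBracket D F G hx, ← hP]
  refine eq_on_homTuple h𝒱 D.e D.mem _ _ (fun w hw => ?_) hx
  obtain rfl : (fun i => D.c (w i)) = d := funext hw
  have hw' : IsHomTuple 𝒱 (fun i => D.c (w i)) (fun i => D.e (w i)) := fun i => D.mem (w i)
  rw [hP, pinczonUshirobira_eq_wordBracket D F G hw', bracketForm_basis]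
  rfl

theorem onWords_bracketForm (h𝒱 : DirectSum.IsInternal 𝒱) (F G : ∀ n, Form K V n) :
    onWords 𝒱 (bracketForm D F G) = wordBracket D (onWords 𝒱 F) (onWords 𝒱 G) := by
  ext w
  generalize hn : w.length = n
  obtain ⟨d, x, hx, rfl⟩ := exists_word w hn
  rw [onWords_word, bracketForm_apply D h𝒱 F G hx]

/-- The sum over signed rotations, which is `f []` on the empty word. -/
def cycTotal (f : List (Letter 𝒱) → K) : List (Letter 𝒱) → K
  | [] => f []
  | a :: w => cycSum f (a :: w)

theorem wordBracket_eq_cycTotal (f g : List (Letter 𝒱) → K) : wordBracket D f g =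
    cycTotal fun u => ∑ k ∈ Finset.range (u.length + 1),
      wordContraction D f g (u.take k) (u.drop k) := by
  ext w
  cases w with
  | nil => simp [wordBracket, cycTotal]
  | cons a w => rfl

theorem cycTotal_add (f g : List (Letter 𝒱) → K) :
    cycTotal (fun w => f w + g w) = cycTotal f + cycTotal g := by
  ext w
  cases w with
  | nil => rfl
  | cons a w => simp only [cycTotal, Pi.add_apply, cycSum, mul_add, Finset.sum_add_distrib]

theorem cycTotal_mul (s : K) (f : List (Letter 𝒱) → K) :
    cycTotal (fun w => s * f w) = s • cycTotal f := by
  ext w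
  cases w with
  | nil => rfl
  | cons a w => simp only [cycTotal, Pi.smul_apply, cycSum, smul_eq_mul, Finset.mul_sum,
      mul_left_comm]

theorem wordBracket_add_left (f f' g : List (Letter 𝒱) → K) :
    wordBracket D (f + f') g = wordBracket D f g + wordBracket D f' g := by
  simp only [wordBracket_eq_cycTotal, ← cycTotal_add, wordContraction, Pi.add_apply, add_mul, mul_add,
    Finset.sum_add_distrib]

theorem wordBracket_add_right (f g g' : List (Letter 𝒱) → K) :
    wordBracket D f (g + g') = wordBracket D f g + wordBracket D f g' := by
  simp only [wordBracket_eq_cycTotal, ← cycTotal_add, wordContraction, Pi.add_apply, mul_add,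
    Finset.sum_add_distrib]

theorem wordBracket_smul_left (s : K) (f g : List (Letter 𝒱) → K) :
    wordBracket D (s • f) g = s • wordBracket D f g := by
  simp only [wordBracket_eq_cycTotal, ← cycTotal_mul, wordContraction, Pi.smul_apply, smul_eq_mul,
    Finset.mul_sum, mul_assoc, mul_left_comm s]

theorem wordBracket_smul_right (s : K) (f g : List (Letter 𝒱) → K) :
    wordBracket D f (s • g) = s • wordBracket D f g := by
  simp only [wordBracket_eq_cycTotal, ← cycTotal_mul, wordContraction, Pi.smul_apply, smul_eq_mul,
    Finset.mul_sum, mul_left_comm _ s]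

theorem bracketForm_cyclicFun (h𝒱 : DirectSum.IsInternal 𝒱) (F G : ∀ n, Form K V n) :
    CyclicFun (onWords 𝒱 (bracketForm D F G)) :=
  (onWords_bracketForm D h𝒱 F G).symm ▸ wordBracket_cyclic D _ _

/-- A single choice of dual bases already determines the bracket, whence its uniqueness for a given
metric. -/
theorem IsPinczonUshirobira.onWords_eq
    {br : cyclicForms 𝒱 →ₗ[K] cyclicForms 𝒱 →ₗ[K] cyclicForms 𝒱}
    (h : IsPinczonUshirobira 𝒱 b br) (Ω Ω' : cyclicForms 𝒱) :
    onWords 𝒱 (br Ω Ω').1 = wordBracket D (onWords 𝒱 Ω.1) (onWords 𝒱 Ω'.1) := by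
  ext w
  generalize hn : w.length = n
  obtain ⟨d, x, hx, rfl⟩ := exists_word w hn
  rw [onWords_word, h D.e D.c D.e' D.mem D.dual Ω Ω' n d x hx,
    pinczonUshirobira_eq_wordBracket D Ω.1 Ω'.1 hx]

variable [FiniteDimensional K V]

/-- The bracket of a metric. -/
noncomputable def metricBracket (h𝒱 : DirectSum.IsInternal 𝒱) :
    cyclicForms 𝒱 →ₗ[K] cyclicForms 𝒱 →ₗ[K] cyclicForms 𝒱 :=
  LinearMap.mk₂ K
    (fun Ω Ω' => ⟨bracketForm D Ω.1 Ω'.1, isCyclic_iff.2 (bracketForm_cyclicFun D h𝒱 Ω.1 Ω'.1)⟩)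
    (fun Ω₁ Ω₂ Ω' => cyclicForms_ext h𝒱 ((onWords_bracketForm D h𝒱 _ _).trans
      ((wordBracket_add_left D (onWords 𝒱 Ω₁.1) (onWords 𝒱 Ω₂.1) (onWords 𝒱 Ω'.1)).trans
        (congrArg₂ (· + ·) (onWords_bracketForm D h𝒱 _ _).symm
          (onWords_bracketForm D h𝒱 _ _).symm))))
    (fun s Ω Ω' => cyclicForms_ext h𝒱 ((onWords_bracketForm D h𝒱 _ _).trans
      ((wordBracket_smul_left D s (onWords 𝒱 Ω.1) (onWords 𝒱 Ω'.1)).trans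
        (congrArg (s • ·) (onWords_bracketForm D h𝒱 _ _).symm))))
    (fun Ω Ω₁ Ω₂ => cyclicForms_ext h𝒱 ((onWords_bracketForm D h𝒱 _ _).trans
      ((wordBracket_add_right D (onWords 𝒱 Ω.1) (onWords 𝒱 Ω₁.1) (onWords 𝒱 Ω₂.1)).trans
        (congrArg₂ (· + ·) (onWords_bracketForm D h𝒱 _ _).symm
          (onWords_bracketForm D h𝒱 _ _).symm))))
    (fun s Ω Ω' => cyclicForms_ext h𝒱 ((onWords_bracketForm D h𝒱 _ _).trans
      ((wordBracket_smul_right D s (onWords 𝒱 Ω.1) (onWords 𝒱 Ω'.1)).trans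
        (congrArg (s • ·) (onWords_bracketForm D h𝒱 _ _).symm))))

theorem onWords_metricBracket (h𝒱 : DirectSum.IsInternal 𝒱) (Ω Ω' : cyclicForms 𝒱) :
    onWords 𝒱 (metricBracket D h𝒱 Ω Ω').1 = wordBracket D (onWords 𝒱 Ω.1) (onWords 𝒱 Ω'.1) :=
  onWords_bracketForm D h𝒱 Ω.1 Ω'.1

theorem wordContraction_eq (h𝒱 : DirectSum.IsInternal 𝒱) (hb : IsMetric 𝒱 b)
    (D' : DualBases 𝒱 b) (F G : ∀ n, Form K V n) (x y : List (Letter 𝒱)) :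
    wordContraction D (onWords 𝒱 F) (onWords 𝒱 G) x y =
      wordContraction D' (onWords 𝒱 F) (onWords 𝒱 G) x y := by
  have h := D.signed_sum_eq_sum h𝒱 hb D' (1 + wdeg x) (slot F (vecs x) []) (slot G (vecs y) [])
  have key : ∀ E : DualBases 𝒱 b, wordContraction E (onWords 𝒱 F) (onWords 𝒱 G) x y =
      sgn (wdeg x * wdeg y) * ∑ i, sgn ((1 + wdeg x) * E.c i) *
        (slot F (vecs x) [] (E.e i) * slot G (vecs y) [] (E.e' i)) := by
    intro E
    rw [wordContraction, Finset.mul_sum]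
    refine Finset.sum_congr rfl fun i _ => ?_
    rw [← mul_assoc (sgn (wdeg x * wdeg y)), ← sgn_add]
    congr 2
    · ring
    · simp [onWords]
    · simp [onWords]
  rw [key, key, h]

theorem wordBracket_eq (h𝒱 : DirectSum.IsInternal 𝒱) (hb : IsMetric 𝒱 b)
    (D' : DualBases 𝒱 b) (F G : ∀ n, Form K V n) :
    wordBracket D (onWords 𝒱 F) (onWords 𝒱 G) = wordBracket D' (onWords 𝒱 F) (onWords 𝒱 G) := by
  simp only [wordBracket_eq_cycTotal, wordContraction_eq D h𝒱 hb D']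

theorem isPinczonUshirobira_metricBracket (h𝒱 : DirectSum.IsInternal 𝒱) (hb : IsMetric 𝒱 b) :
    IsPinczonUshirobira 𝒱 b (metricBracket D h𝒱) := by
  intro e c e' mem dual Ω Ω' n d x hx
  have h1 := pinczonUshirobira_eq_wordBracket (hb.dualBases e c e' mem dual) Ω.1 Ω'.1 hx
  rw [← wordBracket_eq D h𝒱 hb, ← onWords_metricBracket D h𝒱, onWords_word] at h1
  exact h1.symm

end Construction

/-! ## Cyclic tensors of linear forms -/

section CyclicTensors

variable {K V : Type*} [Field K] [AddCommGroup V] [Module K V] {𝒱 : ℤ → Submodule K V}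
  {b : V →ₗ[K] V →ₗ[K] K}

/-- The total degree of a list of linear forms with degrees. -/
def cdeg (l : List (ℤ × Module.Dual K V)) : ℤ := (l.map Prod.fst).sum

/-- The tensor product of a list of linear forms, as a function of words. -/
def tensorFun : List (ℤ × Module.Dual K V) → List (Letter 𝒱) → K
  | [], [] => 1
  | p :: l, a :: w => sgn (cdeg l * a.1) * (p.2 a.2 * tensorFun l w)
  | _, _ => 0

@[simp] theorem cdeg_nil : cdeg ([] : List (ℤ × Module.Dual K V)) = 0 := rfl

@[simp] theorem cdeg_cons (p : ℤ × Module.Dual K V) (l : List (ℤ × Module.Dual K V)) :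
    cdeg (p :: l) = p.1 + cdeg l := by simp [cdeg]

@[simp] theorem cdeg_append (l l' : List (ℤ × Module.Dual K V)) :
    cdeg (l ++ l') = cdeg l + cdeg l' := by simp [cdeg]

theorem cdeg_ofFn {k : ℕ} (g : Fin k → ℤ) (β : Fin k → Module.Dual K V) :
    cdeg (List.ofFn fun i => (g i, β i)) = ∑ i, g i := by
  simp [cdeg, List.map_ofFn, Function.comp_def, List.sum_ofFn]

theorem tensorValue_eq_tensorFun {k : ℕ} (g : Fin k → ℤ) (β : Fin k → Module.Dual K V)
    {d : Fin k → ℤ} {x : Fin k → V} (h : IsHomTuple 𝒱 d x) :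
    tensorValue g β d x = tensorFun (List.ofFn fun i => (g i, β i)) (word h) := by
  induction k with
  | zero => simp [tensorValue, word, tensorFun]
  | succ k ih =>
    have h' : IsHomTuple 𝒱 (fun i : Fin k => d i.succ) (fun i => x i.succ) := fun i => h i.succ
    have hw : word h = ⟨d 0, x 0, h 0⟩ :: word h' := by
      simp [word, List.ofFn_succ, Letter.mk']
    rw [hw, List.ofFn_succ, tensorFun, ← ih (fun i => g i.succ) (fun i => β i.succ) h', tensorValue,
      tensorValue, cdeg_ofFn, negOnePow_smul_eq_sgn_mul, negOnePow_smul_eq_sgn_mul, Fin.prod_univ_succ,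
      Finset.sum_filter, Finset.sum_filter, Fintype.sum_prod_type, Fintype.sum_prod_type,
      Fin.sum_univ_succ]
    simp only [Fin.sum_univ_succ, lt_irrefl, if_false, Fin.succ_pos, if_true, zero_add,
      Fin.not_lt_zero, Fin.succ_lt_succ_iff, sgn_add, Finset.sum_mul]
    ring

theorem IsHomCovector.zmod {g : ℤ} {β : Module.Dual K V} (hβ : IsHomCovector 𝒱 g β) {a : Letter 𝒱}
    (h : β a.2 ≠ 0) : (a.1 : ZMod 2) = g := by
  have h := congrArg (Int.cast : ℤ → ZMod 2) (hβ a.1 a.2 a.2.2 h)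
  push_cast at h
  rw [eq_neg_of_add_eq_zero_left h, ZMod.neg_eq_self_mod_two]

theorem tensorFun_length {l : List (ℤ × Module.Dual K V)} {w : List (Letter 𝒱)}
    (h : tensorFun l w ≠ 0) : w.length = l.length := by
  induction l generalizing w with
  | nil => cases w with
    | nil => rfl
    | cons a w => simp [tensorFun] at h
  | cons p l ih => cases w with
    | nil => simp [tensorFun] at h
    | cons a w =>
      rw [tensorFun] at h
      simp [ih (right_ne_zero_of_mul (right_ne_zero_of_mul h))]

/-- A nonzero value of a tensor of homogeneous linear forms forces the degrees of the entries. -/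
theorem tensorFun_degree {l l' : List (ℤ × Module.Dual K V)}
    (hl : ∀ p ∈ l, IsHomCovector 𝒱 p.1 p.2) {x y : List (Letter 𝒱)} (hx : x.length = l.length)
    (h : tensorFun (l ++ l') (x ++ y) ≠ 0) :
    (wdeg x : ZMod 2) = cdeg l ∧ tensorFun l' y ≠ 0 := by
  induction l generalizing x with
  | nil =>
    obtain rfl := List.length_eq_zero_iff.1 hx
    exact ⟨rfl, h⟩
  | cons p l ih => cases x with
    | nil => simp at hx
    | cons a x =>
      rw [List.cons_append, List.cons_append, tensorFun] at h
      obtain ⟨h1, h2⟩ := ih (fun q hq => hl q (List.mem_cons_of_mem p hq)) (by simpa using hx)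
        (right_ne_zero_of_mul (right_ne_zero_of_mul h))
      have h3 := (hl p List.mem_cons_self).zmod (left_ne_zero_of_mul (right_ne_zero_of_mul h))
      refine ⟨?_, h2⟩
      rw [wdeg_cons, cdeg_cons]
      push_cast
      rw [h1, h3]

theorem tensorFun_middle (l l' : List (ℤ × Module.Dual K V)) (p : ℤ × Module.Dual K V)
    {x : List (Letter 𝒱)} (y : List (Letter 𝒱)) (a : Letter 𝒱) (hx : x.length = l.length) :
    tensorFun (l ++ p :: l') (x ++ a :: y) =
      sgn (p.1 * wdeg x + cdeg l' * a.1) * (p.2 a.2 * tensorFun (l ++ l') (x ++ y)) := by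
  induction l generalizing x with
  | nil =>
    obtain rfl := List.length_eq_zero_iff.1 hx
    simp [tensorFun]
  | cons q l ih => cases x with
    | nil => simp at hx
    | cons c x =>
      rw [List.cons_append, List.cons_append, List.cons_append, List.cons_append, tensorFun, tensorFun,
        ih (by simpa using hx)]
      simp only [cdeg_append, cdeg_cons, wdeg_cons, add_mul, mul_add, sgn_add]
      ring

/-- A preliminary rotation only permutes the terms of the total over all rotations. -/
theorem cycTotal_signedRotation (f : List (Letter 𝒱) → K) (s : ℕ) (w : List (Letter 𝒱))
    (hs : s ≤ w.length) :
    cycTotal (fun u => sgn (wdeg (u.take s) * wdeg (u.drop s)) * f (u.drop s ++ u.take s)) w =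
      cycTotal f w := by
  have key : ∀ f : List (Letter 𝒱) → K, cycSum
      (fun u => sgn (wdeg (u.take s) * wdeg (u.drop s)) * f (u.drop s ++ u.take s)) w =
      cycSum f w := by
    intro f
    obtain ⟨m, hm⟩ := Nat.exists_eq_add_of_le hs
    set t : ℕ → K := fun r => sgn (wdeg (w.take r) * wdeg (w.drop r)) *
      f (w.drop r ++ w.take r) with ht
    have hR : cycSum f w = ∑ i ∈ Finset.range s, t i + ∑ r ∈ Finset.range m, t (s + r) := by
      rw [cycSum, hm, Finset.sum_range_add]
    rw [hR, cycSum, hm, Nat.add_comm s m, Finset.sum_range_add, add_comm]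
    -- Followed by a rotation by `s`, a rotation by `r < m` becomes one by `s + r`, and one by `m +
    -- i` wraps around to `i`.
    congr 1
    · refine Finset.sum_congr rfl fun i hi => ?_
      rw [Finset.mem_range] at hi
      have hw : w = w.take i ++ ((w.drop i).take (m + i - i) ++ w.drop (m + i)) := by
        rw [show w.drop (m + i) = (w.drop i).drop (m + i - i) by rw [List.drop_drop]; congr 1; omega,
          List.take_append_drop, List.take_append_drop]
      have lx : (w.take i).length = i := by simp; omega
      have ly : ((w.drop i).take (m + i - i)).length = m := by simp; omega
      have lz : (w.drop (m + i)).length = s - i := by simp; omega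
      simp only [ht]
      generalize w.take i = x at *
      generalize (w.drop i).take (m + i - i) = y at *
      generalize w.drop (m + i) = z at *
      have e1 : m + i = (x ++ y).length := by simp [lx, ly, add_comm]
      have e2 : s = (z ++ x).length := by simp [lx, lz]; omega
      have e4 : w.take (m + i) = x ++ y := by rw [hw, e1, ← List.append_assoc, List.take_left]
      have e5 : w.drop i = y ++ z := by rw [hw, ← lx, List.drop_left]
      rw [e4, e5, e2, ← List.append_assoc z x y, List.take_left, List.drop_left, ← mul_assoc,
        ← sgn_add]
      simp only [List.append_assoc, wdeg_append]
      congr 1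
      apply sgn_congr
      push_cast
      generalize (wdeg x : ZMod 2) = x, (wdeg y : ZMod 2) = y, (wdeg z : ZMod 2) = z
      revert x y z; decide
    · refine Finset.sum_congr rfl fun r hr => ?_
      rw [Finset.mem_range] at hr
      have hw : w = w.take r ++ ((w.drop r).take s ++ (w.drop r).drop s) := by simp
      have lx : (w.take r).length = r := by simp; omega
      have ly : ((w.drop r).take s).length = s := by simp; omega
      simp only [ht]
      generalize w.take r = x at *
      generalize (w.drop r).take s = y at *
      generalize (w.drop r).drop s = z at *
      have e1 : s + r = (x ++ y).length := by simp [lx, ly, add_comm]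
      have e3 : w.drop (s + r) = z := by rw [hw, e1, ← List.append_assoc, List.drop_left]
      have e4 : w.take (s + r) = x ++ y := by rw [hw, e1, ← List.append_assoc, List.take_left]
      have e5 : w.drop r = y ++ z := by rw [hw, ← lx, List.drop_left]
      rw [e3, e4, e5, ← ly, List.append_assoc y z x, List.take_left, List.drop_left, ← mul_assoc,
        ← sgn_add]
      simp only [List.append_assoc, wdeg_append]
      congr 1
      apply sgn_congr
      push_cast
      generalize (wdeg x : ZMod 2) = x, (wdeg y : ZMod 2) = y, (wdeg z : ZMod 2) = z
      revert x y z; decide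
  cases w with
  | nil =>
    obtain rfl : s = 0 := by simpa using hs
    simp [cycTotal]
  | cons a w => exact key f

theorem cycTotal_congr {f g : List (Letter 𝒱) → K} {w : List (Letter 𝒱)}
    (h : ∀ u, u.length = w.length → f u = g u) : cycTotal f w = cycTotal g w := by
  cases w with
  | nil => exact h [] rfl
  | cons a w =>
    simp only [cycTotal, cycSum]
    refine Finset.sum_congr rfl fun r _ => ?_
    rw [h]
    rw [List.length_append, add_comm, ← List.length_append, List.take_append_drop]

theorem cycTotal_sum {ι : Type*} (s : Finset ι) (f : ι → List (Letter 𝒱) → K) :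
    cycTotal (fun w => ∑ i ∈ s, f i w) = ∑ i ∈ s, cycTotal (f i) := by
  ext w
  rw [Finset.sum_apply]
  cases w with
  | nil => rfl
  | cons a w =>
    simp only [cycTotal, cycSum, Finset.mul_sum]
    rw [Finset.sum_comm]

theorem cycTotal_tensorFun_of_length_ne {l : List (ℤ × Module.Dual K V)} {w : List (Letter 𝒱)}
    (h : w.length ≠ l.length) : cycTotal (tensorFun l) w = 0 := by
  rw [cycTotal_congr (g := fun _ => 0)]
  · cases w <;> simp [cycTotal, cycSum]
  · intro u hu
    by_contra hne
    exact h (hu ▸ tensorFun_length hne)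

theorem IsCyclicTensor.onWords_eq {k : ℕ} {g : Fin k → ℤ} {β : Fin k → Module.Dual K V}
    {Λ : cyclicForms 𝒱} (h : IsCyclicTensor g β Λ) :
    onWords 𝒱 Λ.1 = cycTotal (tensorFun (List.ofFn fun i => (g i, β i))) := by
  ext w
  generalize hn : w.length = n
  obtain ⟨d, x, hx, rfl⟩ := exists_word w hn
  rw [onWords_word]
  by_cases hnk : n = k
  · subst hnk
    rw [h.2 d x hx]
    obtain _ | n := n
    · rw [sum_cyclicPerms_zero, tensorValue_eq_tensorFun g β (hx.comp _)]
      simp [koszulSign, word, cycTotal]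
    · rw [sum_cyclicPerms_eq_cycSum n.succ_pos hx (tensorValue g β) _
        fun d' x' h' => tensorValue_eq_tensorFun g β h']
      have : word hx = (word hx).head (by simp [← List.length_pos_iff]) :: (word hx).tail := by simp
      rw [this, cycTotal]
  · rw [h.1 n hnk, cycTotal_tensorFun_of_length_ne]
    · rfl
    · simpa using hnk

theorem cycTotal_append_singleton (f : List (Letter 𝒱) → K) (u : List (Letter 𝒱)) (a : Letter 𝒱) :
    cycTotal f (u ++ [a]) = ∑ j : Fin (u.length + 1),
      sgn (wdeg (u.take (u.length - j)) * (wdeg (u.drop (u.length - j)) + a.1)) *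
        f (u.drop (u.length - j) ++ a :: u.take (u.length - j)) := by
  have h0 : cycTotal f (u ++ [a]) = cycSum f (u ++ [a]) := by cases u <;> rfl
  rw [h0, cycSum, List.length_append, List.length_singleton, ← Finset.sum_range_reflect,
    ← Fin.sum_univ_eq_sum_range (fun j => sgn (wdeg ((u ++ [a]).take (u.length + 1 - 1 - j)) *
      wdeg ((u ++ [a]).drop (u.length + 1 - 1 - j))) * f ((u ++ [a]).drop (u.length + 1 - 1 - j) ++
        (u ++ [a]).take (u.length + 1 - 1 - j)))]
  refine Finset.sum_congr rfl fun j _ => ?_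
  rw [Nat.add_sub_cancel, List.take_append_of_le_length (by omega),
    List.drop_append_of_le_length (by omega), wdeg_append, List.append_assoc]
  simp

/-- The contribution of one factor to the value of a cyclic tensor. -/
theorem tensorFun_rotation {l : List (ℤ × Module.Dual K V)}
    (hl : ∀ p ∈ l, IsHomCovector 𝒱 p.1 p.2) {j : ℕ} (hj : j < l.length) {x : List (Letter 𝒱)}
    (y : List (Letter 𝒱)) (a : Letter 𝒱) (hx : x.length = j) :
    sgn (wdeg y * (wdeg x + a.1)) * tensorFun l (x ++ a :: y) =
      sgn (l[j].1 * cdeg (l.take j)) * l[j].2 a.2 *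
        (sgn (wdeg y * wdeg x) * tensorFun (l.eraseIdx j) (x ++ y)) := by
  have hsplit : l = l.take j ++ l[j] :: l.drop (j + 1) := by simp
  have hx' : x.length = (l.take j).length := by simp; omega
  have h1 : tensorFun l (x ++ a :: y) = sgn (l[j].1 * wdeg x + cdeg (l.drop (j + 1)) * a.1) *
      (l[j].2 a.2 * tensorFun (l.eraseIdx j) (x ++ y)) := by
    rw [List.eraseIdx_eq_take_drop_succ, ← tensorFun_middle _ _ _ _ _ hx', ← hsplit]
  rw [h1]
  have h2 : ∀ A B C E : K, A * B * (C * E) = A * C * (B * E) := fun A B C E => by ring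
  rw [h2, ← mul_assoc, ← sgn_add, ← sgn_add]
  apply sgn_mul_congr
  intro hne
  have h3 := right_ne_zero_of_mul hne
  rw [List.eraseIdx_eq_take_drop_succ] at h3
  obtain ⟨hX, h4⟩ := tensorFun_degree (fun p hp => hl p (List.mem_of_mem_take hp)) hx' h3
  -- Padding with an empty tail lets the same degree lemma read off the parity of the remaining
  -- block.
  rw [← List.append_nil (l.drop (j + 1)), ← List.append_nil y] at h4
  obtain ⟨hY, -⟩ := tensorFun_degree (fun p hp => hl p (List.mem_of_mem_drop hp))
    (by simpa using tensorFun_length h4) h4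
  have hA := (hl _ (List.getElem_mem hj)).zmod (left_ne_zero_of_mul hne)
  push_cast
  rw [hX, hY, hA]
  generalize (cdeg (l.take j) : ZMod 2) = x, (cdeg (l.drop (j + 1)) : ZMod 2) = y,
    (l[j].1 : ZMod 2) = z
  revert x y z; decide

/-- In each rotation of `u e'ᵢ` the letter `e'ᵢ` meets exactly one factor `βⱼ`; what remains is a
rotation of `u` evaluated on the tensor without `βⱼ`, and `cycTotal_signedRotation` removes that
rotation. -/
theorem wordBracket_cycTotal_tensorFun (D : DualBases 𝒱 b) {f : List (Letter 𝒱) → K}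
    (hf : ∀ u, u.length ≠ 1 → f u = 0) {k : ℕ} {l : List (ℤ × Module.Dual K V)}
    (hk : l.length = k + 1) (hl : ∀ p ∈ l, IsHomCovector 𝒱 p.1 p.2) :
    wordBracket D f (cycTotal (tensorFun l)) = ∑ j : Fin (k + 1),
      (sgn (l[j.1].1 * cdeg (l.take j)) * ∑ i, sgn (D.c i) * (f [D.letter i] * l[j.1].2 (D.e' i))) •
        cycTotal (tensorFun (l.eraseIdx j)) := by
  ext w
  rw [Finset.sum_apply]
  simp only [Pi.smul_apply, smul_eq_mul]
  by_cases hw : w.length = k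
  · have h1 : ∀ u : List (Letter 𝒱), u.length = w.length → ∑ m ∈ Finset.range (u.length + 1),
        wordContraction D f (cycTotal (tensorFun l)) (u.take m) (u.drop m) =
        ∑ j : Fin (k + 1), (sgn (l[j.1].1 * cdeg (l.take j)) *
          ∑ i, sgn (D.c i) * (f [D.letter i] * l[j.1].2 (D.e' i))) *
            (sgn (wdeg (u.take (k - j)) * wdeg (u.drop (k - j))) *
              tensorFun (l.eraseIdx j) (u.drop (k - j) ++ u.take (k - j))) := by
      intro u hu
      rw [Finset.sum_range_succ', Finset.sum_eq_zero, zero_add]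
      · simp only [wordContraction, List.take_zero, List.drop_zero, wdeg_nil, zero_mul, add_zero,
          List.nil_append, cycTotal_append_singleton, Finset.mul_sum, Finset.sum_mul]
        rw [Finset.sum_comm]
        rw [hw] at hu
        subst hu
        refine Finset.sum_congr rfl fun j _ => Finset.sum_congr rfl fun i _ => ?_
        rw [tensorFun_rotation hl (by omega) _ _ (by simp; omega : _ = j.1)]
        simp only [DualBases.letter'_snd]
        ring
      -- A cut after at least one letter feeds the linear form `f` a word of length at least two.
      · intro m hm
        rw [Finset.mem_range] at hm
        refine Finset.sum_eq_zero fun i _ => ?_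
        rw [hf, zero_mul, mul_zero]
        rw [List.length_append, List.length_take, List.length_singleton]
        omega
    rw [wordBracket_eq_cycTotal, cycTotal_congr h1, cycTotal_sum, Finset.sum_apply]
    refine Finset.sum_congr rfl fun j _ => ?_
    rw [cycTotal_mul, Pi.smul_apply, smul_eq_mul, cycTotal_signedRotation _ _ _ (by omega)]
  · have h1 : wordBracket D f (cycTotal (tensorFun l)) w = 0 := by
      by_contra hne
      obtain ⟨x, y, i, hlen, -, hx, hy⟩ := exists_of_wordBracket_ne_zero D hne
      have hx' : x.length = 0 := by
        by_contra h
        exact hx (hf _ (by simpa using h))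
      have hy' : y.length = k := by
        by_contra h
        exact hy (cycTotal_tensorFun_of_length_ne (by simp [hk, h]))
      omega
    rw [h1]
    refine (Finset.sum_eq_zero fun j _ => ?_).symm
    rw [cycTotal_tensorFun_of_length_ne, mul_zero]
    rw [List.length_eraseIdx_of_lt (by omega)]
    omega

end CyclicTensors

/-! ## The bracket of a metric is a Pinczon bracket -/

section PinczonBracket

variable {K V : Type*} [Field K] [AddCommGroup V] [Module K V] {𝒱 : ℤ → Submodule K V}
  {b : V →ₗ[K] V →ₗ[K] K}

theorem HasArity.length_eq {n : ℕ} {Ω : cyclicForms 𝒱} (h : HasArity n Ω) {w : List (Letter 𝒱)}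
    (hw : onWords 𝒱 Ω.1 w ≠ 0) : w.length = n := by
  by_contra hne
  generalize hm : w.length = m at hne
  obtain ⟨d, x, hx, rfl⟩ := exists_word w hm
  rw [onWords_word, h m hne] at hw
  exact hw rfl

theorem hasArity_of_length [FiniteDimensional K V] (h𝒱 : DirectSum.IsInternal 𝒱) {n : ℕ}
    {Ω : cyclicForms 𝒱} (h : ∀ w, onWords 𝒱 Ω.1 w ≠ 0 → w.length = n) : HasArity n Ω := by
  obtain ⟨e, c, mem⟩ := exists_homogeneous_basis h𝒱
  intro m hm
  refine Module.Basis.ext_multilinear (fun _ => e) fun w => ?_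
  have hw : IsHomTuple 𝒱 (fun i => c (w i)) (fun i => e (w i)) := fun i => mem (w i)
  by_contra hne
  rw [← onWords_word Ω.1 hw] at hne
  exact hm (by simpa using h _ hne)

theorem onWords_sum {ι : Type*} (s : Finset ι) (Ω : ι → cyclicForms 𝒱) :
    onWords 𝒱 (∑ i ∈ s, Ω i).1 = ∑ i ∈ s, onWords 𝒱 (Ω i).1 := by
  classical
  induction s using Finset.induction_on with
  | empty => rfl
  | insert a s ha ih => rw [Finset.sum_insert ha, Finset.sum_insert ha, ← ih]; rfl

theorem negOnePow_smul_cyclicForm (n : ℤ) (Ω : cyclicForms 𝒱) :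
    n.negOnePow • Ω = (sgn n : K) • Ω := by
  refine Subtype.ext (funext fun m => MultilinearMap.ext fun x => ?_)
  exact negOnePow_smul_eq_sgn_mul n (Ω.1 m x)

/-- A linear form as a cyclic form. -/
noncomputable def linearForm (𝒱 : ℤ → Submodule K V) (φ : Module.Dual K V) : cyclicForms 𝒱 :=
  ⟨fun n => match n with
    | 1 => MultilinearMap.ofSubsingleton K V K (0 : Fin 1) φ
    | _ => 0, by
    intro n d x _
    match n with
    | 0 => simp
    | 1 =>
      have h : koszulSign (finRotate 1) d = 1 := Finset.prod_eq_one fun p hp =>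
        absurd (Subsingleton.elim _ _) (Finset.mem_filter.1 hp).2.1.ne
      rw [h, one_smul]
      simp
    | n + 2 => simp⟩

@[simp] theorem onWords_linearForm_singleton (φ : Module.Dual K V) (a : Letter 𝒱) :
    onWords 𝒱 (linearForm 𝒱 φ).1 [a] = φ a.2 := rfl

variable {br : cyclicForms 𝒱 →ₗ[K] cyclicForms 𝒱 →ₗ[K] cyclicForms 𝒱}

theorem IsPinczonUshirobira.apply_linearForm (h : IsPinczonUshirobira 𝒱 b br) (D : DualBases 𝒱 b)
    (α : cyclicForms 𝒱) (φ : Module.Dual K V) :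
    onWords 𝒱 (br α (linearForm 𝒱 φ)).1 [] =
      ∑ i, sgn (D.c i) * (onWords 𝒱 α.1 [D.letter i] * φ (D.e' i)) := by
  rw [h.onWords_eq D, wordBracket, wordContraction]
  simp

theorem IsPinczonUshirobira.linear_nondegenerate [FiniteDimensional K V]
    (h𝒱 : DirectSum.IsInternal 𝒱) (h : IsPinczonUshirobira 𝒱 b br) (D : DualBases 𝒱 b)
    {α : cyclicForms 𝒱} (hα : HasArity 1 α) (hz : ∀ Ω, br α Ω = 0) : α = 0 := by
  have h0 : ∀ i, onWords 𝒱 α.1 [D.letter i] = 0 := by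
    intro i
    -- Against the test form `b(eᵢ, ·)` only the term `±α(eᵢ)` survives.
    have h1 := h.apply_linearForm D α (b (D.e i))
    rw [hz] at h1
    simp only [D.dual, mul_ite, mul_one, mul_zero, Finset.sum_ite_eq, Finset.mem_univ, if_true] at h1
    exact (mul_eq_zero.1 h1.symm).resolve_left (sgn_ne_zero _)
  have h1 : slot α.1 [] [] = 0 := D.e.ext fun i => h0 i
  refine cyclicForms_ext h𝒱 ?_
  ext w
  by_contra hne
  obtain ⟨a, rfl⟩ := List.length_eq_one_iff.1 (hα.length_eq hne)
  exact hne (LinearMap.congr_fun h1 a.2)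

/-- The metric is determined by its bracket. -/
theorem IsPinczonUshirobira.metric_unique [FiniteDimensional K V] (h𝒱 : DirectSum.IsInternal 𝒱)
    {b' : V →ₗ[K] V →ₗ[K] K} (hb : IsMetric 𝒱 b) (hb' : IsMetric 𝒱 b')
    (h : IsPinczonUshirobira 𝒱 b br) (h' : IsPinczonUshirobira 𝒱 b' br) : b = b' := by
  obtain ⟨D⟩ := hb.nonempty_dualBases h𝒱
  obtain ⟨e', dual⟩ := hb'.exists_dual_family D.e
  let D' := hb'.dualBases D.e D.c e' D.mem dual
  -- Bracketing the coordinate form of `e k` with all linear forms recovers the dual vector `e' k`,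
  -- without reference to the metric.
  have key : ∀ (E : V →ₗ[K] V →ₗ[K] K) (DE : DualBases 𝒱 E), DE.e = D.e → DE.c = D.c →
      IsPinczonUshirobira 𝒱 E br → ∀ (k : _) (φ : Module.Dual K V),
      onWords 𝒱 (br (linearForm 𝒱 (D.e.coord k)) (linearForm 𝒱 φ)).1 [] =
        sgn (D.c k) * φ (DE.e' k) := by
    intro E DE he hc hE k φ
    rw [hE.apply_linearForm DE]
    simp only [onWords_linearForm_singleton, DualBases.letter_snd, he, hc]
    rw [Finset.sum_eq_single k]
    · simp
    · intro i _ hi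
      simp [hi]
    · simp
  have he' : ∀ k, D.e' k = e' k := by
    intro k
    rw [← sub_eq_zero, ← Module.forall_dual_apply_eq_zero_iff K]
    intro φ
    have h1 := (key b D rfl rfl h k φ).symm.trans (key b' D' rfl rfl h' k φ)
    rw [map_sub, sub_eq_zero]
    exact mul_left_cancel₀ (sgn_ne_zero _) h1
  refine D.e.ext fun i => LinearMap.ext fun y => ?_
  conv_rhs => rw [D.expand hb y]
  simp [he', dual]

theorem eraseIdx_ofFn {α : Type*} {k : ℕ} (f : Fin (k + 1) → α) (j : Fin (k + 1)) :
    (List.ofFn f).eraseIdx j = List.ofFn fun i => f (j.succAbove i) := by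
  refine List.ext_getElem (by rw [List.length_eraseIdx_of_lt (by simp; omega)]; simp) fun i hi hi' => ?_
  rw [List.getElem_eraseIdx]
  simp only [List.getElem_ofFn, Fin.succAbove, Fin.lt_def, Fin.val_castSucc]
  split_ifs <;> rfl

theorem cdeg_take_ofFn {k : ℕ} (g : Fin k → ℤ) (β : Fin k → Module.Dual K V) (j : ℕ) :
    cdeg ((List.ofFn fun i => (g i, β i)).take j) =
      ∑ i ∈ Finset.univ.filter (fun i : Fin k => i.val < j), g i := by
  rw [cdeg, List.map_take, List.map_ofFn, ← List.sum_take_ofFn]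
  rfl

variable [FiniteDimensional K V]

theorem IsPinczonUshirobira.derivation (h𝒱 : DirectSum.IsInternal 𝒱)
    (h : IsPinczonUshirobira 𝒱 b br) (D : DualBases 𝒱 b) (α : cyclicForms 𝒱) (k : ℕ)
    (g : Fin (k + 1) → ℤ) (β : Fin (k + 1) → Module.Dual K V) (Λ : cyclicForms 𝒱)
    (β' Λ' : Fin (k + 1) → cyclicForms 𝒱) (hα : HasArity 1 α)
    (hβ : ∀ j, IsHomCovector 𝒱 (g j) (β j)) (hΛ : IsCyclicTensor g β Λ)
    (hβ' : ∀ j, IsCyclicTensor (k := 1) (fun _ => g j) (fun _ => β j) (β' j))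
    (hΛ' : ∀ j, IsCyclicTensor (fun i => g (j.succAbove i)) (fun i => β (j.succAbove i)) (Λ' j)) :
    br α Λ = ∑ j, (g j * ∑ i ∈ Finset.univ.filter (fun i => i < j), g i).negOnePow •
      ((br α (β' j)).1 0 Fin.elim0 • Λ' j) := by
  refine cyclicForms_ext h𝒱 ?_
  rw [h.onWords_eq D, hΛ.onWords_eq, wordBracket_cycTotal_tensorFun D (k := k), onWords_sum]
  · refine Finset.sum_congr rfl fun j _ => ?_
    have h1 : (br α (β' j)).1 0 Fin.elim0 =
        ∑ i, sgn (D.c i) * (onWords 𝒱 α.1 [D.letter i] * β j (D.e' i)) := by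
      rw [← onWords_nil (𝒱 := 𝒱), h.onWords_eq D, (hβ' j).onWords_eq, wordBracket, wordContraction]
      simp [cycTotal, cycSum, tensorFun]
    rw [h1, negOnePow_smul_cyclicForm, smul_smul, eraseIdx_ofFn, ← (hΛ' j).onWords_eq,
      cdeg_take_ofFn]
    simp only [List.getElem_ofFn]
    rfl
  · intro u hu
    by_contra hne
    exact hu (hα.length_eq hne)
  · simp
  · intro p hp
    obtain ⟨i, rfl⟩ := (List.mem_ofFn' _ _).1 hp
    exact hβ i

theorem isPinczonBracket_metricBracket (h𝒱 : DirectSum.IsInternal 𝒱) (hb : IsMetric 𝒱 b)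
    (D : DualBases 𝒱 b) : IsPinczonBracket 𝒱 (metricBracket D h𝒱) where
  arity k l Ω Ω' h h' := by
    refine hasArity_of_length h𝒱 fun w hw => ?_
    rw [onWords_metricBracket] at hw
    obtain ⟨x, y, i, hlen, -, hx, hy⟩ := exists_of_wordBracket_ne_zero D hw
    have h1 := h.length_eq hx
    have h2 := h'.length_eq hy
    simp only [List.length_append, List.length_singleton] at h1 h2
    omega
  degree p q Ω Ω' hp hq := by
    rw [hasFormDegree_iff] at *
    rw [onWords_metricBracket]
    exact hp.wordBracket D hq
  skew p q Ω Ω' hp hq := by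
    rw [hasFormDegree_iff] at hp hq
    rw [negOnePow_smul_cyclicForm]
    refine cyclicForms_ext h𝒱 ?_
    rw [onWords_metricBracket, wordBracket_skew D h𝒱 hb (cyclicForms_cyclicFun Ω)
      (cyclicForms_cyclicFun Ω') hp hq, ← onWords_metricBracket D h𝒱]
    rfl
  jacobi p q r Ω Ω' Ω'' hp hq hr := by
    rw [hasFormDegree_iff] at hp hq hr
    rw [negOnePow_smul_cyclicForm, negOnePow_smul_cyclicForm]
    refine cyclicForms_ext h𝒱 ?_
    have h := wordBracket_jacobi D h𝒱 hb (cyclicForms_cyclicFun Ω) (cyclicForms_cyclicFun Ω')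
      (cyclicForms_cyclicFun Ω'') hp hq hr (onWords_metricBracket D h𝒱 Ω Ω')
      (onWords_metricBracket D h𝒱 Ω' Ω'') (onWords_metricBracket D h𝒱 Ω'' Ω)
    rw [← onWords_metricBracket D h𝒱, ← onWords_metricBracket D h𝒱,
      ← onWords_metricBracket D h𝒱] at h
    exact h
  derivation := (isPinczonUshirobira_metricBracket D h𝒱 hb).derivation h𝒱 D
  scalars_central Ω Ω' h := by
    refine cyclicForms_ext h𝒱 ?_
    rw [onWords_metricBracket]
    ext w
    by_contra hne
    obtain ⟨x, y, i, -, -, hx, -⟩ := exists_of_wordBracket_ne_zero D hne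
    have h1 := h.length_eq hx
    simp at h1
  linear_nondegenerate α hα :=
    (isPinczonUshirobira_metricBracket D h𝒱 hb).linear_nondegenerate h𝒱 D hα
  ushirobira := ⟨b, hb, isPinczonUshirobira_metricBracket D h𝒱 hb⟩

end PinczonBracket

/-! ## Quadratic `C∞` structures -/

section Quadratic

variable {K V : Type*} [Field K] [AddCommGroup V] [Module K V] {𝒱 : ℤ → Submodule K V}
  {b B : V →ₗ[K] V →ₗ[K] K}

theorem IsMetric.sgn_mul_apply (hb : IsMetric 𝒱 b) {i j : ℤ} {x y : V} (hx : x ∈ shiftOne 𝒱 i)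
    (hy : y ∈ shiftOne 𝒱 j) : sgn i * b x y = -b y x := by
  rw [hb.symm _ _ x y hx hy, negOnePow_smul_eq_sgn_mul, neg_eq_sgn_one_mul, ← mul_assoc, ← sgn_add]
  apply sgn_mul_congr
  intro hne
  have h := congrArg (Int.cast : ℤ → ZMod 2) (hb.shift_degree hy hx hne)
  push_cast at h ⊢
  revert h
  generalize (i : ZMod 2) = i, (j : ZMod 2) = j
  revert i j; decide

/-- Paired vectors have degrees of equal parity in `V[1]`, so `(-1)^{deg x} b(x, y) = -b(y, x)`.
This replaces a sign that depends on degrees by a plain bilinear expression. -/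
theorem IsMetric.isShiftedForm_iff [FiniteDimensional K V] (h𝒱 : DirectSum.IsInternal 𝒱)
    (hb : IsMetric 𝒱 b) : IsShiftedForm 𝒱 b B ↔ B = -b.flip := by
  obtain ⟨e, c, mem⟩ := exists_homogeneous_basis h𝒱
  have key : ∀ (i : ℤ) (x y : V), x ∈ shiftOne 𝒱 i → i.negOnePow • b x y = -b y x := by
    intro i x y hx
    rw [negOnePow_smul_eq_sgn_mul]
    have : (sgn i : K) • b x = -b.flip x := e.ext fun j => hb.sgn_mul_apply hx (mem j)
    exact LinearMap.congr_fun this y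
  constructor
  · intro h
    refine e.ext fun i => LinearMap.ext fun y => ?_
    rw [h _ _ y (mem i), key _ _ y (mem i)]
    rfl
  · rintro rfl i x y hx
    rw [key i x y hx]
    rfl

theorem IsMetric.isSymplectic [FiniteDimensional K V] (hb : IsMetric 𝒱 b) :
    IsSymplectic 𝒱 (-b.flip) where
  degree_two i j x y hx hy h := by
    have h' : b y x ≠ 0 := fun h0 => h (by simp [h0])
    have := hb.shift_degree hy hx h'
    omega
  antisymm i j x y hx hy := by
    have h1 : sgn j * b y x = -b x y := hb.sgn_mul_apply hy hx
    simp only [LinearMap.neg_apply, LinearMap.flip_apply, negOnePow_smul_eq_sgn_mul, ← h1]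
    rw [neg_eq_sgn_one_mul, neg_eq_sgn_one_mul, ← mul_assoc, ← mul_assoc, ← sgn_add, ← sgn_add]
    apply sgn_mul_congr
    intro hne
    have h := congrArg (Int.cast : ℤ → ZMod 2) (hb.shift_degree hy hx hne)
    push_cast at h ⊢
    revert h
    generalize (i : ZMod 2) = i, (j : ZMod 2) = j
    revert i j; decide
  nondegenerate x h := hb.right_nondegenerate fun y => by simpa using h y

theorem IsMetric.bijective_flip [FiniteDimensional K V] (hb : IsMetric 𝒱 b) :
    Function.Bijective (-b.flip) := by
  have hinj : Function.Injective (-b.flip) := by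
    rw [← LinearMap.ker_eq_bot, LinearMap.ker_eq_bot']
    intro x hx
    exact hb.isSymplectic.nondegenerate x fun y => by rw [hx]; rfl
  exact ⟨hinj, (LinearMap.injective_iff_surjective_of_finrank_eq_finrank
    (Subspace.dual_finrank_eq).symm).1 hinj⟩

theorem quadraticForm_snoc (B : V →ₗ[K] V →ₗ[K] K) (Q : ∀ n, Op K V n) {n : ℕ} (x : Fin n → V)
    (y : V) : quadraticForm B Q (n + 1) (Fin.snoc (α := fun _ => V) x y) = B (Q n x) y := by
  simp [quadraticForm]

theorem evalList_quadraticForm (B : V →ₗ[K] V →ₗ[K] K) (Q : ∀ n, Op K V n) (l : List V) (v : V) :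
    evalList (quadraticForm B Q) (l ++ [v]) = B (evalList Q l) v := by
  have h : l ++ [v] = List.ofFn (Fin.snoc (α := fun _ => V) l.get v) := by
    rw [List.ofFn_succ_last]
    simp
  rw [h, evalList_ofFn, quadraticForm_snoc]
  rfl

theorem compValue_eq (q : ℤ) (Q Q' : ∀ n, Op K V n) {n : ℕ} {d : Fin n → ℤ} {x : Fin n → V}
    (h : IsHomTuple 𝒱 d x) : compValue q Q Q' d x =
      ∑ r ∈ Finset.range (n + 1), ∑ j ∈ Finset.range (n - r + 1),
        (sgn (q * wdeg ((word h).take r)) : K) • evalList Q (vecs ((word h).take r) ++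
          evalList Q' (vecs (((word h).drop r).take j)) :: vecs (((word h).drop r).drop j)) := by
  set T : ℕ → ℕ → V := fun r j => (sgn (q * wdeg ((word h).take r)) : K) •
    evalList Q (vecs ((word h).take r) ++
      evalList Q' (vecs (((word h).drop r).take j)) :: vecs (((word h).drop r).drop j)) with hT
  have h1 : compValue q Q Q' d x =
      ∑ j ∈ Finset.range (n + 1), ∑ r ∈ Finset.range (n - j + 1), T r j := by
    rw [compValue, ← Fin.sum_univ_eq_sum_range (fun j => ∑ r ∈ Finset.range (n - j + 1), T r j)]
    refine Finset.sum_congr rfl fun j _ => ?_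
    rw [← Fin.sum_univ_eq_sum_range (fun r => T r j)]
    refine Finset.sum_congr rfl fun r _ => ?_
    have hj := j.2
    have hr := r.2
    simp only [hT]
    rw [negOnePow_smul_eq_sgn_smul (K := K), sum_take_word, ← evalList_ofFn Q]
    congr 2
    have hw : vecs (word h) = List.ofFn x := vecs_word h
    have ht : vecs ((word h).take r) = (List.ofFn x).take r := by rw [← hw, vecs, vecs, List.map_take]
    have hd : vecs (((word h).drop r).drop j) = ((List.ofFn x).drop r).drop j := by
      rw [← hw, vecs, vecs, List.map_drop, List.map_drop]
    have hm : vecs (((word h).drop r).take j) = ((List.ofFn x).drop r).take j := by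
      rw [← hw, vecs, vecs, List.map_take, List.map_drop]
    have hm' : evalList Q' (((List.ofFn x).drop r).take j) =
        Q' j.val (fun a => x ⟨r.val + a.val, by omega⟩) := by
      rw [← evalList_ofFn]
      congr 1
      refine List.ext_getElem (by simp; omega) fun i hi hi' => ?_
      simp
    rw [ht, hd, hm, hm']
    refine List.ext_getElem (by simp; omega) fun i hi hi' => ?_
    simp only [List.getElem_ofFn, List.getElem_append, List.getElem_cons, List.length_take,
      List.length_ofFn, List.getElem_take, List.getElem_drop]
    have hmin : min r.val n = r.val := by omega
    simp only [hmin]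
    split_ifs with h1 h2 h3
    · rfl
    · rfl
    · omega
    · omega
    · congr 2
      omega
  rw [h1]
  -- Both orders of summation run over `r + j ≤ n`; having `r` outside matches `insertion`.
  refine Finset.sum_comm' fun j r => ?_
  simp only [Finset.mem_range]
  omega

/-- Expanding in the dual family gives `Q(y) = -∑ᵢ Ω(y eᵢ) e'ᵢ`. Substituting this into `Ω(x · z a)`
produces the insertion of `Ω`, with the same sign. -/
theorem IsMetric.apply_compValue [FiniteDimensional K V] (hb : IsMetric 𝒱 b) (D : DualBases 𝒱 b)
    (q : ℤ) (Q : ∀ n, Op K V n) {n : ℕ} {d : Fin n → ℤ} {x : Fin n → V} (h : IsHomTuple 𝒱 d x)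
    (a : Letter 𝒱) : (-b.flip) (compValue q Q Q d x) a.2 =
      -insertion q D.letter' (leg D (onWords 𝒱 (quadraticForm (-b.flip) Q)))
        (rightDer a (onWords 𝒱 (quadraticForm (-b.flip) Q))) (word h) := by
  have hQ : ∀ y : List (Letter 𝒱), evalList Q (vecs y) =
      -∑ i, onWords 𝒱 (quadraticForm (-b.flip) Q) (y ++ [D.letter i]) • D.e' i := by
    intro y
    rw [D.expand hb (evalList Q (vecs y)), ← Finset.sum_neg_distrib]
    refine Finset.sum_congr rfl fun i _ => ?_
    rw [onWords, vecs_append, vecs_cons, vecs_nil, evalList_quadraticForm]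
    simp
  rw [compValue_eq q Q Q h, insertion_apply, length_word, map_sum, LinearMap.sum_apply,
    ← Finset.sum_neg_distrib]
  refine Finset.sum_congr rfl fun r _ => ?_
  rw [map_sum, LinearMap.sum_apply, ← Finset.sum_neg_distrib]
  refine Finset.sum_congr rfl fun j _ => ?_
  generalize (word h).take r = x
  generalize ((word h).drop r).take j = y
  generalize ((word h).drop r).drop j = z
  rw [map_smul, LinearMap.smul_apply, ← evalList_quadraticForm, List.append_assoc, List.cons_append,
    ← slot_apply, hQ, map_neg, map_sum, smul_eq_mul, mul_neg]
  simp [leg, rightDer, onWords]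

/-- As `Q` is odd, `[Q, Q] = 2 Q ∘ Q`; as `Ω` has odd degree, the two insertions in `{Ω, Ω}` add up.
Both sides equal `-2` times the insertion of `Ω` into itself; the degrees `3` and `1` give the same
signs. -/
theorem IsMetric.apply_coderBracketValue [FiniteDimensional K V] (h𝒱 : DirectSum.IsInternal 𝒱)
    (hb : IsMetric 𝒱 b) (D : DualBases 𝒱 b) (Q : ∀ n, Op K V n)
    (hcyc : CyclicFun (onWords 𝒱 (quadraticForm (-b.flip) Q)))
    (hdeg : HomFun 3 (onWords 𝒱 (quadraticForm (-b.flip) Q)))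
    {n : ℕ} {d : Fin n → ℤ} {x : Fin n → V} (h : IsHomTuple 𝒱 d x) (a : Letter 𝒱) :
    (-b.flip) (coderBracketValue 1 1 Q Q d x) a.2 =
      wordBracket D (onWords 𝒱 (quadraticForm (-b.flip) Q))
        (onWords 𝒱 (quadraticForm (-b.flip) Q)) (word h ++ [a]) := by
  have h1 := congrFun (rightDer_wordBracket D h𝒱 hb hcyc hcyc hdeg hdeg a) (word h)
  have h3 : (sgn (3 * 3) : K) = -1 := (sgn_congr (n := 1) (by decide)).trans sgn_one
  rw [rightDer, Pi.sub_apply, Pi.smul_apply, smul_eq_mul, h3,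
    insertion_congr (p := 3) (q := 1) (by decide)] at h1
  rw [h1, coderBracketValue, negOnePow_smul_eq_sgn_smul (K := K), map_sub, map_smul,
    LinearMap.sub_apply, LinearMap.smul_apply, hb.apply_compValue D 1 Q h a]
  simp

theorem eq_zero_of_letters [FiniteDimensional K V] (h𝒱 : DirectSum.IsInternal 𝒱)
    (hb : IsMetric 𝒱 b) {v : V} (h : ∀ a : Letter 𝒱, (-b.flip) v a.2 = 0) : v = 0 := by
  obtain ⟨e, c, mem⟩ := exists_homogeneous_basis h𝒱
  refine hb.eq_of_basis e fun i => ?_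
  simpa using h ⟨c i, e i, mem i⟩

theorem apply_units_smul (B : V →ₗ[K] V →ₗ[K] K) (u : ℤˣ) (v y : V) :
    B (u • v) y = u • B v y := by
  rw [Units.smul_def, Units.smul_def, map_zsmul, LinearMap.smul_apply]

/-- The multilinear maps that correspond to a family of forms. -/
theorem IsMetric.existsUnique_op [FiniteDimensional K V] (hb : IsMetric 𝒱 b) (F : ∀ n, Form K V n)
    (h0 : F 0 = 0) : ∃! Q : ∀ n, Op K V n, F = quadraticForm (-b.flip) Q := by
  let E := LinearEquiv.ofBijective (-b.flip) hb.bijective_flip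
  have hE : ∀ φ, (-b.flip) (E.symm φ) = φ := E.apply_symm_apply
  refine ⟨fun k => E.symm.toLinearMap.compMultilinearMap (F (k + 1)).curryRight, ?_, ?_⟩
  · funext n
    match n with
    | 0 => exact h0
    | k + 1 =>
      ext x
      obtain ⟨y, v, rfl⟩ : ∃ (y : Fin k → V) (v : V), x = Fin.snoc (α := fun _ => V) y v :=
        ⟨Fin.init x, x (Fin.last k), (Fin.snoc_init_self x).symm⟩
      rw [quadraticForm_snoc, LinearMap.compMultilinearMap_apply]
      exact (LinearMap.congr_fun (hE ((F (k + 1)).curryRight y)) v).symm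
  · intro Q' hQ'
    funext k
    ext x
    refine E.injective ?_
    rw [LinearMap.compMultilinearMap_apply]
    refine LinearMap.ext fun v => ?_
    refine Eq.trans ?_ (LinearMap.congr_fun (hE ((F (k + 1)).curryRight x)) v).symm
    rw [MultilinearMap.curryRight_apply, hQ', quadraticForm_snoc]
    rfl

/-- The multilinear maps of a commutative Pinczon algebra form a `C∞` structure. -/
theorem IsCommPinczonAlgebra.isCInfinity [FiniteDimensional K V] (h𝒱 : DirectSum.IsInternal 𝒱)
    {br : cyclicForms 𝒱 →ₗ[K] cyclicForms 𝒱 →ₗ[K] cyclicForms 𝒱} {Ω : cyclicForms 𝒱}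
    (h : IsCommPinczonAlgebra 𝒱 br Ω) (hb : IsMetric 𝒱 b) (hbr : IsPinczonUshirobira 𝒱 b br)
    {Q : ∀ n, Op K V n} (hQ : Ω.1 = quadraticForm (-b.flip) Q) : IsCInfinity 𝒱 Q := by
  obtain ⟨D⟩ := hb.nonempty_dualBases h𝒱
  have hΩ : ∀ (n : ℕ) (x : Fin n → V) (y : V),
      Ω.1 (n + 1) (Fin.snoc (α := fun _ => V) x y) = (-b.flip) (Q n x) y := by
    intro n x y
    rw [hQ, quadraticForm_snoc]
  have hnd : ∀ v : V, (∀ y, (-b.flip) v y = 0) → v = 0 := hb.isSymplectic.nondegenerate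
  refine ⟨?_, ?_, ?_, ?_⟩
  · ext x
    refine hnd _ fun y => ?_
    rw [← hΩ, h.no_linear]
    rfl
  · intro n d x hx
    -- A nonzero coefficient of `e'ᵢ` is a nonzero value of `Ω`, so degree `3` gives `∑ d + cᵢ + 3 =
    -- 0`, and the degree `-2 - cᵢ` of `e'ᵢ` equals `∑ d + 1`.
    rw [D.expand hb (Q n x)]
    refine Submodule.sum_mem _ fun i _ => ?_
    by_cases hi : b (D.e i) (Q n x) = 0
    · rw [hi, zero_smul]
      exact Submodule.zero_mem _
    · refine Submodule.smul_mem _ _ ?_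
      have hne : Ω.1 (n + 1) (Fin.snoc (α := fun _ => V) x (D.e i)) ≠ 0 := by
        rw [hΩ]
        simpa using hi
      have hdeg := h.degree_three (n + 1) (Fin.snoc (α := fun _ => ℤ) d (D.c i)) _ (fun j => by
        refine Fin.lastCases ?_ (fun j => ?_) j
        · simpa using D.mem i
        · simpa using hx j) hne
      rw [Fin.sum_univ_castSucc] at hdeg
      simp only [Fin.snoc_castSucc, Fin.snoc_last] at hdeg
      have : (∑ i, d i) + 1 = -2 - D.c i := by omega
      rw [this]
      exact D.mem' i
  · intro n p hp hpn d x hx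
    refine hnd _ fun y => ?_
    have := h.vsp n y p hp hpn d x hx
    simp only [hΩ] at this
    rw [← LinearMap.flip_apply, map_sum]
    simpa only [apply_units_smul, LinearMap.flip_apply] using this
  · intro n d x hx
    refine eq_zero_of_letters h𝒱 hb fun a => ?_
    have hcyc := cyclicForms_cyclicFun Ω
    have hdeg := hasFormDegree_iff.1 h.degree_three
    have h0 := hbr.onWords_eq D Ω Ω
    rw [hQ] at hcyc hdeg h0
    rw [hb.apply_coderBracketValue h𝒱 D Q hcyc hdeg hx a, ← h0, h.bracket_self]
    rfl

theorem IsCInfinity.hasFormDegree_three (hB : IsSymplectic 𝒱 B) {Q : ∀ n, Op K V n}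
    (hQ : IsCInfinity 𝒱 Q) (hq : IsQuadratic 𝒱 B Q) :
    HasFormDegree 3 (⟨quadraticForm B Q, hq⟩ : cyclicForms 𝒱) := by
  intro n d x hx hne
  match n with
  | 0 => exact absurd rfl hne
  | k + 1 =>
    have hx' : x = Fin.snoc (α := fun _ => V) (Fin.init x) (x (Fin.last k)) :=
      (Fin.snoc_init_self x).symm
    have hne' : B (Q k (Fin.init x)) (x (Fin.last k)) ≠ 0 := by
      rw [← quadraticForm_snoc, ← hx']
      exact hne
    have h1 := hQ.degree_one k (fun i => d i.castSucc) (Fin.init x) fun i => hx i.castSucc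
    have := hB.degree_two _ _ _ _ h1 (hx (Fin.last k)) hne'
    rw [Fin.sum_univ_castSucc]
    omega

/-- A quadratic `C∞` structure gives a commutative Pinczon algebra. -/
theorem IsCInfinity.isCommPinczonAlgebra [FiniteDimensional K V] (h𝒱 : DirectSum.IsInternal 𝒱)
    (hb : IsMetric 𝒱 b) (D : DualBases 𝒱 b) {Q : ∀ n, Op K V n}
    (hQ : IsCInfinity 𝒱 Q) (hq : IsQuadratic 𝒱 (-b.flip) Q) :
    IsCommPinczonAlgebra 𝒱 (metricBracket D h𝒱) ⟨quadraticForm (-b.flip) Q, hq⟩ where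
  bracket := isPinczonBracket_metricBracket h𝒱 hb D
  vsp k y p hp hpk d x hx := by
    have := congrArg ((-b.flip).flip y) (hQ.vsp k p hp hpk d x hx)
    rw [map_sum, map_zero] at this
    simpa only [apply_units_smul, LinearMap.flip_apply, quadraticForm_snoc] using this
  degree_three := hQ.hasFormDegree_three hb.isSymplectic hq
  no_linear := by
    ext x
    obtain ⟨y, v, rfl⟩ : ∃ (y : Fin 0 → V) (v : V), x = Fin.snoc (α := fun _ => V) y v :=
      ⟨Fin.init x, x (Fin.last 0), (Fin.snoc_init_self x).symm⟩
    rw [quadraticForm_snoc, hQ.zero]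
    simp
  bracket_self := by
    refine cyclicForms_ext h𝒱 ?_
    rw [onWords_metricBracket]
    have hcyc := cyclicForms_cyclicFun (⟨quadraticForm (-b.flip) Q, hq⟩ : cyclicForms 𝒱)
    have hdeg := hasFormDegree_iff.1 (hQ.hasFormDegree_three hb.isSymplectic hq)
    ext w
    rcases List.eq_nil_or_concat w with rfl | ⟨v, a, rfl⟩
    -- The scalar component of `{Ω, Ω}` pairs the linear component of `Ω` with itself, and that
    -- component is `B(Q₀, ·) = 0`.
    · rw [wordBracket, wordContraction]
      refine Finset.sum_eq_zero fun i _ => ?_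
      rw [onWords, vecs_append, vecs_cons, vecs_nil, evalList_quadraticForm, evalList]
      simp [hQ.zero]
    · rw [List.concat_eq_append]
      generalize hn : v.length = n
      obtain ⟨d, x, hx, rfl⟩ := exists_word v hn
      have h1 := hb.apply_coderBracketValue h𝒱 D Q hcyc hdeg hx a
      rw [hQ.bracket_self n d x hx] at h1
      rw [← h1]
      simp [onWords, evalList]

/-- A commutative Pinczon algebra is given by a unique symplectic form and a unique quadratic `C∞`
structure. -/
theorem IsCommPinczonAlgebra.quadratic_cInfinity [FiniteDimensional K V]
    (h𝒱 : DirectSum.IsInternal 𝒱)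
    {br : cyclicForms 𝒱 →ₗ[K] cyclicForms 𝒱 →ₗ[K] cyclicForms 𝒱} {Ω : cyclicForms 𝒱}
    (h : IsCommPinczonAlgebra 𝒱 br Ω) :
    (∃! B : V →ₗ[K] V →ₗ[K] K, IsSymplectic 𝒱 B ∧ IsFormOfBracket 𝒱 br B) ∧
      ∀ B : V →ₗ[K] V →ₗ[K] K, IsFormOfBracket 𝒱 br B →
        ∃ Q : ∀ n, Op K V n, IsCInfinity 𝒱 Q ∧ IsQuadratic 𝒱 B Q ∧
          (Ω : ∀ n, Form K V n) = quadraticForm B Q ∧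
          ∀ Q' : ∀ n, Op K V n, (Ω : ∀ n, Form K V n) = quadraticForm B Q' → Q' = Q := by
  refine ⟨?_, ?_⟩
  · obtain ⟨b, hb, hbr⟩ := h.bracket.ushirobira
    refine ⟨-b.flip, ⟨hb.isSymplectic, b, hb, hbr, (hb.isShiftedForm_iff h𝒱).2 rfl⟩, ?_⟩
    rintro B ⟨-, b', hb', hbr', hB⟩
    rw [(hb'.isShiftedForm_iff h𝒱).1 hB, hbr.metric_unique h𝒱 hb hb' hbr']
  · rintro B ⟨b, hb, hbr, hB⟩
    obtain rfl := (hb.isShiftedForm_iff h𝒱).1 hB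
    -- A scalar has degree `0`, not `3`; this is needed because `quadraticForm` is zero in arity
    -- `0`.
    have h0 : Ω.1 0 = 0 := by
      ext x
      by_contra hne
      have := h.degree_three 0 Fin.elim0 x (fun i => i.elim0) hne
      simp at this
    obtain ⟨Q, hQ, huniq⟩ := hb.existsUnique_op Ω.1 h0
    have hq : quadraticForm (-b.flip) Q ∈ cyclicForms 𝒱 := hQ ▸ Ω.2
    exact ⟨Q, h.isCInfinity h𝒱 hb hbr hQ, hq, hQ, huniq⟩

/-- A quadratic `C∞` structure comes from a unique commutative Pinczon algebra. -/
theorem IsCInfinity.existsUnique_pinczon [FiniteDimensional K V] (h𝒱 : DirectSum.IsInternal 𝒱)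
    (hb : IsMetric 𝒱 b) (hB : IsShiftedForm 𝒱 b B) {Q : ∀ n, Op K V n} (hQ : IsCInfinity 𝒱 Q)
    (hq : IsQuadratic 𝒱 B Q) :
    ∃! P : (cyclicForms 𝒱 →ₗ[K] cyclicForms 𝒱 →ₗ[K] cyclicForms 𝒱) × cyclicForms 𝒱,
      IsCommPinczonAlgebra 𝒱 P.1 P.2 ∧ IsFormOfBracket 𝒱 P.1 B ∧
        (P.2 : ∀ n, Form K V n) = quadraticForm B Q := by
  obtain rfl := (hb.isShiftedForm_iff h𝒱).1 hB
  obtain ⟨D⟩ := hb.nonempty_dualBases h𝒱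
  refine ⟨(metricBracket D h𝒱, ⟨quadraticForm (-b.flip) Q, hq⟩),
    ⟨hQ.isCommPinczonAlgebra h𝒱 hb D hq,
      ⟨b, hb, isPinczonUshirobira_metricBracket D h𝒱 hb, hB⟩, rfl⟩, ?_⟩
  rintro ⟨br, Ω⟩ ⟨-, ⟨b', hb', hbr', hB'⟩, hΩ⟩
  -- The metric is recovered from the symplectic form through `B = -b.flip`.
  have hbb : b' = b := by
    have h1 := (hb'.isShiftedForm_iff h𝒱).1 hB'
    ext x y
    have h2 := LinearMap.congr_fun (LinearMap.congr_fun h1 y) x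
    simpa using h2.symm
  subst hbb
  refine Prod.ext (LinearMap.ext fun Ω₁ => LinearMap.ext fun Ω₂ => cyclicForms_ext h𝒱 ?_)
    (Subtype.ext hΩ)
  rw [onWords_metricBracket D h𝒱]
  exact hbr'.onWords_eq D Ω₁ Ω₂

end Quadratic

end Pinczon

/-! ### The correspondence in both directions -/

theorem mainTheorem9 {K V : Type*} [Field K] [CharZero K] [AddCommGroup V] [Module K V]
    [FiniteDimensional K V] (𝒱 : ℤ → Submodule K V) (h𝒱 : DirectSum.IsInternal 𝒱) :
    (∀ (br : Pinczon.cyclicForms 𝒱 →ₗ[K] Pinczon.cyclicForms 𝒱 →ₗ[K] Pinczon.cyclicForms 𝒱)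
        (Ω : Pinczon.cyclicForms 𝒱), Pinczon.IsCommPinczonAlgebra 𝒱 br Ω →
      (∃! B : V →ₗ[K] V →ₗ[K] K,
        Pinczon.IsSymplectic 𝒱 B ∧ Pinczon.IsFormOfBracket 𝒱 br B) ∧
      ∀ B : V →ₗ[K] V →ₗ[K] K, Pinczon.IsFormOfBracket 𝒱 br B →
        ∃ Q : ∀ n, Pinczon.Op K V n,
          Pinczon.IsCInfinity 𝒱 Q ∧ Pinczon.IsQuadratic 𝒱 B Q ∧
          (Ω : ∀ n, Pinczon.Form K V n) = Pinczon.quadraticForm B Q ∧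
          ∀ Q' : ∀ n, Pinczon.Op K V n,
            (Ω : ∀ n, Pinczon.Form K V n) = Pinczon.quadraticForm B Q' → Q' = Q) ∧
    (∀ b : V →ₗ[K] V →ₗ[K] K, Pinczon.IsMetric 𝒱 b →
      ∀ B : V →ₗ[K] V →ₗ[K] K, Pinczon.IsShiftedForm 𝒱 b B →
      ∀ Q : ∀ n, Pinczon.Op K V n, Pinczon.IsCInfinity 𝒱 Q → Pinczon.IsQuadratic 𝒱 B Q →
        ∃! P : (Pinczon.cyclicForms 𝒱 →ₗ[K] Pinczon.cyclicForms 𝒱 →ₗ[K] Pinczon.cyclicForms 𝒱) ×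
            Pinczon.cyclicForms 𝒱,
          Pinczon.IsCommPinczonAlgebra 𝒱 P.1 P.2 ∧ Pinczon.IsFormOfBracket 𝒱 P.1 B ∧
          (P.2 : ∀ n, Pinczon.Form K V n) = Pinczon.quadraticForm B Q) := by
  exact ⟨fun br Ω h => h.quadratic_cInfinity h𝒱,
    fun b hb B hB Q hQ hq => hQ.existsUnique_pinczon h𝒱 hb hB hq⟩
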